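/- **Setting.** Let $R,G,C,L\ge 0$ and $\lambda_0,\rho,\sigma_g,\sigma_{\nabla g}>0$ be constants. Let $\mathcal W\subset\mathbb R^d$ be closed and convex with $\|\mathbf w\|\le R$ on $\mathcal W$, and let $\ell_1,\dots,\ell_n$ ($n\ge1$) be losses that are convex on $\mathcal W$ and differentiable at the points of $\mathcal W$, with $0\le \ell_i\le C$, $\|\nabla\ell_i\|\le G$ and $\|\nabla\ell_i(\mathbf w)-\nabla\ell_i(\mathbf w')\|\le L\|\mathbf w-\mathbf w'\|$ on $\mathcal W$. Put $\tilde\lambda=\lambda_0+C/\rho$, $\mathcal X=\{\mathbf x=(\mathbf w,\lambda):\mathbf w\in\mathcal W,\ \lambda_0\le\lambda\le\tilde\lambda\}\subset\mathbb R^{d+1}$, $g_i(\mathbf w,\lambda)=\exp(\ell_i(\mathbf w)/\lambda)$, $g=\frac1n\sum_i g_i$, $$F(\mathbf w,\lambda)=\lambda\log g(\mathbf w,\lambda)+(\lambda-\lambda_0)\rho,\qquad F_\mu(\mathbf x)=F(\mathbf x)+\tfrac{\mu}{2}\|\mathbf x\|^2,$$ and assume that $\frac1n\sum_i|g_i(\mathbf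 x)-g(\mathbf x)|^2\le\sigma_g^2$ and $\frac1n\sum_i\|\nabla g_i(\mathbf x)-\nabla g(\mathbf x)\|^2\le\sigma_{\nabla g}^2$ for $\mathbf x\in\mathcal X$. Let $\sigma=\max\{\sigma_g,\sigma_{\nabla g}\}$, $L_g=e^{C/\lambda_0}\big(\frac G{\lambda_0}+\frac C{\lambda_0^2}\big)$, $L_{\nabla g}=\sqrt{L_A^2+L_B^2+L_C^2+L_D^2}$ with $L_A=e^{C/\lambda_0}\big(\frac{G^2}{\lambda_0^2}+\frac L{\lambda_0}\big)$, $L_B=e^{C/\lambda_0}\big(\frac{CG}{\lambda_0^3}+\frac{G}{\lambda_0^2}\big)$, $L_C=e^{C/\lambda_0}\frac{CG+\lambda_0G}{\lambda_0^3}$, $L_D=e^{C/\lambda_0}\frac{C^2+2\lambda_0C}{\lambda_0^4}$, and let $L_F=\tilde\lambda L_g^2+2L_g+\tilde\lambda L_{\nabla g}+1+\tilde\lambda$ and $c=768L_F^2$. **Algorithm (RASCDRO).** Let $\epsilon>0$, $\mu=\epsilon/(2(R^2+\tilde\lambda^2))$, $\mathbf x_1\in\mathcal X$ and $\Delta_\mu\ge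 F_\mu(\mathbf x_1)-\inf_{\mathcal X}F_\mu$. Put $\epsilon_1=\Delta_\mu$, $\epsilon_k=\epsilon_{k-1}/2$, $$\beta_k=\min\Big\{\frac{\mu\epsilon_k}{c\sigma^2},\frac1c\Big\},\quad \eta_k=\min\Big\{\frac{\sqrt{\mu\epsilon_k}}{24cL_F\sigma},\frac1{24cL_F^2}\Big\},\quad T_k=\max\Big\{\frac{192cL_F\sigma}{\mu^{3/2}\sqrt{\epsilon_k}},\frac{192cL_F^2\sigma^2}{\mu\epsilon_k},\frac{192cL_F^2}{\mu}\Big\},$$ with $T_k$ rounded up to a positive integer. All sample indices are drawn independently and uniformly from $\{1,\dots,n\}$. The state $\Lambda_1=(\mathbf x_1,\mathbf v_1,u_1,s_1)$ takes for $\mathbf v_1,u_1,s_1$ the averages of $\partial_{\mathbf w}g_i(\mathbf x_1)$, $\partial_\lambda g_i(\mathbf x_1)$, $g_i(\mathbf x_1)$ over an initial minibatch of $48L_F^2\sigma^2/(\mu\epsilon_1)$ samples (rounded up to a positive integer). Stage $k$ starts at $\Lambda_k$ and, with $\eta=\eta_k$ and $\beta=\beta_k$, performs for $t=1,\dots,T_k$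 the following iteration, where $\mathbf x_t=(\mathbf w_t,\lambda_t)$: $$\mathbf z_t=\Big(\tfrac{\lambda_t}{s_t}\mathbf v_t,\ \tfrac{\lambda_t}{s_t}u_t+\log s_t+\rho\Big)+\mu\mathbf x_t,\qquad \mathbf x_{t+1}=\Pi_{\mathcal X}(\mathbf x_t-\eta\mathbf z_t);$$ draw one sample $i$ and set $$\mathbf v_{t+1}=\partial_{\mathbf w}g_i(\mathbf x_{t+1})+(1-\beta)(\mathbf v_t-\partial_{\mathbf w}g_i(\mathbf x_t)),\quad u_{t+1}=\partial_\lambda g_i(\mathbf x_{t+1})+(1-\beta)(u_t-\partial_\lambda g_i(\mathbf x_t)),\quad s_{t+1}=g_i(\mathbf x_{t+1})+(1-\beta)(s_t-g_i(\mathbf x_t)).$$ It returns $\Lambda_{k+1}=(\mathbf x_\tau,\mathbf v_\tau,u_\tau,s_\tau)$ for an independent uniform $\tau\in\{1,\dots,T_k\}$. After $K$ stages the output is $\mathbf x_K$, the iterate in $\Lambda_K$. (If a tracker $s_t$ happens to vanish or to be negative, the convention is $\lambda/0=0$, $\log 0=0$ and $\log s=\log|s|$.) **Claim.** For every $\Delta_{\max}$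 there are constants $A,B,\epsilon_0>0$, depending only on $R,G,C,L,\lambda_0,\rho,\sigma_g,\sigma_{\nabla g},\Delta_{\max}$ (and not on $d$, $n$, $\mathcal W$, the losses or $\mathbf x_1$), such that for all $0<\epsilon\le\epsilon_0$ and all $\Delta_\mu\in[\epsilon,\Delta_{\max}]$ as above there is a number of stages $1\le K\le A(1+\log_2(\epsilon_1/\epsilon))$ for which the output of RASCDRO satisfies $$\mathbb E\big[F(\mathbf x_K)-\inf_{\mathbf x\in\mathcal X}F(\mathbf x)\big]\le\epsilon,$$ and the total number of samples processed in the initialization and in all $K$ stages is at most $B/\epsilon^2$. -/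

import Mathlib

open MeasureTheory

noncomputable section

namespace DRO

/-- The points `x = (w, lam)` of `ℝ^d × ℝ = ℝ^(d+1)`, with the Euclidean norm. -/
abbrev Point (d : ℕ) : Type := WithLp 2 (EuclideanSpace ℝ (Fin d) × ℝ)

/-- The constants of the problem: `R` bounds the model domain; `G`, `C`, `L` are the Lipschitz
constant, the upper bound and the smoothness constant of the losses; `lam₀` is the weight of the
small KL regularisation and `ρ` the radius of the KL ball; `σg` and `σdg` bound the standard
deviations of the inner function and of its gradient. -/
structure Constants where
  R : ℝ
  G : ℝ
  C : ℝ
  L : ℝ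
  lam₀ : ℝ
  ρ : ℝ
  σg : ℝ
  σdg : ℝ

namespace Constants

structure Admissible (P : Constants) : Prop where
  R_nonneg : 0 ≤ P.R
  G_nonneg : 0 ≤ P.G
  C_nonneg : 0 ≤ P.C
  L_nonneg : 0 ≤ P.L
  lam₀_pos : 0 < P.lam₀
  ρ_pos : 0 < P.ρ
  σg_pos : 0 < P.σg
  σdg_pos : 0 < P.σdg

variable (P : Constants)

/-- The upper bound for the dual variable. -/
def lamMax : ℝ := P.lam₀ + P.C / P.ρ

/-- The Lipschitz constant of the inner functions. -/
def Lg : ℝ := Real.exp (P.C / P.lam₀) * (P.G / P.lam₀ + P.C / P.lam₀ ^ 2)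

def LA : ℝ := Real.exp (P.C / P.lam₀) * (P.G ^ 2 / P.lam₀ ^ 2 + P.L / P.lam₀)

def LB : ℝ := Real.exp (P.C / P.lam₀) * (P.C * P.G / P.lam₀ ^ 3 + P.G / P.lam₀ ^ 2)

def LC : ℝ := Real.exp (P.C / P.lam₀) * ((P.C * P.G + P.lam₀ * P.G) / P.lam₀ ^ 3)

def LD : ℝ := Real.exp (P.C / P.lam₀) * ((P.C ^ 2 + 2 * P.lam₀ * P.C) / P.lam₀ ^ 4)

/-- The smoothness constant of the inner functions. -/
def Ldg : ℝ := Real.sqrt (P.LA ^ 2 + P.LB ^ 2 + P.LC ^ 2 + P.LD ^ 2)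

/-- The smoothness constant of the objective. -/
def LF : ℝ := P.lamMax * P.Lg ^ 2 + 2 * P.Lg + P.lamMax * P.Ldg + 1 + P.lamMax

/-- `σ`, with `σ² = max {σg², σdg²}`. -/
def σ : ℝ := max P.σg P.σdg

/-- The constant `c = 768 L_F²` in the choice of the parameters. -/
def c : ℝ := 768 * P.LF ^ 2

/-- The regularisation parameter `μ = ε / (2 (R² + lamMax²))`. -/
def mu (ε : ℝ) : ℝ := ε / (2 * (P.R ^ 2 + P.lamMax ^ 2))

end Constants

/-- The stagewise target accuracies: `ε_1 = Δ` and `ε_k = ε_{k-1} / 2`. -/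
def stageEps (Δ : ℝ) (k : ℕ) : ℝ := Δ / 2 ^ (k - 1)

section Parameters

variable (P : Constants) (μ : ℝ)

/-- `β_k` as a function of `e = ε_k`. -/
def stageBeta (e : ℝ) : ℝ := min (μ * e / (P.c * P.σ ^ 2)) (1 / P.c)

/-- `η_k` as a function of `e = ε_k`. -/
def stageEta (e : ℝ) : ℝ :=
  min (Real.sqrt (μ * e) / (24 * P.c * P.LF * P.σ)) (1 / (24 * P.c * P.LF ^ 2))

/-- The number `T_k` of iterations as a function of `e = ε_k`, rounded up to a positive integer. -/
def stageLength (e : ℝ) : ℕ :=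
  max 1 ⌈max (max (192 * P.c * P.LF * P.σ / (μ ^ (3 / 2 : ℝ) * Real.sqrt e))
    (192 * P.c * P.LF ^ 2 * P.σ ^ 2 / (μ * e))) (192 * P.c * P.LF ^ 2 / μ)⌉₊

/-- The size of the initial minibatch, as a function of `e = ε_1`, rounded up to a positive
integer. -/
def batchSize (e : ℝ) : ℕ := max 1 ⌈48 * P.LF ^ 2 * P.σ ^ 2 / (μ * e)⌉₊

instance (e : ℝ) : NeZero (stageLength P μ e) :=
  ⟨Nat.one_le_iff_ne_zero.mp (le_max_left _ _)⟩

end Parameters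

section Problem

variable {d n : ℕ}

/-- The domain `X = {(w, lam) | w ∈ W, lam₀ ≤ lam ≤ lamMax}`. -/
def domain (P : Constants) (W : Set (EuclideanSpace ℝ (Fin d))) : Set (Point d) :=
  {x | x.fst ∈ W ∧ P.lam₀ ≤ x.snd ∧ x.snd ≤ P.lamMax}

/-- `g_i(w, lam) = exp (ℓ_i(w) / lam)`. -/
def gi (ℓ : Fin n → EuclideanSpace ℝ (Fin d) → ℝ) (i : Fin n) (x : Point d) : ℝ :=
  Real.exp (ℓ i x.fst / x.snd)

/-- `g(w, lam) = (1/n) ∑ i, exp (ℓ_i(w) / lam)`. -/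
def g (ℓ : Fin n → EuclideanSpace ℝ (Fin d) → ℝ) (x : Point d) : ℝ :=
  (1 / n : ℝ) * ∑ i, gi ℓ i x

/-- The objective `F(w, lam) = lam * log ((1/n) ∑ i, exp (ℓ_i(w) / lam)) + (lam - lam₀) * ρ`. -/
def F (P : Constants) (ℓ : Fin n → EuclideanSpace ℝ (Fin d) → ℝ) (x : Point d) : ℝ :=
  x.snd * Real.log (g ℓ x) + (x.snd - P.lam₀) * P.ρ

/-- The regularised objective `F_μ(x) = F(x) + μ ‖x‖² / 2`. -/
def Fmu (P : Constants) (ℓ : Fin n → EuclideanSpace ℝ (Fin d) → ℝ) (μ : ℝ) (x : Point d) : ℝ :=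
  F P ℓ x + μ * ‖x‖ ^ 2 / 2

/-- The standing assumptions: a nonempty sample, a closed convex domain in the ball of radius `R`,
convex, differentiable, `G`-Lipschitz and `L`-smooth losses with values in `[0, C]`, and the two
variance bounds, for an index `i` that is uniformly distributed on the sample. -/
structure ConvexProblem (P : Constants) (W : Set (EuclideanSpace ℝ (Fin d)))
    (ℓ : Fin n → EuclideanSpace ℝ (Fin d) → ℝ) : Prop where
  closed : IsClosed W
  convex : Convex ℝ W
  norm_le : ∀ w ∈ W, ‖w‖ ≤ P.R
  loss_convex : ∀ i, ConvexOn ℝ W (ℓ i)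
  loss_nonneg : ∀ i, ∀ w ∈ W, 0 ≤ ℓ i w
  loss_le : ∀ i, ∀ w ∈ W, ℓ i w ≤ P.C
  loss_differentiable : ∀ i, ∀ w ∈ W, DifferentiableAt ℝ (ℓ i) w
  loss_lipschitz : ∀ i, ∀ w ∈ W, ‖gradient (ℓ i) w‖ ≤ P.G
  loss_smooth : ∀ i, ∀ w ∈ W, ∀ w' ∈ W,
    ‖gradient (ℓ i) w - gradient (ℓ i) w'‖ ≤ P.L * ‖w - w'‖
  variance : ∀ x ∈ domain P W, (1 / n : ℝ) * ∑ i, (gi ℓ i x - g ℓ x) ^ 2 ≤ P.σg ^ 2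
  variance_gradient : ∀ x ∈ domain P W,
    (1 / n : ℝ) * ∑ i, ‖gradient (gi ℓ i) x - gradient (g ℓ) x‖ ^ 2 ≤ P.σdg ^ 2

open Classical in
/-- The Euclidean projection onto `S`: the point of `S` nearest to `y` (it exists and is unique
when `S` is nonempty, closed and convex). -/
def proj (S : Set (Point d)) (y : Point d) : Point d :=
  if h : ∃ p ∈ S, ∀ q ∈ S, dist y p ≤ dist y q then h.choose else y

end Problem

section Algorithm

variable {d n : ℕ}

/-- The state `(x, v, u, s)`: the iterate and the trackers of the two partial gradients and of the
value of the inner function `g`. -/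
structure State (d : ℕ) where
  x : Point d
  v : EuclideanSpace ℝ (Fin d)
  u : ℝ
  s : ℝ

/-- The gradient estimator
`z = ((lam / s) v, (lam / s) u + log s + ρ) + μ x`, where `x = (w, lam)`. -/
def estimator (P : Constants) (μ : ℝ) (S : State d) : Point d :=
  WithLp.toLp 2 ((S.x.snd / S.s) • S.v, S.x.snd / S.s * S.u + Real.log S.s + P.ρ) + μ • S.x

/-- The state at `x₁` with trackers computed from the minibatch `I`. -/
def initState (ℓ : Fin n → EuclideanSpace ℝ (Fin d) → ℝ) (x₁ : Point d) {b : ℕ}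
    (I : Fin b → Fin n) : State d where
  x := x₁
  v := (1 / b : ℝ) • ∑ j, (gradient (gi ℓ (I j)) x₁).fst
  u := (1 / b : ℝ) * ∑ j, (gradient (gi ℓ (I j)) x₁).snd
  s := (1 / b : ℝ) * ∑ j, gi ℓ (I j) x₁

/-- One iteration of ASCDRO with step size `η`, momentum `β` and sample `i`: a projected step
along the gradient estimator, then the recursive variance-reduced updates of the trackers. -/
def step (P : Constants) (W : Set (EuclideanSpace ℝ (Fin d)))
    (ℓ : Fin n → EuclideanSpace ℝ (Fin d) → ℝ) (μ η β : ℝ) (i : Fin n) (S : State d) : State d :=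
  let x' := proj (domain P W) (S.x - η • estimator P μ S)
  { x := x'
    v := (gradient (gi ℓ i) x').fst + (1 - β) • (S.v - (gradient (gi ℓ i) S.x).fst)
    u := (gradient (gi ℓ i) x').snd + (1 - β) * (S.u - (gradient (gi ℓ i) S.x).snd)
    s := gi ℓ i x' + (1 - β) * (S.s - gi ℓ i S.x) }

/-- The states `Λ_1, …, Λ_{T+1}` (numbered from `0` here) that ASCDRO runs through on the samples
`ξ_1, …, ξ_T`, from the state `S`. -/
def trajectory (P : Constants) (W : Set (EuclideanSpace ℝ (Fin d)))
    (ℓ : Fin n → EuclideanSpace ℝ (Fin d) → ℝ) (μ η β : ℝ) (S : State d) {T : ℕ}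
    (ξ : Fin T → Fin n) : Fin (T + 1) → State d :=
  Fin.induction (motive := fun _ => State d) S (fun t S' => step P W ℓ μ η β (ξ t) S')

variable [NeZero n]

/-- The law of the output of `T` iterations of ASCDRO from the state `S`: `T` independent uniform
samples are drawn, and the state number `τ` is returned, for a uniform `τ ∈ {1, …, T}`. The second
component of the argument and of the result counts the samples processed so far. -/
def ascdro (P : Constants) (W : Set (EuclideanSpace ℝ (Fin d)))
    (ℓ : Fin n → EuclideanSpace ℝ (Fin d) → ℝ) (μ η β : ℝ) (T : ℕ) [NeZero T]
    (S : State d × ℕ) : PMF (State d × ℕ) :=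
  (PMF.uniformOfFintype (Fin T → Fin n)).bind fun ξ =>
    (PMF.uniformOfFintype (Fin T)).map fun τ =>
      (trajectory P W ℓ μ η β S.1 ξ τ.castSucc, S.2 + T)

/-- Stage `k` of the restarted method. -/
def stage (P : Constants) (W : Set (EuclideanSpace ℝ (Fin d)))
    (ℓ : Fin n → EuclideanSpace ℝ (Fin d) → ℝ) (μ Δ : ℝ) (k : ℕ)
    (S : State d × ℕ) : PMF (State d × ℕ) :=
  ascdro P W ℓ μ (stageEta P μ (stageEps Δ k)) (stageBeta P μ (stageEps Δ k))
    (stageLength P μ (stageEps Δ k)) S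

/-- The joint law of `Λ_{m+1}`, the state after the stages `1, …, m`, and of the number of samples
processed until then. The initial minibatch is drawn uniformly and independently. -/
def stages (P : Constants) (W : Set (EuclideanSpace ℝ (Fin d)))
    (ℓ : Fin n → EuclideanSpace ℝ (Fin d) → ℝ) (μ Δ : ℝ) (x₁ : Point d) :
    ℕ → PMF (State d × ℕ)
  | 0 => (PMF.uniformOfFintype (Fin (batchSize P μ (stageEps Δ 1)) → Fin n)).map fun I =>
      (initState ℓ x₁ I, batchSize P μ (stageEps Δ 1))
  | m + 1 => (stages P W ℓ μ Δ x₁ m).bind (stage P W ℓ μ Δ (m + 1))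

/-- The restarted method with `K ≥ 1` stages: the joint law of its output `x_K`, the iterate in
`Λ_K`, and of the number of samples processed in all `K` stages and the initialisation. -/
def rascdro (P : Constants) (W : Set (EuclideanSpace ℝ (Fin d)))
    (ℓ : Fin n → EuclideanSpace ℝ (Fin d) → ℝ) (μ Δ : ℝ) (x₁ : Point d) (K : ℕ) :
    PMF (Point d × ℕ) :=
  (stages P W ℓ μ Δ x₁ (K - 1)).bind fun S =>
    (stage P W ℓ μ Δ K S).map fun S' => (S.1.x, S'.2)

end Algorithm

end DRO

end

noncomputable section

namespace DRO

variable {d n : ℕ} {P : Constants} {W : Set (EuclideanSpace ℝ (Fin d))}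
  {ℓ : Fin n → EuclideanSpace ℝ (Fin d) → ℝ}

/-! ### Elementary inequalities -/

/-! `F` is, up to an affine term, the perspective of a log-mean-exp, hence convex, and its gradient
is Lipschitz on the domain; `Fmu` is moreover μ-strongly convex (`Fmu_lower`, `Fmu_upper`). The
method is projected gradient descent with an inexact gradient. As long as the weighted tracking
error `State.err` has norm at most 1/2, the value tracker stays above 1/2, and the squared gradient
error is at most 16 times the squared tracking error (`norm_estimator_sub_sq_le`).

On such good states three facts combine: the squared tracking error contracts by 1 − β up to noise
of variance O(β² + ‖x' − x‖²), the descent inequality pays for ‖x' − x‖², and strong convexity gives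
progress towards the minimizer. Hence `potential` decreases in mean by `merit`, up to O(β/μ)
(`avg_potential_step_le`), while it is at most T/3 times the merit (`potential_le`). Averaging over
a stage, which is what the random index does, divides the merit by three up to a small multiple of
ε_k, so that the expected merit at the start of stage k stays below 2ε_k.

Nothing forces the states to remain good, and near s = 0 the estimator is uncontrolled. The function
`lyapunov` is at least 1 on bad states and grows in mean by only O(η⁶) per step on good ones
(`avg_lyapunov_step_le`). With q = √(με_1), all step sizes are O(q), the base of the cube in
`lyapunov` starts at order q, and the cube makes the initial value and the total growth O(q³) = O(q
· με_1) = O(qε). The square would give O(ε) without the spare small factor q. As the gap is bounded,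
bad states cost at most ε/4 for small ε. `cumulative_le` merges both arguments without stopping
times, and `expectation_stages_le` iterates the result over the stages.

The run stops at a stage with ε/8 ≤ ε_K ≤ ε/4. The error is then at most 2ε_K ≤ ε/2, plus ε/4 for
bad states, plus ε/4 for the regularisation. Stage k takes O(1/(μ√(με_k))) samples; the sum is
geometric and dominated by its last term, where √(με_K) is at least of order μ. This gives O(1/μ²) =
O(1/ε²) samples. -/

theorem abs_exp_sub_exp_le {x y M : ℝ} (hx : x ≤ M) (hy : y ≤ M) :
    |Real.exp x - Real.exp y| ≤ Real.exp M * |x - y| := by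
  wlog h : y ≤ x generalizing x y
  · rw [abs_sub_comm, abs_sub_comm x]; exact this hy hx (le_of_not_ge h)
  rw [abs_of_nonneg (sub_nonneg.2 (Real.exp_le_exp.2 h)), abs_of_nonneg (sub_nonneg.2 h)]
  have h1 : Real.exp y = Real.exp x * Real.exp (y - x) := by rw [← Real.exp_add]; ring_nf
  have h2 := Real.add_one_le_exp (y - x)
  have h3 := Real.exp_le_exp.2 hx
  have h4 := Real.exp_pos x
  nlinarith

theorem norm_sq_le_of_fst_snd {E : Type*} [NormedAddCommGroup E] {x : WithLp 2 (E × ℝ)} {a b : ℝ}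
    (h1 : ‖x.fst‖ ≤ a) (h2 : |x.snd| ≤ b) : ‖x‖ ^ 2 ≤ a ^ 2 + b ^ 2 := by
  rw [WithLp.prod_norm_sq_eq_of_L2, Real.norm_eq_abs]
  have := norm_nonneg x.fst
  have := abs_nonneg x.snd
  gcongr

theorem norm_fst_le {E : Type*} [NormedAddCommGroup E] (x : WithLp 2 (E × ℝ)) : ‖x.fst‖ ≤ ‖x‖ := by
  refine le_of_sq_le_sq ?_ (norm_nonneg _)
  rw [WithLp.prod_norm_sq_eq_of_L2]
  nlinarith [sq_nonneg ‖x.snd‖]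

theorem abs_snd_le {E : Type*} [NormedAddCommGroup E] (x : WithLp 2 (E × ℝ)) : |x.snd| ≤ ‖x‖ := by
  refine le_of_sq_le_sq ?_ (norm_nonneg _)
  rw [WithLp.prod_norm_sq_eq_of_L2, Real.norm_eq_abs]
  nlinarith [sq_nonneg ‖x.fst‖]

/-! ### The constants -/

namespace Constants

theorem Admissible.lamMax_ge (hP : P.Admissible) : P.lam₀ ≤ P.lamMax :=
  le_add_of_nonneg_right (div_nonneg hP.C_nonneg hP.ρ_pos.le)

theorem Admissible.lamMax_pos (hP : P.Admissible) : 0 < P.lamMax := hP.lam₀_pos.trans_le hP.lamMax_ge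

theorem Admissible.Lg_nonneg (hP : P.Admissible) : 0 ≤ P.Lg := by
  have := hP.G_nonneg
  have := hP.C_nonneg
  have := hP.lam₀_pos
  unfold Lg
  positivity

theorem Ldg_nonneg : 0 ≤ P.Ldg := Real.sqrt_nonneg _

/-- The left side adds the Lipschitz constants of the two components of `sample`: the gradient with
weight `lamMax` and the value with weight `lamMax * Lg + 1`. -/
theorem Admissible.LF_ge (hP : P.Admissible) :
    P.lamMax * P.Ldg + (P.lamMax * P.Lg + 1) * P.Lg ≤ P.LF := by
  have := hP.Lg_nonneg
  have := hP.lamMax_pos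
  unfold LF
  nlinarith

theorem Admissible.one_le_LF (hP : P.Admissible) : 1 ≤ P.LF := by
  have h1 := hP.Lg_nonneg
  have h2 := hP.lamMax_pos
  have h3 := P.Ldg_nonneg
  unfold LF
  have := mul_nonneg h2.le h3
  have := mul_nonneg h2.le (sq_nonneg P.Lg)
  linarith

theorem Admissible.lamMax_le_LF (hP : P.Admissible) : P.lamMax ≤ P.LF := by
  have h1 := hP.Lg_nonneg
  have h2 := hP.lamMax_pos
  have h3 := P.Ldg_nonneg
  unfold LF
  have := mul_nonneg h2.le h3
  have := mul_nonneg h2.le (sq_nonneg P.Lg)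
  linarith

theorem Admissible.lamMax_mul_Lg_le (hP : P.Admissible) : P.lamMax * P.Lg + 1 ≤ P.LF := by
  have h1 := hP.Lg_nonneg
  have h2 := hP.lamMax_pos
  have h3 := P.Ldg_nonneg
  unfold LF
  have := mul_nonneg h2.le h3
  -- The last summand `lamMax` of `LF` serves here: `lamMax * Lg ^ 2 + lamMax ≥ 2 * lamMax * Lg`.
  have := mul_nonneg h2.le (sq_nonneg (P.Lg - 1))
  nlinarith

theorem Admissible.σ_pos (hP : P.Admissible) : 0 < P.σ := lt_max_of_lt_left hP.σg_pos

end Constants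

/-! ### The inner functions and their gradients -/

/-- The gradient of `gi ℓ i`. -/
def giGrad (ℓ : Fin n → EuclideanSpace ℝ (Fin d) → ℝ) (i : Fin n) (x : Point d) : Point d :=
  WithLp.toLp 2 ((gi ℓ i x / x.snd) • gradient (ℓ i) x.fst, -(gi ℓ i x * ℓ i x.fst / x.snd ^ 2))

theorem hasGradientAt_gi {i : Fin n} {x : Point d} (h1 : DifferentiableAt ℝ (ℓ i) x.fst)
    (h2 : x.snd ≠ 0) : HasGradientAt (gi ℓ i) (giGrad ℓ i x) x := by
  rw [hasGradientAt_iff_hasFDerivAt]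
  have e1 : HasFDerivAt (fun y : Point d => ℓ i y.fst) _ x :=
    HasFDerivAt.comp x (g := ℓ i) h1.hasGradientAt.hasFDerivAt
      (WithLp.fstL 2 ℝ (EuclideanSpace ℝ (Fin d)) ℝ).hasFDerivAt
  have e2 : HasFDerivAt (fun y : Point d => y.snd) _ x :=
    (WithLp.sndL 2 ℝ (EuclideanSpace ℝ (Fin d)) ℝ).hasFDerivAt
  have e3 := (e1.mul ((hasDerivAt_inv h2).comp_hasFDerivAt x e2)).exp
  refine HasFDerivAt.congr_fderiv (e3.congr_of_eventuallyEq ?_) ?_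
  · filter_upwards with y
    simp [gi, div_eq_mul_inv]
  · ext y
    simp [giGrad, gi, WithLp.prod_inner_apply, inner_smul_left, div_eq_mul_inv]
    field_simp
    ring

namespace ConvexProblem

variable (hP : P.Admissible) (hℓ : ConvexProblem P W ℓ)
include hP hℓ

omit hℓ in
theorem snd_pos {x : Point d} (hx : x ∈ domain P W) : 0 < x.snd := hP.lam₀_pos.trans_le hx.2.1

theorem gradient_gi {x : Point d} (hx : x ∈ domain P W) (i : Fin n) :
    gradient (gi ℓ i) x = giGrad ℓ i x :=
  (hasGradientAt_gi (hℓ.loss_differentiable i _ hx.1) (snd_pos hP hx).ne').gradient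

theorem hasGradientAt {x : Point d} (hx : x ∈ domain P W) (i : Fin n) :
    HasGradientAt (gi ℓ i) (gradient (gi ℓ i) x) x := by
  rw [hℓ.gradient_gi hP hx]
  exact hasGradientAt_gi (hℓ.loss_differentiable i _ hx.1) (snd_pos hP hx).ne'

omit hP in
theorem convex_domain : Convex ℝ (domain P W) := by
  intro x hx y hy a b ha hb hab
  refine ⟨hℓ.convex hx.1 hy.1 ha hb hab, ?_, ?_⟩
  · exact (convex_Icc P.lam₀ P.lamMax ⟨hx.2.1, hx.2.2⟩ ⟨hy.2.1, hy.2.2⟩ ha hb hab).1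
  · exact (convex_Icc P.lam₀ P.lamMax ⟨hx.2.1, hx.2.2⟩ ⟨hy.2.1, hy.2.2⟩ ha hb hab).2

omit hP in
theorem isClosed_domain : IsClosed (domain P W) := by
  have h1 : Continuous fun x : Point d => x.fst :=
    (WithLp.fstL 2 ℝ (EuclideanSpace ℝ (Fin d)) ℝ).continuous
  have h2 : Continuous fun x : Point d => x.snd :=
    (WithLp.sndL 2 ℝ (EuclideanSpace ℝ (Fin d)) ℝ).continuous
  exact (hℓ.closed.preimage h1).inter
    ((isClosed_le continuous_const h2).inter (isClosed_le h2 continuous_const))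

theorem norm_sq_le {x : Point d} (hx : x ∈ domain P W) : ‖x‖ ^ 2 ≤ P.R ^ 2 + P.lamMax ^ 2 := by
  refine norm_sq_le_of_fst_snd (hℓ.norm_le _ hx.1) ?_
  rw [abs_of_pos (snd_pos hP hx)]
  exact hx.2.2

theorem div_le {x : Point d} (hx : x ∈ domain P W) (i : Fin n) : ℓ i x.fst / x.snd ≤ P.C / P.lam₀ :=
  div_le_div₀ hP.C_nonneg (hℓ.loss_le i _ hx.1) hP.lam₀_pos hx.2.1

theorem one_le_gi {x : Point d} (hx : x ∈ domain P W) (i : Fin n) : 1 ≤ gi ℓ i x :=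
  Real.one_le_exp (div_nonneg (hℓ.loss_nonneg i _ hx.1) (snd_pos hP hx).le)

theorem gi_le {x : Point d} (hx : x ∈ domain P W) (i : Fin n) : gi ℓ i x ≤ Real.exp (P.C / P.lam₀) :=
  Real.exp_le_exp.2 (hℓ.div_le hP hx i)

theorem norm_giGrad_le {x : Point d} (hx : x ∈ domain P W) (i : Fin n) : ‖giGrad ℓ i x‖ ≤ P.Lg := by
  have h0 := hP.lam₀_pos
  have hC := hP.C_nonneg
  have hG := hP.G_nonneg
  have hg := hℓ.gi_le hP hx i
  have hg0 := (zero_lt_one.trans_le (hℓ.one_le_gi hP hx i)).le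
  have hl := hℓ.loss_nonneg i _ hx.1
  have hs := snd_pos hP hx
  refine le_of_sq_le_sq ?_ hP.Lg_nonneg
  have a1 : ‖(giGrad ℓ i x).fst‖ ≤ Real.exp (P.C / P.lam₀) * (P.G / P.lam₀) := by
    show ‖(gi ℓ i x / x.snd) • gradient (ℓ i) x.fst‖ ≤ _
    rw [norm_smul, Real.norm_of_nonneg (by positivity), div_mul_eq_mul_div, mul_div_assoc']
    have := hℓ.loss_lipschitz i _ hx.1
    have := hx.2.1
    gcongr
  have a2 : |(giGrad ℓ i x).snd| ≤ Real.exp (P.C / P.lam₀) * (P.C / P.lam₀ ^ 2) := by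
    show |-(gi ℓ i x * ℓ i x.fst / x.snd ^ 2)| ≤ _
    rw [abs_neg, abs_of_nonneg (by positivity), mul_div_assoc']
    have := hℓ.loss_le i _ hx.1
    have := hx.2.1
    gcongr
  refine (norm_sq_le_of_fst_snd a1 a2).trans ?_
  have : 0 ≤ Real.exp (P.C / P.lam₀) * (P.G / P.lam₀) := by positivity
  have : 0 ≤ Real.exp (P.C / P.lam₀) * (P.C / P.lam₀ ^ 2) := by positivity
  unfold Constants.Lg
  nlinarith

theorem abs_gi_sub_le {x y : Point d} (hx : x ∈ domain P W) (hy : y ∈ domain P W) (i : Fin n) :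
    |gi ℓ i x - gi ℓ i y| ≤ P.Lg * ‖x - y‖ := by
  refine hℓ.convex_domain.norm_image_sub_le_of_norm_hasFDerivWithin_le (𝕜 := ℝ)
    (fun z hz => (hℓ.hasGradientAt hP hz i).hasFDerivAt.hasFDerivWithinAt) ?_ hy hx
  intro z hz
  rw [LinearIsometryEquiv.norm_map, hℓ.gradient_gi hP hz]
  exact hℓ.norm_giGrad_le hP hz i

omit hP in
theorem abs_loss_sub_le {w v : EuclideanSpace ℝ (Fin d)} (hw : w ∈ W) (hv : v ∈ W) (i : Fin n) :
    |ℓ i w - ℓ i v| ≤ P.G * ‖w - v‖ := by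
  refine hℓ.convex.norm_image_sub_le_of_norm_hasFDerivWithin_le (𝕜 := ℝ)
    (fun z hz => (hℓ.loss_differentiable i z hz).hasGradientAt.hasFDerivAt.hasFDerivWithinAt)
    ?_ hv hw
  intro z hz
  rw [LinearIsometryEquiv.norm_map]
  exact hℓ.loss_lipschitz i z hz

end ConvexProblem

end DRO

namespace DRO

variable {d n : ℕ} {P : Constants} {W : Set (EuclideanSpace ℝ (Fin d))}
  {ℓ : Fin n → EuclideanSpace ℝ (Fin d) → ℝ}

/-! ### Smoothness of the inner functions -/

/-- In the variable r = 1/λ, which ranges over [0, K] with K = 1/λ₀, the inner functions and the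
coefficients of their gradients are elementary. This estimate and the next two bound their variation
in r. -/
theorem abs_exp_mul_sub_le {a C r s K : ℝ} (ha : 0 ≤ a) (haC : a ≤ C) (hr : r ≤ K)
    (hs : s ≤ K) (hK : 0 ≤ K) :
    |Real.exp (a * r) - Real.exp (a * s)| ≤ Real.exp (C * K) * (C * |r - s|) := by
  have h1 : a * r ≤ C * K := (mul_le_mul_of_nonneg_left hr ha).trans
    (mul_le_mul_of_nonneg_right haC hK)
  have h2 : a * s ≤ C * K := (mul_le_mul_of_nonneg_left hs ha).trans
    (mul_le_mul_of_nonneg_right haC hK)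
  refine (abs_exp_sub_exp_le h1 h2).trans ?_
  rw [← mul_sub, abs_mul, abs_of_nonneg ha]
  gcongr

theorem abs_mul_exp_sub_le {a C r s K : ℝ} (ha : 0 ≤ a) (haC : a ≤ C) (hr : r ≤ K)
    (hs0 : 0 ≤ s) (hs : s ≤ K) :
    |r * Real.exp (a * r) - s * Real.exp (a * s)|
      ≤ Real.exp (C * K) * (1 + C * K) * |r - s| := by
  have hK : 0 ≤ K := hs0.trans hs
  have hC : 0 ≤ C := ha.trans haC
  have h1 : Real.exp (a * r) ≤ Real.exp (C * K) := Real.exp_le_exp.2 <|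
    (mul_le_mul_of_nonneg_left hr ha).trans (mul_le_mul_of_nonneg_right haC hK)
  calc |r * Real.exp (a * r) - s * Real.exp (a * s)|
      = |(r - s) * Real.exp (a * r) + s * (Real.exp (a * r) - Real.exp (a * s))| := by ring_nf
    _ ≤ |r - s| * Real.exp (a * r) + s * |Real.exp (a * r) - Real.exp (a * s)| := by
        refine (abs_add_le _ _).trans ?_
        rw [abs_mul, abs_mul, abs_of_nonneg hs0, abs_of_pos (Real.exp_pos _)]
    _ ≤ |r - s| * Real.exp (C * K) + K * (Real.exp (C * K) * (C * |r - s|)) := by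
        gcongr
        exact abs_exp_mul_sub_le ha haC hr hs hK
    _ = _ := by ring

theorem abs_mul_sq_mul_exp_sub_le {a C r s K : ℝ} (ha : 0 ≤ a) (haC : a ≤ C) (hr0 : 0 ≤ r)
    (hr : r ≤ K) (hs0 : 0 ≤ s) (hs : s ≤ K) :
    |a * r ^ 2 * Real.exp (a * r) - a * s ^ 2 * Real.exp (a * s)|
      ≤ Real.exp (C * K) * (C ^ 2 * K ^ 2 + 2 * C * K) * |r - s| := by
  have hK : 0 ≤ K := hs0.trans hs
  have hC : 0 ≤ C := ha.trans haC
  have h1 : Real.exp (a * r) ≤ Real.exp (C * K) := Real.exp_le_exp.2 <|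
    (mul_le_mul_of_nonneg_left hr ha).trans (mul_le_mul_of_nonneg_right haC hK)
  calc |a * r ^ 2 * Real.exp (a * r) - a * s ^ 2 * Real.exp (a * s)|
      = |a * (r + s) * Real.exp (a * r) * (r - s)
          + a * s ^ 2 * (Real.exp (a * r) - Real.exp (a * s))| := by ring_nf
    _ ≤ a * (r + s) * Real.exp (a * r) * |r - s|
          + a * s ^ 2 * |Real.exp (a * r) - Real.exp (a * s)| := by
        refine (abs_add_le _ _).trans ?_
        rw [abs_mul, abs_mul (a * s ^ 2), abs_of_nonneg (a := a * s ^ 2) (by positivity),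
          abs_of_nonneg (a := a * (r + s) * Real.exp (a * r)) (by positivity)]
    _ ≤ C * (K + K) * Real.exp (C * K) * |r - s|
          + C * K ^ 2 * (Real.exp (C * K) * (C * |r - s|)) := by
        gcongr
        exact abs_exp_mul_sub_le ha haC hr hs hK
    _ = _ := by ring

theorem abs_inv_sub_inv_le {a b c : ℝ} (hc : 0 < c) (ha : c ≤ a) (hb : c ≤ b) :
    |a⁻¹ - b⁻¹| ≤ |a - b| / c ^ 2 := by
  have ha' := hc.trans_le ha
  have hb' := hc.trans_le hb
  rw [inv_sub_inv ha'.ne' hb'.ne', abs_div, abs_sub_comm, abs_of_pos (mul_pos ha' hb'), sq]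
  gcongr

namespace ConvexProblem

variable (hP : P.Admissible) (hℓ : ConvexProblem P W ℓ)
include hP hℓ

/-- Variation in w alone. Differences replace second derivatives, since the losses have only
Lipschitz gradients. -/
theorem norm_giGrad_sub_le_of_snd_eq {w v : EuclideanSpace ℝ (Fin d)} {t : ℝ} (hw : w ∈ W)
    (hv : v ∈ W) (ht : P.lam₀ ≤ t) (i : Fin n) :
    ‖(giGrad ℓ i (WithLp.toLp 2 (w, t))).fst - (giGrad ℓ i (WithLp.toLp 2 (v, t))).fst‖
        ≤ P.LA * ‖w - v‖ ∧
      |(giGrad ℓ i (WithLp.toLp 2 (w, t))).snd - (giGrad ℓ i (WithLp.toLp 2 (v, t))).snd|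
        ≤ P.LC * ‖w - v‖ := by
  have h0 := hP.lam₀_pos
  have hC := hP.C_nonneg
  have hG := hP.G_nonneg
  have hL := hP.L_nonneg
  have ht0 := h0.trans_le ht
  set a := ℓ i w
  set b := ℓ i v
  have ha0 : 0 ≤ a := hℓ.loss_nonneg i w hw
  have hb0 : 0 ≤ b := hℓ.loss_nonneg i v hv
  have ha : a ≤ P.C := hℓ.loss_le i w hw
  have hb : b ≤ P.C := hℓ.loss_le i v hv
  have hab : |a - b| ≤ P.G * ‖w - v‖ := hℓ.abs_loss_sub_le hw hv i
  have hat : a / t ≤ P.C / P.lam₀ := div_le_div₀ hC ha h0 ht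
  have hbt : b / t ≤ P.C / P.lam₀ := div_le_div₀ hC hb h0 ht
  set E := Real.exp (P.C / P.lam₀)
  have hE : |Real.exp (a / t) - Real.exp (b / t)| ≤ E * (P.G * ‖w - v‖ / P.lam₀) := by
    refine (abs_exp_sub_exp_le hat hbt).trans ?_
    rw [← sub_div, abs_div, abs_of_pos ht0]
    gcongr
  have hEb : Real.exp (b / t) ≤ E := Real.exp_le_exp.2 hbt
  have hGw := hℓ.loss_lipschitz i w hw
  constructor
  · show ‖(Real.exp (a / t) / t) • gradient (ℓ i) w - (Real.exp (b / t) / t) • gradient (ℓ i) v‖ ≤ _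
    have e : (Real.exp (a / t) / t) • gradient (ℓ i) w - (Real.exp (b / t) / t) • gradient (ℓ i) v
        = ((Real.exp (a / t) - Real.exp (b / t)) / t) • gradient (ℓ i) w
          + (Real.exp (b / t) / t) • (gradient (ℓ i) w - gradient (ℓ i) v) := by
      rw [smul_sub, sub_div, sub_smul]; abel
    rw [e]
    calc _ ≤ |Real.exp (a / t) - Real.exp (b / t)| / t * ‖gradient (ℓ i) w‖
          + Real.exp (b / t) / t * ‖gradient (ℓ i) w - gradient (ℓ i) v‖ := by
          refine (norm_add_le _ _).trans ?_
          rw [norm_smul, norm_smul, Real.norm_eq_abs, Real.norm_eq_abs, abs_div, abs_div,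
            abs_of_pos ht0, Real.abs_exp]
      _ ≤ E * (P.G * ‖w - v‖ / P.lam₀) / P.lam₀ * P.G + E / P.lam₀ * (P.L * ‖w - v‖) := by
          have := hℓ.loss_smooth i w hw v hv
          gcongr
      _ = _ := by unfold Constants.LA; field_simp; try ring
  · show |-(Real.exp (a / t) * a / t ^ 2) - -(Real.exp (b / t) * b / t ^ 2)| ≤ _
    have e : -(Real.exp (a / t) * a / t ^ 2) - -(Real.exp (b / t) * b / t ^ 2)
        = -((Real.exp (a / t) - Real.exp (b / t)) * a + Real.exp (b / t) * (a - b)) / t ^ 2 := by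
      ring
    rw [e, abs_div, abs_neg, abs_of_pos (by positivity : 0 < t ^ 2)]
    calc _ ≤ (|Real.exp (a / t) - Real.exp (b / t)| * a + Real.exp (b / t) * |a - b|) / t ^ 2 := by
          gcongr
          refine (abs_add_le _ _).trans ?_
          rw [abs_mul, abs_mul, Real.abs_exp, abs_of_nonneg ha0]
      _ ≤ (E * (P.G * ‖w - v‖ / P.lam₀) * P.C + E * (P.G * ‖w - v‖)) / P.lam₀ ^ 2 := by gcongr
      _ = _ := by unfold Constants.LC; field_simp; try ring

/-- Variation in λ alone: the estimates in r = 1/λ, followed by |1/t − 1/s| ≤ |t − s|/λ₀². -/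
theorem norm_giGrad_sub_le_of_fst_eq {v : EuclideanSpace ℝ (Fin d)} {t s : ℝ}
    (hv : v ∈ W) (ht : P.lam₀ ≤ t) (hs : P.lam₀ ≤ s) (i : Fin n) :
    ‖(giGrad ℓ i (WithLp.toLp 2 (v, t))).fst - (giGrad ℓ i (WithLp.toLp 2 (v, s))).fst‖
        ≤ P.LB * |t - s| ∧
      |(giGrad ℓ i (WithLp.toLp 2 (v, t))).snd - (giGrad ℓ i (WithLp.toLp 2 (v, s))).snd|
        ≤ P.LD * |t - s| := by
  have h0 := hP.lam₀_pos
  have hC := hP.C_nonneg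
  have hG := hP.G_nonneg
  have ht0 := h0.trans_le ht
  have hs0 := h0.trans_le hs
  set a := ℓ i v
  have ha0 : 0 ≤ a := hℓ.loss_nonneg i v hv
  have ha : a ≤ P.C := hℓ.loss_le i v hv
  have hGw := hℓ.loss_lipschitz i v hv
  have hK := abs_inv_sub_inv_le h0 ht hs
  have htK : t⁻¹ ≤ P.lam₀⁻¹ := inv_anti₀ h0 ht
  have hsK : s⁻¹ ≤ P.lam₀⁻¹ := inv_anti₀ h0 hs
  have ht' := inv_pos.2 ht0
  have hs' := inv_pos.2 hs0
  have h0' := inv_pos.2 h0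
  constructor
  · show ‖(Real.exp (a / t) / t) • gradient (ℓ i) v - (Real.exp (a / s) / s) • gradient (ℓ i) v‖ ≤ _
    rw [← sub_smul, norm_smul, Real.norm_eq_abs]
    have key := abs_mul_exp_sub_le ha0 ha htK hs'.le hsK
    calc _ = |t⁻¹ * Real.exp (a * t⁻¹) - s⁻¹ * Real.exp (a * s⁻¹)| * ‖gradient (ℓ i) v‖ := by
          simp only [div_eq_mul_inv, mul_comm]
      _ ≤ Real.exp (P.C * P.lam₀⁻¹) * (1 + P.C * P.lam₀⁻¹) * (|t - s| / P.lam₀ ^ 2) * P.G := by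
          refine mul_le_mul (key.trans ?_) hGw (norm_nonneg _) (by positivity)
          gcongr
      _ = _ := by unfold Constants.LB; rw [div_eq_mul_inv P.C]; field_simp; try ring
  · show |-(Real.exp (a / t) * a / t ^ 2) - -(Real.exp (a / s) * a / s ^ 2)| ≤ _
    have key := abs_mul_sq_mul_exp_sub_le ha0 ha ht'.le htK hs'.le hsK
    calc _ = |a * t⁻¹ ^ 2 * Real.exp (a * t⁻¹) - a * s⁻¹ ^ 2 * Real.exp (a * s⁻¹)| := by
          rw [neg_sub_neg, abs_sub_comm]
          simp only [div_eq_mul_inv, inv_pow]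
          congr 1
          ring
      _ ≤ Real.exp (P.C * P.lam₀⁻¹) * (P.C ^ 2 * P.lam₀⁻¹ ^ 2 + 2 * P.C * P.lam₀⁻¹)
            * (|t - s| / P.lam₀ ^ 2) := by
          refine key.trans ?_
          gcongr
      _ = _ := by unfold Constants.LD; rw [div_eq_mul_inv P.C]; field_simp; try ring

theorem norm_giGrad_sub_le {x y : Point d} (hx : x ∈ domain P W) (hy : y ∈ domain P W)
    (i : Fin n) : ‖giGrad ℓ i x - giGrad ℓ i y‖ ≤ P.Ldg * ‖x - y‖ := by
  obtain ⟨a1, a2⟩ := hℓ.norm_giGrad_sub_le_of_snd_eq hP hx.1 hy.1 hx.2.1 i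
  obtain ⟨b1, b2⟩ := hℓ.norm_giGrad_sub_le_of_fst_eq hP hy.1 hx.2.1 hy.2.1 i
  -- The passage from x to y changes one coordinate at a time.
  set z : Point d := WithLp.toLp 2 (y.fst, x.snd)
  have ex : WithLp.toLp 2 (x.fst, x.snd) = x := rfl
  have ey : WithLp.toLp 2 (y.fst, y.snd) = y := rfl
  rw [ex] at a1 a2
  rw [ey] at b1 b2
  have h1 : ‖(giGrad ℓ i x - giGrad ℓ i y).fst‖
      ≤ P.LA * ‖x.fst - y.fst‖ + P.LB * |x.snd - y.snd| := by
    rw [WithLp.sub_fst, ← sub_add_sub_cancel _ (giGrad ℓ i z).fst]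
    exact (norm_add_le _ _).trans (add_le_add a1 b1)
  have h2 : |(giGrad ℓ i x - giGrad ℓ i y).snd|
      ≤ P.LC * ‖x.fst - y.fst‖ + P.LD * |x.snd - y.snd| := by
    rw [WithLp.sub_snd, ← sub_add_sub_cancel _ (giGrad ℓ i z).snd]
    exact (abs_add_le _ _).trans (add_le_add a2 b2)
  refine le_of_sq_le_sq ?_ (mul_nonneg P.Ldg_nonneg (norm_nonneg _))
  refine (norm_sq_le_of_fst_snd h1 h2).trans ?_
  rw [mul_pow, WithLp.prod_norm_sq_eq_of_L2 (x - y), Constants.Ldg, Real.sq_sqrt (by positivity),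
    WithLp.sub_fst, WithLp.sub_snd, Real.norm_eq_abs]
  -- Cauchy–Schwarz for each row of the matrix (LA, LB; LC, LD), whose Frobenius norm is `Ldg`.
  nlinarith [sq_nonneg (P.LA * |x.snd - y.snd| - P.LB * ‖x.fst - y.fst‖),
    sq_nonneg (P.LC * |x.snd - y.snd| - P.LD * ‖x.fst - y.fst‖)]

end ConvexProblem

end DRO

namespace DRO

variable {d n : ℕ} {P : Constants} {W : Set (EuclideanSpace ℝ (Fin d))}
  {ℓ : Fin n → EuclideanSpace ℝ (Fin d) → ℝ}

/-! ### First-order convexity -/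

/-- Restriction to the segment reduces this to the slope inequality for convex functions of one real
variable. The point x may lie on the boundary of S. -/
theorem add_inner_le_of_convexOn {E : Type*} [NormedAddCommGroup E] [InnerProductSpace ℝ E]
    [CompleteSpace E] {S : Set E} {f : E → ℝ} {f' x y : E} (hf : ConvexOn ℝ S f)
    (hx : x ∈ S) (hy : y ∈ S) (h : HasGradientAt f f' x) :
    f x + inner ℝ f' (y - x) ≤ f y := by
  have h1 : ConvexOn ℝ (AffineMap.lineMap x y ⁻¹' S : Set ℝ) (f ∘ AffineMap.lineMap x y) :=
    hf.comp_affineMap _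
  have h2 : HasDerivAt (f ∘ AffineMap.lineMap x y) (inner ℝ f' (y - x)) (0 : ℝ) := by
    have hl : HasDerivAt (AffineMap.lineMap x y : ℝ → E) (y - x) 0 := AffineMap.hasDerivAt_lineMap
    have hg : HasFDerivAt f (InnerProductSpace.toDual ℝ E f') (AffineMap.lineMap x y (0 : ℝ)) := by
      simpa using h.hasFDerivAt
    simpa using hg.comp_hasDerivAt (0 : ℝ) hl
  have := h1.le_slope_of_hasDerivAt (x := 0) (y := 1) (by simpa) (by simpa) one_pos h2
  simp [slope] at this
  linarith

/-! ### The estimator as a function of the trackers -/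

/-- The gradient estimator without the regularisation term, as a function of the dual variable and
the trackers. -/
def dualMap (P : Constants) (t : ℝ) (v : EuclideanSpace ℝ (Fin d)) (u s : ℝ) : Point d :=
  WithLp.toLp 2 ((t / s) • v, t / s * u + Real.log s + P.ρ)

theorem abs_log_sub_log_le {s s₀ : ℝ} (hs : 1 / 2 ≤ s) (hs₀ : 1 ≤ s₀) :
    |Real.log s - Real.log s₀| ≤ 2 * |s - s₀| := by
  have h1 : 0 < s := by linarith
  have h2 : 0 < s₀ := by linarith
  rw [abs_le]
  constructor
  · have := Real.log_le_sub_one_of_pos (div_pos h2 h1)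
    rw [Real.log_div h2.ne' h1.ne'] at this
    have h3 : s₀ / s - 1 = (s₀ - s) / s := by field_simp
    have h4 : (s₀ - s) / s ≤ |s - s₀| / (1 / 2) := by
      gcongr
      rw [abs_sub_comm]
      exact le_abs_self _
    linarith
  · have := Real.log_le_sub_one_of_pos (div_pos h1 h2)
    rw [Real.log_div h1.ne' h2.ne'] at this
    have h3 : s / s₀ - 1 = (s - s₀) / s₀ := by field_simp
    have h4 : (s - s₀) / s₀ ≤ |s - s₀| / 1 := by
      gcongr
      exact le_abs_self _
    have := abs_nonneg (s - s₀)
    linarith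

theorem norm_smul_sub_smul_le {E : Type*} [NormedAddCommGroup E] [NormedSpace ℝ E] {v v₀ : E}
    {s s₀ t T D : ℝ} (hs : 1 / 2 ≤ s) (hs₀ : 1 ≤ s₀) (ht : 0 ≤ t) (htT : t ≤ T) (hv : ‖v₀‖ ≤ D) :
    ‖(t / s) • v - (t / s₀) • v₀‖ ≤ 2 * (T * ‖v - v₀‖) + 2 * (T * D * |s - s₀|) := by
  have h1 : 0 < s := by linarith
  have h2 : 0 < s₀ := by linarith
  have hD : 0 ≤ D := (norm_nonneg _).trans hv
  have hT : 0 ≤ T := ht.trans htT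
  have e : (t / s) • v - (t / s₀) • v₀ = (t / s) • (v - v₀) + (t * (s₀ - s) / (s * s₀)) • v₀ := by
    have : t * (s₀ - s) / (s * s₀) = t / s - t / s₀ := by field_simp
    rw [this, smul_sub, sub_smul]; abel
  rw [e]
  calc _ ≤ t / s * ‖v - v₀‖ + t * |s - s₀| / (s * s₀) * ‖v₀‖ := by
        refine (norm_add_le _ _).trans ?_
        rw [norm_smul, norm_smul, Real.norm_of_nonneg (by positivity), Real.norm_eq_abs, abs_div,
          abs_mul, abs_of_nonneg ht, abs_of_pos (mul_pos h1 h2), abs_sub_comm]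
    _ ≤ T / (1 / 2) * ‖v - v₀‖ + T * |s - s₀| / (1 / 2 * 1) * D := by gcongr
    _ = _ := by ring

/-- Here tracking error becomes gradient error. The right side dictates the weights of the tracking
error: `lamMax` for the gradient and `lamMax * Lg + 1` for the value, where the 1 pays for the
logarithm. The bound s ≥ 1/2 controls both 1/s and log s. -/
theorem norm_dualMap_sub_sq_le (hP : P.Admissible) {t : ℝ} {v v₀ : EuclideanSpace ℝ (Fin d)}
    {u u₀ s s₀ : ℝ} (ht : 0 ≤ t) (htT : t ≤ P.lamMax) (hs : 1 / 2 ≤ s) (hs₀ : 1 ≤ s₀)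
    (hv : ‖v₀‖ ≤ P.Lg) (hu : |u₀| ≤ P.Lg) :
    ‖dualMap P t v u s - dualMap P t v₀ u₀ s₀‖ ^ 2 ≤
      16 * (P.lamMax ^ 2 * (‖v - v₀‖ ^ 2 + (u - u₀) ^ 2)
        + (P.lamMax * P.Lg + 1) ^ 2 * (s - s₀) ^ 2) := by
  have hL := hP.Lg_nonneg
  have hT := hP.lamMax_pos
  have h1 : ‖(dualMap P t v u s - dualMap P t v₀ u₀ s₀).fst‖
      ≤ 2 * (P.lamMax * ‖v - v₀‖) + 2 * (P.lamMax * P.Lg * |s - s₀|) :=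
    norm_smul_sub_smul_le hs hs₀ ht htT hv
  have h2 : |(dualMap P t v u s - dualMap P t v₀ u₀ s₀).snd|
      ≤ 2 * (P.lamMax * |u - u₀|) + 2 * ((P.lamMax * P.Lg + 1) * |s - s₀|) := by
    show |t / s * u + Real.log s + P.ρ - (t / s₀ * u₀ + Real.log s₀ + P.ρ)| ≤ _
    have h3 := norm_smul_sub_smul_le (v := u) hs hs₀ ht htT hu
    rw [smul_eq_mul, smul_eq_mul, Real.norm_eq_abs, Real.norm_eq_abs] at h3
    have h4 := abs_log_sub_log_le hs hs₀
    have h5 := abs_add_le (t / s * u - t / s₀ * u₀) (Real.log s - Real.log s₀)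
    rw [show t / s * u + Real.log s + P.ρ - (t / s₀ * u₀ + Real.log s₀ + P.ρ)
      = t / s * u - t / s₀ * u₀ + (Real.log s - Real.log s₀) by ring]
    linarith
  refine (norm_sq_le_of_fst_snd h1 h2).trans ?_
  rw [← sq_abs (u - u₀), ← sq_abs (s - s₀)]
  have h6 : (P.lamMax * P.Lg * |s - s₀|) ^ 2 ≤ ((P.lamMax * P.Lg + 1) * |s - s₀|) ^ 2 := by
    gcongr
    linarith
  nlinarith [sq_nonneg (P.lamMax * ‖v - v₀‖ - P.lamMax * P.Lg * |s - s₀|),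
    sq_nonneg (P.lamMax * |u - u₀| - (P.lamMax * P.Lg + 1) * |s - s₀|),
    sq_nonneg (P.lamMax * |u - u₀|)]

/-! ### The objective -/

/-- The gradient of `F P ℓ`. -/
def FGrad (P : Constants) (ℓ : Fin n → EuclideanSpace ℝ (Fin d) → ℝ) (x : Point d) : Point d :=
  dualMap P x.snd (gradient (g ℓ) x).fst (gradient (g ℓ) x).snd (g ℓ x)

section mean

variable [NeZero n]

theorem mean_const {E : Type*} [AddCommGroup E] [Module ℝ E] (a : E) :
    (1 / n : ℝ) • ∑ _i : Fin n, a = a := by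
  have : (n : ℝ) ≠ 0 := NeZero.ne _
  rw [Finset.sum_const, Finset.card_univ, Fintype.card_fin, ← Nat.cast_smul_eq_nsmul ℝ, smul_smul,
    one_div_mul_cancel this, one_smul]

theorem norm_mean_le {E : Type*} [NormedAddCommGroup E] [NormedSpace ℝ E] {a : Fin n → E} {B : ℝ}
    (h : ∀ i, ‖a i‖ ≤ B) : ‖(1 / n : ℝ) • ∑ i, a i‖ ≤ B := by
  rw [norm_smul, Real.norm_of_nonneg (by positivity)]
  calc _ ≤ (1 / n : ℝ) * ∑ _i : Fin n, B := by
        gcongr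
        exact norm_sum_le_of_le _ fun i _ => h i
    _ = B := mean_const (E := ℝ) B

end mean

namespace ConvexProblem

variable (hP : P.Admissible) (hℓ : ConvexProblem P W ℓ)
include hP hℓ

theorem hasGradientAt_g {x : Point d} (hx : x ∈ domain P W) :
    HasGradientAt (g ℓ) ((1 / n : ℝ) • ∑ i, gradient (gi ℓ i) x) x := by
  rw [hasGradientAt_iff_hasFDerivAt]
  have h := (HasFDerivAt.fun_sum (u := Finset.univ) fun i _ =>
    (hℓ.hasGradientAt hP hx i).hasFDerivAt).const_smul (1 / n : ℝ)
  rw [map_smul, map_sum]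
  exact h

theorem gradient_g {x : Point d} (hx : x ∈ domain P W) :
    gradient (g ℓ) x = (1 / n : ℝ) • ∑ i, gradient (gi ℓ i) x :=
  (hℓ.hasGradientAt_g hP hx).gradient

variable [NeZero n]

theorem one_le_g {x : Point d} (hx : x ∈ domain P W) : 1 ≤ g ℓ x := by
  rw [← mean_const (n := n) (1 : ℝ), smul_eq_mul, g]
  gcongr with i
  exact hℓ.one_le_gi hP hx i

theorem g_le {x : Point d} (hx : x ∈ domain P W) : g ℓ x ≤ Real.exp (P.C / P.lam₀) := by
  rw [← mean_const (n := n) (Real.exp (P.C / P.lam₀)), smul_eq_mul, g]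
  gcongr with i
  exact hℓ.gi_le hP hx i

theorem norm_gradient_g_le {x : Point d} (hx : x ∈ domain P W) : ‖gradient (g ℓ) x‖ ≤ P.Lg := by
  rw [hℓ.gradient_g hP hx]
  refine norm_mean_le fun i => ?_
  rw [hℓ.gradient_gi hP hx]
  exact hℓ.norm_giGrad_le hP hx i

theorem abs_g_sub_le {x y : Point d} (hx : x ∈ domain P W) (hy : y ∈ domain P W) :
    |g ℓ x - g ℓ y| ≤ P.Lg * ‖x - y‖ := by
  have h : g ℓ x - g ℓ y = (1 / n : ℝ) • ∑ i, (gi ℓ i x - gi ℓ i y) := by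
    rw [Finset.sum_sub_distrib, smul_sub]; rfl
  rw [h, ← Real.norm_eq_abs]
  exact norm_mean_le fun i => hℓ.abs_gi_sub_le hP hx hy i

omit [NeZero n] in
theorem norm_gradient_gi_sub_le {x y : Point d} (hx : x ∈ domain P W) (hy : y ∈ domain P W)
    (i : Fin n) : ‖gradient (gi ℓ i) x - gradient (gi ℓ i) y‖ ≤ P.Ldg * ‖x - y‖ := by
  rw [hℓ.gradient_gi hP hx, hℓ.gradient_gi hP hy]
  exact hℓ.norm_giGrad_sub_le hP hx hy i

theorem norm_gradient_g_sub_le {x y : Point d} (hx : x ∈ domain P W) (hy : y ∈ domain P W) :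
    ‖gradient (g ℓ) x - gradient (g ℓ) y‖ ≤ P.Ldg * ‖x - y‖ := by
  rw [hℓ.gradient_g hP hx, hℓ.gradient_g hP hy, ← smul_sub, ← Finset.sum_sub_distrib]
  exact norm_mean_le fun i => hℓ.norm_gradient_gi_sub_le hP hx hy i

theorem hasGradientAt_F {x : Point d} (hx : x ∈ domain P W) :
    HasGradientAt (F P ℓ) (FGrad P ℓ x) x := by
  have hg := (zero_lt_one.trans_le (hℓ.one_le_g hP hx)).ne'
  rw [hasGradientAt_iff_hasFDerivAt]
  have e1 : HasFDerivAt (g ℓ) _ x := (hℓ.hasGradientAt_g hP hx).hasFDerivAt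
  have e2 : HasFDerivAt (fun y : Point d => y.snd) _ x :=
    (WithLp.sndL 2 ℝ (EuclideanSpace ℝ (Fin d)) ℝ).hasFDerivAt
  have e3 := (e2.mul (e1.log hg)).add ((e2.sub_const P.lam₀).mul_const P.ρ)
  rw [← hℓ.gradient_g hP hx] at e3
  refine HasFDerivAt.congr_fderiv e3 ?_
  ext y
  simp only [FGrad, dualMap, add_apply, smul_apply,
    InnerProductSpace.toDual_apply_apply, WithLp.prod_inner_apply, smul_eq_mul, WithLp.sndL_apply]
  simp [inner_smul_left]
  ring

theorem norm_FGrad_sub_le {x y : Point d} (hx : x ∈ domain P W) (hy : y ∈ domain P W) :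
    ‖FGrad P ℓ x - FGrad P ℓ y‖ ≤ 5 * P.LF * ‖x - y‖ := by
  have hT := hP.lamMax_pos
  have hL := hP.Lg_nonneg
  have hgy := hℓ.one_le_g hP hy
  have hgx := hℓ.one_le_g hP hx
  have hb := hℓ.norm_gradient_g_le hP hy
  -- Intermediate point: dual variable of x, value and gradient of g at y. The first difference is
  -- an instance of the estimator bound, with g(x) as the value tracker, and costs 4 `LF`; the
  -- second is linear in λ and costs one more `LF`.
  set z : Point d := dualMap P x.snd (gradient (g ℓ) y).fst (gradient (g ℓ) y).snd (g ℓ y)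
  have h1 : ‖FGrad P ℓ x - z‖ ^ 2 ≤ (4 * P.LF * ‖x - y‖) ^ 2 := by
    refine (norm_dualMap_sub_sq_le hP (snd_pos hP hx).le hx.2.2 (by linarith) hgy
      ((norm_fst_le _).trans hb) ((abs_snd_le _).trans hb)).trans ?_
    have e1 := WithLp.prod_norm_sq_eq_of_L2 (gradient (g ℓ) x - gradient (g ℓ) y)
    rw [WithLp.sub_fst, WithLp.sub_snd, Real.norm_eq_abs, sq_abs] at e1
    rw [← e1, ← sq_abs (g ℓ x - g ℓ y)]
    calc _ ≤ 16 * (P.lamMax ^ 2 * (P.Ldg * ‖x - y‖) ^ 2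
          + (P.lamMax * P.Lg + 1) ^ 2 * (P.Lg * ‖x - y‖) ^ 2) := by
          gcongr
          · exact hℓ.norm_gradient_g_sub_le hP hx hy
          · exact hℓ.abs_g_sub_le hP hx hy
      _ ≤ 16 * ((P.lamMax * P.Ldg + (P.lamMax * P.Lg + 1) * P.Lg) ^ 2 * ‖x - y‖ ^ 2) := by
          have : 0 ≤ P.lamMax * P.Ldg * ((P.lamMax * P.Lg + 1) * P.Lg) := by
            have := P.Ldg_nonneg
            positivity
          nlinarith [mul_nonneg this (sq_nonneg ‖x - y‖)]
      _ ≤ 16 * (P.LF ^ 2 * ‖x - y‖ ^ 2) := by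
          have := P.Ldg_nonneg
          gcongr
          exact hP.LF_ge
      _ = _ := by ring
  have hΛ := hP.one_le_LF
  have h1' := abs_le_of_sq_le_sq' h1 (by positivity)
  have h2 : ‖z - FGrad P ℓ y‖ ≤ P.LF * ‖x - y‖ := by
    have e : z - FGrad P ℓ y = ((x.snd - y.snd) / g ℓ y) • gradient (g ℓ) y := by
      have : ∀ a b : Point d, a.fst = b.fst → a.snd = b.snd → a = b := by
        intro a b h1 h2
        exact (WithLp.ofLp_injective 2) (Prod.ext h1 h2)
      apply this
      · show (x.snd / g ℓ y) • (gradient (g ℓ) y).fst - (y.snd / g ℓ y) • (gradient (g ℓ) y).fst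
          = ((x.snd - y.snd) / g ℓ y) • (gradient (g ℓ) y).fst
        rw [sub_div, sub_smul]
      · show x.snd / g ℓ y * (gradient (g ℓ) y).snd + Real.log (g ℓ y) + P.ρ
          - (y.snd / g ℓ y * (gradient (g ℓ) y).snd + Real.log (g ℓ y) + P.ρ)
          = (x.snd - y.snd) / g ℓ y * (gradient (g ℓ) y).snd
        ring
    rw [e, norm_smul, Real.norm_eq_abs, abs_div, abs_of_pos (a := g ℓ y) (by linarith)]
    have h3 : |x.snd - y.snd| ≤ ‖x - y‖ := abs_snd_le (x - y)
    have h4 : P.Lg ≤ P.LF := by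
      unfold Constants.LF
      have := mul_nonneg hT.le P.Ldg_nonneg
      have := mul_nonneg hT.le (sq_nonneg P.Lg)
      linarith
    calc _ ≤ ‖x - y‖ / 1 * P.LF := by
          gcongr
          exact hb.trans h4
      _ = _ := by ring
  calc _ = ‖(FGrad P ℓ x - z) + (z - FGrad P ℓ y)‖ := by rw [sub_add_sub_cancel]
    _ ≤ _ := by
      refine (norm_add_le _ _).trans ?_
      linarith [h1'.2]

theorem norm_FGrad_le {x : Point d} (hx : x ∈ domain P W) :
    ‖FGrad P ℓ x‖ ≤ P.lamMax * P.Lg + P.C / P.lam₀ + P.ρ := by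
  have hT := hP.lamMax_pos
  have hL := hP.Lg_nonneg
  have hg := hℓ.one_le_g hP hx
  have hb := hℓ.norm_gradient_g_le hP hx
  have e : FGrad P ℓ x = (x.snd / g ℓ x) • gradient (g ℓ) x
      + WithLp.toLp 2 (0, Real.log (g ℓ x) + P.ρ) := by
    refine (WithLp.ofLp_injective 2) (Prod.ext ?_ ?_)
    · show (x.snd / g ℓ x) • (gradient (g ℓ) x).fst = (x.snd / g ℓ x) • (gradient (g ℓ) x).fst + 0
      rw [add_zero]
    · show x.snd / g ℓ x * (gradient (g ℓ) x).snd + Real.log (g ℓ x) + P.ρ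
        = x.snd / g ℓ x * (gradient (g ℓ) x).snd + (Real.log (g ℓ x) + P.ρ)
      ring
  have hl : Real.log (g ℓ x) ≤ P.C / P.lam₀ := by
    rw [Real.log_le_iff_le_exp (by linarith)]
    exact hℓ.g_le hP hx
  have hl0 := Real.log_nonneg hg
  have hρ := hP.ρ_pos
  have h1 : ‖(x.snd / g ℓ x) • gradient (g ℓ) x‖ ≤ P.lamMax * P.Lg := by
    have := snd_pos hP hx
    rw [norm_smul, Real.norm_of_nonneg (by positivity)]
    calc _ ≤ P.lamMax / 1 * P.Lg := by
          gcongr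
          exact hx.2.2
      _ = _ := by ring
  have h2 : ‖(WithLp.toLp 2 (0, Real.log (g ℓ x) + P.ρ) : Point d)‖ ≤ P.C / P.lam₀ + P.ρ := by
    refine le_of_sq_le_sq ?_ (by linarith)
    refine (norm_sq_le_of_fst_snd (a := 0) (b := P.C / P.lam₀ + P.ρ) (by simp) ?_).trans (by simp)
    show |Real.log (g ℓ x) + P.ρ| ≤ _
    rw [abs_of_nonneg (by positivity)]
    linarith
  rw [e]
  exact (norm_add_le _ _).trans (by linarith)

/-- Joint convexity in (w, λ) is that of the perspective of log-mean-exp, which is increasing in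
each loss. The proof is direct, by Jensen's inequality for exp with weights adapted to λ. -/
theorem convexOn_F : ConvexOn ℝ (domain P W) (F P ℓ) := by
  refine ⟨hℓ.convex_domain, ?_⟩
  intro x hx y hy a b ha hb hab
  have hz := hℓ.convex_domain hx hy ha hb hab
  set z := a • x + b • y with hzdef
  have hx0 := snd_pos hP hx
  have hy0 := snd_pos hP hy
  have hz0 := snd_pos hP hz
  have hgx := zero_lt_one.trans_le (hℓ.one_le_g hP hx)
  have hgy := zero_lt_one.trans_le (hℓ.one_le_g hP hy)
  have hgz := zero_lt_one.trans_le (hℓ.one_le_g hP hz)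
  have hzs : z.snd = a * x.snd + b * y.snd := rfl
  -- With these weights, convexity of the losses gives ℓ(z)/λ_z ≤ p ℓ(x)/λ_x + q ℓ(y)/λ_y.
  set p := a * x.snd / z.snd with hp
  set q := b * y.snd / z.snd with hq
  have hp0 : 0 ≤ p := by positivity
  have hq0 : 0 ≤ q := by positivity
  have hpq : p + q = 1 := by
    rw [hp, hq, ← add_div, ← hzs, div_self hz0.ne']
  set α := Real.log (g ℓ x)
  set β := Real.log (g ℓ y)
  have hα : Real.exp α = g ℓ x := Real.exp_log hgx
  have hβ : Real.exp β = g ℓ y := Real.exp_log hgy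
  have key : g ℓ z ≤ Real.exp (p * α + q * β) := by
    -- Dividing by g(x) and g(y) before applying Jensen makes the right side average exactly to
    -- exp(pα + qβ).
    have hi : ∀ i, gi ℓ i z ≤ Real.exp (p * α + q * β)
        * (p * (gi ℓ i x / g ℓ x) + q * (gi ℓ i y / g ℓ y)) := by
      intro i
      have h1 : ℓ i z.fst / z.snd ≤ p * (ℓ i x.fst / x.snd) + q * (ℓ i y.fst / y.snd) := by
        have h2 := (hℓ.loss_convex i).2 hx.1 hy.1 ha hb hab
        have h3 : p * (ℓ i x.fst / x.snd) + q * (ℓ i y.fst / y.snd)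
            = (a * ℓ i x.fst + b * ℓ i y.fst) / z.snd := by
          rw [hp, hq]; field_simp
        rw [h3]
        gcongr
        exact h2
      have h4 : p * (ℓ i x.fst / x.snd) + q * (ℓ i y.fst / y.snd)
          = (p * α + q * β) + (p * (ℓ i x.fst / x.snd - α) + q * (ℓ i y.fst / y.snd - β)) := by ring
      have h5 := convexOn_exp.2 (Set.mem_univ (ℓ i x.fst / x.snd - α))
        (Set.mem_univ (ℓ i y.fst / y.snd - β)) hp0 hq0 hpq
      rw [Real.exp_sub, Real.exp_sub, hα, hβ] at h5
      calc gi ℓ i z ≤ Real.exp (p * (ℓ i x.fst / x.snd) + q * (ℓ i y.fst / y.snd)) :=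
            Real.exp_le_exp.2 h1
        _ ≤ _ := by
            rw [h4, Real.exp_add]
            gcongr
            exact h5
    calc g ℓ z ≤ (1 / n : ℝ) * ∑ i, Real.exp (p * α + q * β)
          * (p * (gi ℓ i x / g ℓ x) + q * (gi ℓ i y / g ℓ y)) := by
          unfold g
          gcongr with i
          exact hi i
      _ = Real.exp (p * α + q * β) * (p * (g ℓ x / g ℓ x) + q * (g ℓ y / g ℓ y)) := by
          have e : ∀ w : Point d, g ℓ w = (1 / n : ℝ) * ∑ i, gi ℓ i w := fun _ => rfl
          conv_rhs => rw [mul_add, ← mul_assoc, ← mul_assoc]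
          simp only [← Finset.mul_sum, Finset.sum_add_distrib, ← Finset.sum_div]
          rw [show g ℓ x / g ℓ x = (1 / n : ℝ) * (∑ i, gi ℓ i x) / g ℓ x by rw [← e],
            show g ℓ y / g ℓ y = (1 / n : ℝ) * (∑ i, gi ℓ i y) / g ℓ y by rw [← e]]
          ring
      _ = _ := by rw [div_self hgx.ne', div_self hgy.ne', mul_one, mul_one, hpq, mul_one]
  have hlog : Real.log (g ℓ z) ≤ p * α + q * β := by
    rw [Real.log_le_iff_le_exp hgz]
    exact key
  have hmul : z.snd * Real.log (g ℓ z) ≤ a * (x.snd * α) + b * (y.snd * β) := by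
    calc _ ≤ z.snd * (p * α + q * β) := by gcongr
      _ = _ := by rw [hp, hq]; field_simp
  show z.snd * Real.log (g ℓ z) + (z.snd - P.lam₀) * P.ρ
    ≤ a * (x.snd * α + (x.snd - P.lam₀) * P.ρ) + b * (y.snd * β + (y.snd - P.lam₀) * P.ρ)
  have : (z.snd - P.lam₀) * P.ρ
      = a * ((x.snd - P.lam₀) * P.ρ) + b * ((y.snd - P.lam₀) * P.ρ) := by
    rw [hzs]
    linear_combination (P.lam₀ * P.ρ) * hab
  linarith

theorem F_nonneg {x : Point d} (hx : x ∈ domain P W) : 0 ≤ F P ℓ x :=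
  add_nonneg (mul_nonneg (snd_pos hP hx).le (Real.log_nonneg (hℓ.one_le_g hP hx)))
    (mul_nonneg (sub_nonneg.2 hx.2.1) hP.ρ_pos.le)

theorem F_le {x : Point d} (hx : x ∈ domain P W) :
    F P ℓ x ≤ P.lamMax * (P.C / P.lam₀) + P.lamMax * P.ρ := by
  have hg := hℓ.one_le_g hP hx
  have hl : Real.log (g ℓ x) ≤ P.C / P.lam₀ := by
    rw [Real.log_le_iff_le_exp (by linarith)]
    exact hℓ.g_le hP hx
  have hl0 := Real.log_nonneg hg
  have h1 : x.snd - P.lam₀ ≤ P.lamMax := by linarith [hx.2.2, hP.lam₀_pos]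
  have h2 := hx.2.2
  have := hP.lamMax_pos
  have := hP.ρ_pos
  unfold F
  gcongr

end ConvexProblem

end DRO

namespace DRO

variable {d n : ℕ} {P : Constants} {W : Set (EuclideanSpace ℝ (Fin d))}
  {ℓ : Fin n → EuclideanSpace ℝ (Fin d) → ℝ}

/-! ### Inexact projected gradient steps -/

section ProjectedStep

variable {E : Type*} [NormedAddCommGroup E] [InnerProductSpace ℝ E]

theorem norm_sub_le_of_projected_step {x x' z : E} {η : ℝ} (hη : 0 < η)
    (h : inner ℝ (x - η • z - x') (x - x') ≤ 0) : ‖x' - x‖ ≤ η * ‖z‖ := by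
  have h1 : ‖x - x'‖ ^ 2 ≤ η * inner ℝ z (x - x') := by
    have e : x - η • z - x' = (x - x') - η • z := by abel
    rw [e, inner_sub_left, real_inner_self_eq_norm_sq, real_inner_smul_left] at h
    linarith
  have h2 := mul_le_mul_of_nonneg_left (real_inner_le_norm z (x - x')) hη.le
  rw [norm_sub_rev]
  by_contra! hc
  have h3 : 0 < ‖x - x'‖ := lt_of_le_of_lt (by positivity) hc
  nlinarith

/-- The variational inequality of the projection, tested at x, yields −‖x' − x‖²/η. A quarter of it
absorbs the gradient error by Young's inequality, a quarter the quadratic upper bound, and half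
remains. -/
theorem descent_of_projected_step {x x' z p : E} {η Lu φ φ' r : ℝ} (hη : 0 < η)
    (h : inner ℝ (x - η • z - x') (x - x') ≤ 0)
    (hup : φ' ≤ φ + inner ℝ p (x' - x) + Lu * ‖x' - x‖ ^ 2) (hr : ‖z - p‖ ^ 2 ≤ r)
    (hLu : η * Lu ≤ 1 / 4) : φ' ≤ φ - ‖x' - x‖ ^ 2 / (2 * η) + η * r := by
  have h1 : η * inner ℝ z (x' - x) ≤ -‖x' - x‖ ^ 2 := by
    have e : x - η • z - x' = -(x' - x) - η • z := by abel
    rw [e, ← neg_sub x' x, inner_neg_right, inner_sub_left, inner_neg_left,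
      real_inner_self_eq_norm_sq, real_inner_smul_left] at h
    linarith
  have h2 : inner ℝ p (x' - x) = inner ℝ z (x' - x) - inner ℝ (z - p) (x' - x) := by
    rw [inner_sub_left]; ring
  have h3 : -inner ℝ (z - p) (x' - x) ≤ ‖z - p‖ * ‖x' - x‖ := by
    have := abs_real_inner_le_norm (z - p) (x' - x)
    linarith [neg_abs_le (inner ℝ (z - p) (x' - x))]
  set X := ‖x' - x‖
  set s := ‖z - p‖
  have h4 : inner ℝ z (x' - x) ≤ -X ^ 2 / η := by rw [le_div_iff₀ hη]; linarith
  have h5 : s * X ≤ η * s ^ 2 + X ^ 2 / (4 * η) := by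
    have : 0 ≤ (2 * η * s - X) ^ 2 / (4 * η) := by positivity
    have e : (2 * η * s - X) ^ 2 / (4 * η) = η * s ^ 2 + X ^ 2 / (4 * η) - s * X := by
      field_simp; ring
    linarith
  have h6 : Lu * X ^ 2 ≤ X ^ 2 / (4 * η) := by
    rw [le_div_iff₀ (by positivity)]
    nlinarith [sq_nonneg X]
  have h7 : -X ^ 2 / η + X ^ 2 / (4 * η) + X ^ 2 / (4 * η) = -(X ^ 2 / (2 * η)) := by
    field_simp; ring
  have h8 : η * s ^ 2 ≤ η * r := by gcongr
  linarith

/-- The same variational inequality, tested at the comparison point. The gradient error costs μ/4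
‖x' − xs‖², at most μ/2 ‖x − xs‖² + μ/2 ‖x − x'‖²; strong convexity absorbs the first term and the
step size condition the second. The gap gained is the one at x', not at x. -/
theorem progress_of_projected_step {x x' xs z p : E} {η μ Lu φ φ' φs r : ℝ} (hη : 0 < η)
    (hμ : 0 < μ) (h : inner ℝ (x - η • z - x') (xs - x') ≤ 0)
    (hup : φ' ≤ φ + inner ℝ p (x' - x) + Lu * ‖x' - x‖ ^ 2)
    (hlow : φ + inner ℝ p (xs - x) + μ / 2 * ‖xs - x‖ ^ 2 ≤ φs) (hr : ‖z - p‖ ^ 2 ≤ r)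
    (hLu : η * (Lu + μ / 2) ≤ 1 / 2) :
    φ' - φs + ‖x' - xs‖ ^ 2 / (2 * η) ≤ ‖x - xs‖ ^ 2 / (2 * η) + r / μ := by
  set a := x - x' with ha
  set b := x' - xs with hb
  have e1 : x - xs = a + b := by rw [ha, hb]; abel
  have e2 : ‖x - xs‖ ^ 2 = ‖a‖ ^ 2 + 2 * inner ℝ a b + ‖b‖ ^ 2 := by rw [e1, norm_add_sq_real]
  have h1 : η * inner ℝ z b ≤ inner ℝ a b := by
    have e : x - η • z - x' = a - η • z := by rw [ha]; abel
    rw [e, ← neg_sub x' xs, ← hb, inner_neg_right, inner_sub_left, real_inner_smul_left] at h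
    linarith
  have h2 : inner ℝ p (x' - x) - inner ℝ p (xs - x) = inner ℝ z b + inner ℝ (p - z) b := by
    rw [← inner_sub_right, inner_sub_left, sub_sub_sub_cancel_right, ← hb]; ring
  have h3 : inner ℝ (p - z) b ≤ ‖z - p‖ * ‖b‖ := by
    rw [norm_sub_rev]; exact real_inner_le_norm _ _
  have h4 : ‖z - p‖ * ‖b‖ ≤ r / μ + μ / 4 * ‖b‖ ^ 2 := by
    have : 0 ≤ (2 * ‖z - p‖ - μ * ‖b‖) ^ 2 / (4 * μ) := by positivity
    have e : (2 * ‖z - p‖ - μ * ‖b‖) ^ 2 / (4 * μ)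
        = ‖z - p‖ ^ 2 / μ + μ / 4 * ‖b‖ ^ 2 - ‖z - p‖ * ‖b‖ := by field_simp; ring
    have : ‖z - p‖ ^ 2 / μ ≤ r / μ := by gcongr
    linarith
  have h5 : ‖b‖ ^ 2 ≤ 2 * ‖x - xs‖ ^ 2 + 2 * ‖a‖ ^ 2 := by
    have e : b = (x - xs) - a := by rw [e1]; abel
    rw [e]
    have := parallelogram_law_with_norm ℝ (x - xs) a
    nlinarith [sq_nonneg ‖x - xs + a‖]
  have h6 : inner ℝ z b ≤ (‖x - xs‖ ^ 2 - ‖b‖ ^ 2 - ‖a‖ ^ 2) / (2 * η) := by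
    rw [le_div_iff₀ (by positivity)]
    linarith
  have h7 : (Lu + μ / 2) * ‖a‖ ^ 2 ≤ ‖a‖ ^ 2 / (2 * η) := by
    rw [le_div_iff₀ (by positivity)]
    nlinarith [sq_nonneg ‖a‖]
  rw [norm_sub_rev x' x, ← ha] at hup
  rw [norm_sub_rev xs x] at hlow
  rw [sub_div, sub_div] at h6
  nlinarith

end ProjectedStep

theorem inner_nonneg_of_isMinOn {E : Type*} [NormedAddCommGroup E] [InnerProductSpace ℝ E]
    [CompleteSpace E] {S : Set E} {f : E → ℝ} {f' x y : E} (hS : Convex ℝ S)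
    (hx : x ∈ S) (hy : y ∈ S) (hmin : ∀ z ∈ S, f x ≤ f z) (h : HasGradientAt f f' x) :
    0 ≤ inner ℝ f' (y - x) := by
  have h2 : IsLocalMinOn f S x := IsMinOn.localize (isMinOn_iff.2 hmin)
  exact h2.hasFDerivWithinAt_nonneg h.hasFDerivAt.hasFDerivWithinAt
    (sub_mem_posTangentConeAt_of_segment_subset (hS.segment_subset hx hy))

/-- A nonempty closed set in a finite-dimensional space has nearest points, so `proj` never takes
its default value. -/
theorem exists_dist_le (hℓ : ConvexProblem P W ℓ) (hne : (domain P W).Nonempty) (u : Point d) :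
    ∃ p ∈ domain P W, ∀ q ∈ domain P W, dist u p ≤ dist u q := by
  obtain ⟨p, hp, h⟩ := hℓ.isClosed_domain.exists_infDist_eq_dist hne u
  exact ⟨p, hp, fun q hq => h ▸ Metric.infDist_le_dist_of_mem hq⟩

theorem proj_mem (hℓ : ConvexProblem P W ℓ) (hne : (domain P W).Nonempty) (u : Point d) :
    proj (domain P W) u ∈ domain P W := by
  have h := exists_dist_le hℓ hne u
  rw [proj, dif_pos h]
  exact h.choose_spec.1

theorem inner_proj_nonpos (hℓ : ConvexProblem P W ℓ) (hne : (domain P W).Nonempty) (u : Point d)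
    {y : Point d} (hy : y ∈ domain P W) :
    inner ℝ (u - proj (domain P W) u) (y - proj (domain P W) u) ≤ 0 := by
  have h := exists_dist_le hℓ hne u
  have hm := proj_mem hℓ hne u
  have hmin : ∀ q ∈ domain P W, dist u (proj (domain P W) u) ≤ dist u q := by
    rw [proj, dif_pos h]
    exact h.choose_spec.2
  refine (norm_eq_iInf_iff_real_inner_le_zero hℓ.convex_domain hm).1 ?_ y hy
  have : Nonempty (domain P W) := hne.to_subtype
  refine le_antisymm (le_ciInf fun q => ?_) (ciInf_le ⟨0, ?_⟩ (⟨_, hm⟩ : domain P W))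
  · rw [← dist_eq_norm, ← dist_eq_norm]
    exact hmin q q.2
  · rintro _ ⟨q, rfl⟩
    exact norm_nonneg _

/-! ### The regularised objective -/

/-- The gradient of `Fmu P ℓ μ`. -/
def FmuGrad (P : Constants) (ℓ : Fin n → EuclideanSpace ℝ (Fin d) → ℝ) (μ : ℝ) (x : Point d) :
    Point d := FGrad P ℓ x + μ • x

namespace ConvexProblem

variable (hP : P.Admissible) (hℓ : ConvexProblem P W ℓ) [NeZero n]
include hP hℓ

theorem Fmu_lower (μ : ℝ) {x y : Point d} (hx : x ∈ domain P W) (hy : y ∈ domain P W) :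
    Fmu P ℓ μ x + inner ℝ (FmuGrad P ℓ μ x) (y - x) + μ / 2 * ‖y - x‖ ^ 2 ≤ Fmu P ℓ μ y := by
  have h := add_inner_le_of_convexOn (hℓ.convexOn_F hP) hx hy (hℓ.hasGradientAt_F hP hx)
  have e : ‖y‖ ^ 2 = ‖x‖ ^ 2 + 2 * inner ℝ x (y - x) + ‖y - x‖ ^ 2 := by
    rw [← norm_add_sq_real, add_sub_cancel]
  rw [Fmu, Fmu, FmuGrad, inner_add_left, real_inner_smul_left, e]
  linarith

/-- Convexity at y and the Lipschitz bound for the gradient replace an integration along the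
segment. This doubles the quadratic term of `F`, which is harmless here. -/
theorem Fmu_upper (μ : ℝ) {x y : Point d} (hx : x ∈ domain P W) (hy : y ∈ domain P W) :
    Fmu P ℓ μ y ≤ Fmu P ℓ μ x + inner ℝ (FmuGrad P ℓ μ x) (y - x)
      + (5 * P.LF + μ / 2) * ‖y - x‖ ^ 2 := by
  have h := add_inner_le_of_convexOn (hℓ.convexOn_F hP) hy hx (hℓ.hasGradientAt_F hP hy)
  have h1 : inner ℝ (FGrad P ℓ y) (y - x)
      ≤ inner ℝ (FGrad P ℓ x) (y - x) + 5 * P.LF * ‖y - x‖ ^ 2 := by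
    have h2 := real_inner_le_norm (FGrad P ℓ y - FGrad P ℓ x) (y - x)
    have h3 := mul_le_mul_of_nonneg_right (hℓ.norm_FGrad_sub_le hP hy hx) (norm_nonneg (y - x))
    rw [inner_sub_left] at h2
    linarith
  have h4 : inner ℝ (FGrad P ℓ y) (x - y) = -inner ℝ (FGrad P ℓ y) (y - x) := by
    rw [← inner_neg_right, neg_sub]
  have e : ‖y‖ ^ 2 = ‖x‖ ^ 2 + 2 * inner ℝ x (y - x) + ‖y - x‖ ^ 2 := by
    rw [← norm_add_sq_real, add_sub_cancel]
  rw [Fmu, Fmu, FmuGrad, inner_add_left, real_inner_smul_left, e]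
  linarith

theorem hasGradientAt_Fmu (μ : ℝ) {x : Point d} (hx : x ∈ domain P W) :
    HasGradientAt (Fmu P ℓ μ) (FmuGrad P ℓ μ x) x := by
  rw [hasGradientAt_iff_hasFDerivAt]
  have h := (hℓ.hasGradientAt_F hP hx).hasFDerivAt.add
    ((((hasStrictFDerivAt_norm_sq x).hasFDerivAt).const_mul μ).mul_const (2⁻¹ : ℝ))
  refine (h.congr_fderiv ?_).congr_of_eventuallyEq ?_
  · ext y
    simp [FmuGrad]
    ring
  · filter_upwards with y
    simp [Fmu, div_eq_mul_inv]

theorem exists_minimizer (μ : ℝ) (hne : (domain P W).Nonempty) :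
    ∃ xs ∈ domain P W, ∀ y ∈ domain P W, Fmu P ℓ μ xs ≤ Fmu P ℓ μ y := by
  have hb : Bornology.IsBounded (domain P W) := by
    refine (Metric.isBounded_closedBall (x := 0) (r := Real.sqrt (P.R ^ 2 + P.lamMax ^ 2))).subset ?_
    intro x hx
    rw [mem_closedBall_zero_iff]
    exact Real.le_sqrt_of_sq_le (hℓ.norm_sq_le hP hx)
  have hc : IsCompact (domain P W) := Metric.isCompact_of_isClosed_isBounded hℓ.isClosed_domain hb
  exact hc.exists_isMinOn hne fun x hx =>
    (hℓ.hasGradientAt_Fmu hP μ hx).continuousAt.continuousWithinAt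

theorem quadratic_growth (μ : ℝ) {x xs : Point d} (hx : x ∈ domain P W) (hxs : xs ∈ domain P W)
    (hmin : ∀ y ∈ domain P W, Fmu P ℓ μ xs ≤ Fmu P ℓ μ y) :
    μ / 2 * ‖x - xs‖ ^ 2 ≤ Fmu P ℓ μ x - Fmu P ℓ μ xs := by
  have h1 : 0 ≤ inner ℝ (FmuGrad P ℓ μ xs) (x - xs) :=
    inner_nonneg_of_isMinOn hℓ.convex_domain hxs hx hmin (hℓ.hasGradientAt_Fmu hP μ hxs)
  linarith [hℓ.Fmu_lower hP μ hxs hx]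

end ConvexProblem

end DRO

namespace DRO

/-! ### Averages over a finite type -/

section Avg

variable {ι E : Type*} [Fintype ι]

/-- The average of a finite family. -/
def avg [AddCommGroup E] [Module ℝ E] (a : ι → E) : E := (1 / Fintype.card ι : ℝ) • ∑ i, a i

section Module

variable [AddCommGroup E] [Module ℝ E]

theorem avg_fin {n : ℕ} (a : Fin n → E) : avg a = (1 / n : ℝ) • ∑ i, a i := by
  rw [avg, Fintype.card_fin]

theorem avg_const [Nonempty ι] (a : E) : avg (fun _ : ι => a) = a := by
  have : (Fintype.card ι : ℝ) ≠ 0 := Nat.cast_ne_zero.2 Fintype.card_ne_zero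
  rw [avg, Finset.sum_const, Finset.card_univ, ← Nat.cast_smul_eq_nsmul ℝ, smul_smul,
    one_div_mul_cancel this, one_smul]

theorem avg_add (a b : ι → E) : avg (fun i => a i + b i) = avg a + avg b := by
  rw [avg, Finset.sum_add_distrib, smul_add]; rfl

theorem avg_sub (a b : ι → E) : avg (fun i => a i - b i) = avg a - avg b := by
  rw [avg, Finset.sum_sub_distrib, smul_sub]; rfl

theorem avg_smul (c : ℝ) (a : ι → E) : avg (fun i => c • a i) = c • avg a := by
  rw [avg, ← Finset.smul_sum, smul_comm]; rfl

theorem avg_avg {κ : Type*} [Fintype κ] (a : ι → κ → E) :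
    avg (fun i => avg (a i)) = avg (fun p : ι × κ => a p.1 p.2) := by
  simp only [avg, Fintype.sum_prod_type, Fintype.card_prod, ← Finset.smul_sum, smul_smul]
  push_cast
  rw [one_div_mul_one_div]

theorem avg_equiv {κ : Type*} [Fintype κ] (e : ι ≃ κ) (a : κ → E) :
    avg (fun i => a (e i)) = avg a := by
  rw [avg, avg, Equiv.sum_comp, Fintype.card_congr e]

end Module

theorem avg_const_mul (c : ℝ) (a : ι → ℝ) : avg (fun i => c * a i) = c * avg a := avg_smul c a

theorem avg_mono {a b : ι → ℝ} (h : ∀ i, a i ≤ b i) : avg a ≤ avg b :=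
  mul_le_mul_of_nonneg_left (Finset.sum_le_sum fun i _ => h i) (by positivity)

theorem avg_nonneg {a : ι → ℝ} (h : ∀ i, 0 ≤ a i) : 0 ≤ avg a :=
  mul_nonneg (by positivity) (Finset.sum_nonneg fun i _ => h i)

theorem avg_le [Nonempty ι] {a : ι → ℝ} {c : ℝ} (h : ∀ i, a i ≤ c) : avg a ≤ c :=
  (avg_mono h).trans (avg_const c).le

theorem norm_avg_le [NormedAddCommGroup E] [NormedSpace ℝ E] [Nonempty ι] {a : ι → E} {B : ℝ}
    (h : ∀ i, ‖a i‖ ≤ B) : ‖avg a‖ ≤ B := by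
  rw [avg, norm_smul, Real.norm_of_nonneg (by positivity)]
  calc _ ≤ avg fun _ : ι => B := by
        rw [avg, smul_eq_mul]
        gcongr
        exact norm_sum_le_of_le _ fun i _ => h i
    _ = B := avg_const B

variable [NormedAddCommGroup E] [InnerProductSpace ℝ E]

theorem avg_inner (e : E) (a : ι → E) : avg (fun i => inner ℝ e (a i)) = inner ℝ e (avg a) := by
  rw [avg, avg, inner_smul_right, inner_sum]; rfl

theorem avg_norm_add_sq [Nonempty ι] (e : E) {a : ι → E} (ha : avg a = 0) :
    avg (fun i => ‖e + a i‖ ^ 2) = ‖e‖ ^ 2 + avg fun i => ‖a i‖ ^ 2 := by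
  simp only [norm_add_sq_real]
  rw [avg_add, avg_add, avg_const, avg_const_mul, avg_inner, ha, inner_zero_right]
  ring

theorem avg_norm_sub_avg_sq_le [Nonempty ι] (a : ι → E) :
    avg (fun i => ‖a i - avg a‖ ^ 2) ≤ avg fun i => ‖a i‖ ^ 2 := by
  have h := avg_norm_add_sq (avg a) (a := fun i => a i - avg a)
    (by rw [avg_sub, avg_const, sub_self])
  simp only [add_sub_cancel] at h
  rw [h]
  linarith [sq_nonneg ‖avg a‖]

/-- The noise in the recursive variance-reduced update of a tracker. -/
def noise (β : ℝ) (a b : ι → E) (i : ι) : E := (b i - avg b) - (1 - β) • (a i - avg a)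

variable [Nonempty ι] {a b : ι → E} {β : ℝ}

theorem avg_noise : avg (noise β a b) = 0 := by
  unfold noise
  rw [avg_sub, avg_smul, avg_sub, avg_sub, avg_const, avg_const]
  simp

omit [Nonempty ι] in
-- The source of variance reduction: fresh sampling noise enters only with weight β, and the rest is
-- the centred increment of the samples, which is small when the iterate moves little.
theorem noise_eq (i : ι) :
    noise β a b i = β • (b i - avg b) + (1 - β) • ((b i - a i) - avg fun j => b j - a j) := by
  rw [avg_sub, noise]
  module

theorem avg_norm_noise_sq_le {v D : ℝ} (hβ0 : 0 ≤ β) (hβ1 : β ≤ 1)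
    (hv : avg (fun i => ‖b i - avg b‖ ^ 2) ≤ v) (hD : ∀ i, ‖b i - a i‖ ≤ D) :
    avg (fun i => ‖noise β a b i‖ ^ 2) ≤ 2 * β ^ 2 * v + 2 * D ^ 2 := by
  have h1 : ∀ i, ‖noise β a b i‖ ^ 2 ≤ 2 * β ^ 2 * ‖b i - avg b‖ ^ 2
      + 2 * ‖(b i - a i) - avg fun j => b j - a j‖ ^ 2 := by
    intro i
    rw [noise_eq]
    set p := β • (b i - avg b) with hp
    set q := (1 - β) • ((b i - a i) - avg fun j => b j - a j) with hq
    have h2 := parallelogram_law_with_norm ℝ p q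
    have h3 : ‖p‖ = β * ‖b i - avg b‖ := by rw [hp, norm_smul, Real.norm_of_nonneg hβ0]
    have h4 : ‖q‖ ≤ ‖(b i - a i) - avg fun j => b j - a j‖ := by
      rw [hq, norm_smul, Real.norm_of_nonneg (by linarith)]
      exact mul_le_of_le_one_left (norm_nonneg _) (by linarith)
    have h5 : ‖q‖ ^ 2 ≤ ‖(b i - a i) - avg fun j => b j - a j‖ ^ 2 := by gcongr
    have h6 : ‖p‖ ^ 2 = β ^ 2 * ‖b i - avg b‖ ^ 2 := by rw [h3, mul_pow]
    nlinarith [sq_nonneg ‖p - q‖]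
  refine (avg_mono h1).trans ?_
  rw [avg_add, avg_const_mul, avg_const_mul]
  have h2 : avg (fun i => ‖b i - a i‖ ^ 2) ≤ D ^ 2 :=
    avg_le fun i => pow_le_pow_left₀ (norm_nonneg _) (hD i) 2
  have h3 := avg_norm_sub_avg_sq_le fun j => b j - a j
  gcongr
  exact h3.trans h2

theorem norm_noise_le {B D : ℝ} (hβ0 : 0 ≤ β) (hβ1 : β ≤ 1) (hB : ∀ i, ‖b i‖ ≤ B)
    (hD : ∀ i, ‖b i - a i‖ ≤ D) (i : ι) : ‖noise β a b i‖ ≤ 2 * β * B + 2 * D := by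
  rw [noise_eq]
  have h1 := norm_avg_le hB
  have h2 := norm_avg_le hD
  have h3 := (norm_sub_le (b i) (avg b)).trans (add_le_add (hB i) h1)
  have h4 := (norm_sub_le (b i - a i) (avg fun j => b j - a j)).trans (add_le_add (hD i) h2)
  have hD0 : 0 ≤ D := (norm_nonneg _).trans (hD i)
  refine (norm_add_le _ _).trans ?_
  rw [norm_smul, norm_smul, Real.norm_of_nonneg hβ0, Real.norm_of_nonneg (by linarith)]
  have h5 : β * ‖b i - avg b‖ ≤ β * (B + B) := by gcongr
  have h6 : (1 - β) * ‖(b i - a i) - avg fun j => b j - a j‖ ≤ 1 * (D + D) := by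
    gcongr
    linarith
  linarith

theorem avg_norm_tracker_sq_le {e : E} {N : ι → E} (hβ0 : 0 ≤ β) (hβ1 : β ≤ 1) (hN : avg N = 0) :
    avg (fun i => ‖(1 - β) • e + N i‖ ^ 2) ≤ (1 - β) * ‖e‖ ^ 2 + avg fun i => ‖N i‖ ^ 2 := by
  rw [avg_norm_add_sq _ hN, norm_smul, Real.norm_of_nonneg (by linarith), mul_pow]
  have : (1 - β) ^ 2 ≤ 1 - β := by nlinarith
  gcongr

/-- D ≤ Ψ gives D³ ≤ ΨD², so no lower bound for D is needed. -/
theorem avg_pow_three_le {Ψ : ℝ} {D : ι → ℝ} (hD : ∀ i, D i ≤ Ψ) :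
    avg (fun i => (Ψ + D i) ^ 3) ≤ Ψ ^ 3 + 3 * Ψ ^ 2 * avg D + 4 * Ψ * avg fun i => D i ^ 2 := by
  have h : ∀ i, (Ψ + D i) ^ 3 ≤ Ψ ^ 3 + (3 * Ψ ^ 2 * D i + 4 * Ψ * D i ^ 2) := by
    intro i
    nlinarith [mul_nonneg (sq_nonneg (D i)) (sub_nonneg.2 (hD i))]
  refine (avg_mono h).trans ?_
  rw [avg_add, avg_const, avg_add, avg_const_mul, avg_const_mul, add_assoc]

theorem sq_add_add_add_le (q A B w : ℝ) :
    (q + (A + B + w)) ^ 2 ≤ 2 * q ^ 2 + 6 * A ^ 2 + 6 * B ^ 2 + 6 * w ^ 2 := by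
  nlinarith [sq_nonneg (q - (A + B + w)), sq_nonneg (A - B), sq_nonneg (A - w), sq_nonneg (B - w)]

set_option maxHeartbeats 1000000 in
/-- One step of the third power of the Lyapunov function `‖e‖² + 60 Λ² η (f + 1)`: it increases in
mean by `O(η⁶)` only. -/
theorem avg_lyapunov_pow_three_le {e : E} {N : ι → E} {η κ Λ X f f' s cN Z cF M : ℝ}
    (hN : avg N = 0) (hη : 0 < η) (hΛ : 1 ≤ Λ) (hκ : 442368 * Λ ^ 2 ≤ κ) (hβ : β = κ * η ^ 2)
    (hXZ : X ≤ Z * η) (hf : 0 ≤ f) (hfM : f ≤ M) (hs : 0 ≤ s)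
    (hN2 : avg (fun i => ‖N i‖ ^ 2) ≤ s * η ^ 4 + 2 * Λ ^ 2 * X ^ 2)
    (hNb : ∀ i, ‖N i‖ ≤ cN * η) (hdesc : f' ≤ f - X ^ 2 / (2 * η) + η * (16 * ‖e‖ ^ 2))
    (hff : |f' - f| ≤ cF * X) (hcF : 0 ≤ cF)
    (h1 : 48 * cN ^ 2 * η ≤ 60) (h2 : 2 * cF * Z * η ≤ 1) (h3 : 120 * cF ^ 2 * η ≤ 1)
    (h4 : 192 * β ≤ 1) (h5 : 78 * s * η ≤ 240) :
    avg (fun i => (‖(1 - β) • e + N i‖ ^ 2 + 60 * Λ ^ 2 * η * (f' + 1)) ^ 3)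
      ≤ (‖e‖ ^ 2 + 60 * Λ ^ 2 * η * (f + 1)) ^ 3
        + 280800 * s * Λ ^ 4 * (M + 1) ^ 2 * η ^ 6 := by
  have hΛ2 : 1 ≤ Λ ^ 2 := one_le_pow₀ hΛ
  have hκ0 : 0 < κ := by linarith
  have hβ0 : 0 < β := by rw [hβ]; positivity
  set a := 60 * Λ ^ 2 * η with ha
  have ha0 : 0 < a := by positivity
  have haη : 60 * η ≤ a := by rw [ha]; linarith [mul_le_mul_of_nonneg_right hΛ2 hη.le]
  set E2 := ‖e‖ ^ 2 with hE2
  have hE0 : 0 ≤ E2 := sq_nonneg _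
  set Ψ := E2 + a * (f + 1) with hΨ
  have hΨE : E2 ≤ Ψ := by rw [hΨ]; linarith [mul_nonneg ha0.le hf]
  have hΨa : a ≤ Ψ := by rw [hΨ]; linarith [mul_nonneg ha0.le hf]
  have hΨ0 : 0 < Ψ := ha0.trans_le hΨa
  -- The part of the increment that does not depend on the sample; `D` adds the cross term and the
  -- squared noise.
  set m := -(2 * β - β ^ 2) * E2 + a * (f' - f) with hm
  set D : ι → ℝ := fun i => m + (2 * (1 - β) * inner ℝ e (N i) + ‖N i‖ ^ 2) with hD
  have hsum : ∀ i, ‖(1 - β) • e + N i‖ ^ 2 + a * (f' + 1) = Ψ + D i := by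
    intro i
    rw [norm_add_sq_real, norm_smul, Real.norm_of_nonneg (by linarith), real_inner_smul_left,
      mul_pow, ← hE2]
    simp only [hD, hm, hΨ]
    ring
  simp only [hsum]
  set ν := avg (fun i => ‖N i‖ ^ 2) with hν
  have hν0 : 0 ≤ ν := avg_nonneg fun i => sq_nonneg _
  have hX2 : 0 ≤ X ^ 2 := sq_nonneg _
  have hfa := abs_le.1 hff
  -- the mean of the increment
  have hDavg : avg D = m + ν := by
    rw [hD, avg_add, avg_const, avg_add, avg_const_mul, avg_inner, hN, inner_zero_right]
    ring
  -- The weight 60Λ²η turns the descent term into −30Λ²X², which dominates the part 2Λ²X² of the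
  -- noise variance. Since κ is large, the contraction of the error absorbs the gradient error in
  -- the descent inequality.
  have hm' : m ≤ -(3 / 2 * β * E2) - 30 * Λ ^ 2 * X ^ 2 := by
    have e1 : a * (f' - f) ≤ a * (-(X ^ 2 / (2 * η)) + η * (16 * E2)) := by
      gcongr; linarith
    have e2 : a * (-(X ^ 2 / (2 * η)) + η * (16 * E2))
        = -(30 * Λ ^ 2 * X ^ 2) + 960 * Λ ^ 2 * η ^ 2 * E2 := by
      rw [ha]; field_simp; ring
    have e3 : 960 * Λ ^ 2 * η ^ 2 ≤ 1 / 4 * β := by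
      rw [hβ]
      linarith [mul_le_mul_of_nonneg_right hκ (sq_nonneg η),
        mul_nonneg (sq_nonneg Λ) (sq_nonneg η)]
    have e4 : β ^ 2 ≤ 1 / 4 * β := by
      rw [sq]; exact mul_le_mul_of_nonneg_right (by linarith) hβ0.le
    have e5 := mul_le_mul_of_nonneg_right e3 hE0
    have e6 := mul_le_mul_of_nonneg_right e4 hE0
    rw [hm]
    linarith
  have hDavg' : avg D ≤ -(3 / 2 * β * E2) - 28 * Λ ^ 2 * X ^ 2 + s * η ^ 4 := by
    rw [hDavg]; linarith
  -- the size of the increment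
  have hin : ∀ i, |inner ℝ e (N i)| ≤ ‖e‖ * ‖N i‖ := fun i => abs_real_inner_le_norm _ _
  have hN2b : ∀ i, ‖N i‖ ^ 2 ≤ cN ^ 2 * η ^ 2 := fun i => by
    rw [← mul_pow]; exact pow_le_pow_left₀ (norm_nonneg _) (hNb i) 2
  have hN2c : cN ^ 2 * η ^ 2 ≤ 5 / 4 * η := by
    linarith [mul_le_mul_of_nonneg_right h1 hη.le]
  have hβ2 : 0 ≤ 2 * β - β ^ 2 := by
    linarith [mul_le_mul_of_nonneg_right (show β ≤ 1 by linarith) hβ0.le]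
  -- The `+ 1` next to the gap is needed here: it gives Ψ ≥ E2 + a, and a dominates both the squared
  -- noise, of order η², and the change of the gap term.
  have hDle : ∀ i, D i ≤ Ψ := by
    intro i
    have e1 : 2 * (1 - β) * inner ℝ e (N i) ≤ E2 + ‖N i‖ ^ 2 := by
      have := (le_abs_self _).trans (hin i)
      have p0 : 0 ≤ ‖e‖ * ‖N i‖ := by positivity
      have p1 : (1 - β) * inner ℝ e (N i) ≤ (1 - β) * (‖e‖ * ‖N i‖) := by
        gcongr; linarith
      have p2 : (1 - β) * (‖e‖ * ‖N i‖) ≤ 1 * (‖e‖ * ‖N i‖) := by gcongr; linarith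
      linarith [two_mul_le_add_sq ‖e‖ ‖N i‖]
    have e2 : 2 * (cN ^ 2 * η ^ 2) ≤ a / 2 := by linarith
    have e3 : a * (f' - f) ≤ a / 2 := by
      have : cF * X ≤ cF * (Z * η) := by gcongr
      have : f' - f ≤ 1 / 2 := by linarith
      linarith [mul_le_mul_of_nonneg_left this ha0.le]
    have e4 : -(2 * β - β ^ 2) * E2 ≤ 0 := by
      linarith [mul_nonneg hβ2 hE0]
    have := hN2b i
    simp only [hD, hm]
    have : E2 + a ≤ Ψ := by rw [hΨ]; linarith [mul_nonneg ha0.le hf]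
    linarith
  have hDsq : ∀ i, D i ^ 2 ≤ (24 * β ^ 2 * E2 ^ 2 + 6 * a ^ 2 * cF ^ 2 * X ^ 2)
      + (8 * E2 + 6 * (cN ^ 2 * η ^ 2)) * ‖N i‖ ^ 2 := by
    intro i
    set q := 2 * (1 - β) * inner ℝ e (N i) with hq
    set w := ‖N i‖ ^ 2 with hw
    have e1 : q ^ 2 ≤ 4 * (E2 * w) := by
      have p1 : inner ℝ e (N i) ^ 2 ≤ E2 * w := by
        rw [← sq_abs, hE2, hw, ← mul_pow]
        exact pow_le_pow_left₀ (abs_nonneg _) (hin i) 2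
      have p2 : (1 - β) ^ 2 ≤ 1 := pow_le_one₀ (by linarith) (by linarith)
      have p3 := mul_le_mul p2 p1 (sq_nonneg _) zero_le_one
      rw [hq, mul_pow, mul_pow]
      linarith
    have e2 : w ^ 2 ≤ cN ^ 2 * η ^ 2 * w := by
      rw [sq w]
      exact mul_le_mul_of_nonneg_right (hN2b i) (sq_nonneg _)
    have e3 : (a * (f' - f)) ^ 2 ≤ a ^ 2 * cF ^ 2 * X ^ 2 := by
      rw [mul_pow, mul_assoc, ← mul_pow cF X, ← sq_abs (f' - f)]
      gcongr
    have e4 : (-(2 * β - β ^ 2) * E2) ^ 2 ≤ 4 * β ^ 2 * E2 ^ 2 := by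
      rw [mul_pow]
      have p1 : 2 * β - β ^ 2 ≤ 2 * β := by linarith [sq_nonneg β]
      have p2 := pow_le_pow_left₀ hβ2 p1 2
      rw [neg_sq]
      gcongr
      linarith
    set A := -(2 * β - β ^ 2) * E2
    set B := a * (f' - f)
    have e5 : D i = q + (A + B + w) := by simp only [hD, hm]; ring
    rw [e5]
    linarith [sq_add_add_add_le q A B w]
  have hDsqavg : avg (fun i => D i ^ 2) ≤ (24 * β ^ 2 * E2 ^ 2 + 6 * a ^ 2 * cF ^ 2 * X ^ 2)
      + (8 * E2 + 6 * (cN ^ 2 * η ^ 2)) * ν := by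
    refine (avg_mono hDsq).trans ?_
    rw [avg_add, avg_const, avg_const_mul]
  refine (avg_pow_three_le hDle).trans ?_
  -- Balance of the terms below, in units of Ψ². For Λ²X², the drift −3·28 cancels 4·3 + 4·9·2. For
  -- βE2, −9/2 + 1/2 leaves −4. For sη⁴, 3 + 4·9 = 39 remain.
  have k1 : 8 * E2 + 6 * (cN ^ 2 * η ^ 2) ≤ 9 * Ψ := by linarith
  have k2 : (8 * E2 + 6 * (cN ^ 2 * η ^ 2)) * ν ≤ 9 * Ψ * (s * η ^ 4 + 2 * Λ ^ 2 * X ^ 2) := by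
    gcongr
  have k3 : 24 * β ^ 2 * E2 ^ 2 ≤ 1 / 8 * β * E2 * Ψ := by
    have p1 : β ^ 2 * E2 ^ 2 ≤ β * (1 / 192) * (E2 * Ψ) := by
      rw [sq, sq]
      gcongr
      linarith
    linarith
  have k4 : 6 * a ^ 2 * cF ^ 2 * X ^ 2 ≤ 3 * Λ ^ 2 * X ^ 2 * Ψ := by
    have p1 : a * cF ^ 2 ≤ Λ ^ 2 / 2 := by
      rw [ha]; linarith [mul_le_mul_of_nonneg_left h3 (sq_nonneg Λ)]
    have p2 : a * (a * cF ^ 2) ≤ Ψ * (Λ ^ 2 / 2) := by gcongr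
    have := mul_le_mul_of_nonneg_right p2 hX2
    linarith
  have k5 : 4 * Ψ * avg (fun i => D i ^ 2) ≤ 4 * Ψ * (1 / 8 * β * E2 * Ψ + 3 * Λ ^ 2 * X ^ 2 * Ψ
      + 9 * Ψ * (s * η ^ 4 + 2 * Λ ^ 2 * X ^ 2)) := by
    gcongr
    linarith
  have k6 : 3 * Ψ ^ 2 * avg D
      ≤ 3 * Ψ ^ 2 * (-(3 / 2 * β * E2) - 28 * Λ ^ 2 * X ^ 2 + s * η ^ 4) := by gcongr
  -- The remaining 39sη⁴Ψ² splits into an E2² part, which the leftover −4βE2Ψ² absorbs, and a part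
  -- of order η⁶ with constant 39·2·60² = 280800.
  have k7 : 39 * s * η ^ 4 * Ψ ^ 2
      ≤ 78 * s * η ^ 4 * E2 ^ 2 + 280800 * s * Λ ^ 4 * (M + 1) ^ 2 * η ^ 6 := by
    have p1 : Ψ ^ 2 ≤ 2 * E2 ^ 2 + 2 * (a * (M + 1)) ^ 2 := by
      have : a * (f + 1) ≤ a * (M + 1) := by gcongr
      have q1 : Ψ ≤ E2 + a * (M + 1) := by rw [hΨ]; linarith
      linarith [add_sq_le (a := E2) (b := a * (M + 1)), pow_le_pow_left₀ hΨ0.le q1 2]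
    calc 39 * s * η ^ 4 * Ψ ^ 2 ≤ 39 * s * η ^ 4 * (2 * E2 ^ 2 + 2 * (a * (M + 1)) ^ 2) := by gcongr
      _ = _ := by rw [ha]; ring
  have k8 : 78 * s * η ^ 4 * E2 ^ 2 ≤ 4 * β * E2 * Ψ ^ 2 := by
    have p1 : E2 * a ≤ Ψ ^ 2 := by rw [sq]; gcongr
    have p2 : 78 * s * η ^ 4 ≤ 4 * β * a := by
      have q1 : η ^ 2 ≤ β := by
        rw [hβ]; exact le_mul_of_one_le_left (sq_nonneg η) (by linarith)
      have q2 : 78 * s * η * η ^ 3 ≤ 240 * η ^ 3 := by gcongr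
      have q3 : η ^ 2 * (60 * η) ≤ β * a := by gcongr
      linarith [show 78 * s * η ^ 4 = 78 * s * η * η ^ 3 by ring,
        show η ^ 2 * (60 * η) = 60 * η ^ 3 by ring]
    calc 78 * s * η ^ 4 * E2 ^ 2 ≤ 4 * β * a * E2 ^ 2 := by gcongr
      _ = 4 * β * E2 * (E2 * a) := by ring
      _ ≤ _ := by gcongr
  linarith

end Avg

end DRO

namespace DRO

variable {d n : ℕ} {P : Constants} {W : Set (EuclideanSpace ℝ (Fin d))}
  {ℓ : Fin n → EuclideanSpace ℝ (Fin d) → ℝ}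

/-! ### The tracking error -/

/-- The space of the gradient and value trackers, weighted by their influence on the estimator. -/
abbrev TrackerSpace (d : ℕ) : Type := WithLp 2 (Point d × ℝ)

/-- The weighted pair of a gradient and a value. -/
def weighted (P : Constants) (v : Point d) (s : ℝ) : TrackerSpace d :=
  WithLp.toLp 2 (P.lamMax • v, (P.lamMax * P.Lg + 1) * s)

/-- The weighted sample `(∇ g_i, g_i)`. -/
def sample (P : Constants) (ℓ : Fin n → EuclideanSpace ℝ (Fin d) → ℝ) (x : Point d) (i : Fin n) :
    TrackerSpace d := weighted P (gradient (gi ℓ i) x) (gi ℓ i x)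

/-- The weighted trackers of a state. -/
def State.tracker (P : Constants) (S : State d) : TrackerSpace d :=
  weighted P (WithLp.toLp 2 (S.v, S.u)) S.s

/-- The tracking error of a state. -/
def State.err (P : Constants) (ℓ : Fin n → EuclideanSpace ℝ (Fin d) → ℝ) (S : State d) :
    TrackerSpace d := S.tracker P - avg (sample P ℓ S.x)

theorem weighted_sub (v w : Point d) (s t : ℝ) :
    weighted P v s - weighted P w t = weighted P (v - w) (s - t) := by
  refine WithLp.ofLp_injective 2 (Prod.ext ?_ ?_)
  · exact (smul_sub _ _ _).symm
  · exact (mul_sub _ _ _).symm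

theorem weighted_add (v w : Point d) (s t : ℝ) :
    weighted P v s + weighted P w t = weighted P (v + w) (s + t) := by
  refine WithLp.ofLp_injective 2 (Prod.ext ?_ ?_)
  · exact (smul_add _ _ _).symm
  · exact (mul_add _ _ _).symm

theorem smul_weighted (c : ℝ) (v : Point d) (s : ℝ) :
    c • weighted P v s = weighted P (c • v) (c * s) := by
  refine WithLp.ofLp_injective 2 (Prod.ext ?_ ?_)
  · exact smul_comm _ _ _
  · exact mul_left_comm _ _ _

theorem sum_weighted {ι : Type*} (t : Finset ι) (v : ι → Point d) (s : ι → ℝ) :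
    ∑ i ∈ t, weighted P (v i) (s i) = weighted P (∑ i ∈ t, v i) (∑ i ∈ t, s i) := by
  classical
  induction t using Finset.induction_on with
  | empty =>
    refine WithLp.ofLp_injective 2 (Prod.ext ?_ ?_)
    · exact (smul_zero _).symm
    · exact (mul_zero _).symm
  | insert i t hi ih => rw [Finset.sum_insert hi, Finset.sum_insert hi, Finset.sum_insert hi, ih,
      weighted_add]

theorem norm_weighted_sq (v : Point d) (s : ℝ) :
    ‖weighted P v s‖ ^ 2 = P.lamMax ^ 2 * ‖v‖ ^ 2 + (P.lamMax * P.Lg + 1) ^ 2 * s ^ 2 := by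
  rw [WithLp.prod_norm_sq_eq_of_L2]
  show ‖P.lamMax • v‖ ^ 2 + ‖(P.lamMax * P.Lg + 1) * s‖ ^ 2 = _
  rw [norm_smul, mul_pow, Real.norm_eq_abs, Real.norm_eq_abs, sq_abs, sq_abs, mul_pow]

namespace ConvexProblem

variable (hP : P.Admissible) (hℓ : ConvexProblem P W ℓ)
include hP hℓ

theorem norm_sample_sub_le {x y : Point d} (hx : x ∈ domain P W) (hy : y ∈ domain P W)
    (i : Fin n) : ‖sample P ℓ x i - sample P ℓ y i‖ ≤ P.LF * ‖x - y‖ := by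
  have h0 := hP.lamMax_pos
  have h1 := hP.Lg_nonneg
  have h2 := P.Ldg_nonneg
  have h3 := hP.one_le_LF
  refine le_of_sq_le_sq ?_ (by positivity)
  rw [sample, sample, weighted_sub, norm_weighted_sq, ← sq_abs (gi ℓ i x - gi ℓ i y)]
  calc _ ≤ P.lamMax ^ 2 * (P.Ldg * ‖x - y‖) ^ 2
          + (P.lamMax * P.Lg + 1) ^ 2 * (P.Lg * ‖x - y‖) ^ 2 := by
        gcongr
        · exact hℓ.norm_gradient_gi_sub_le hP hx hy i
        · exact hℓ.abs_gi_sub_le hP hx hy i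
    _ ≤ (P.lamMax * P.Ldg + (P.lamMax * P.Lg + 1) * P.Lg) ^ 2 * ‖x - y‖ ^ 2 := by
        have : 0 ≤ P.lamMax * P.Ldg * ((P.lamMax * P.Lg + 1) * P.Lg) := by positivity
        nlinarith [mul_nonneg this (sq_nonneg ‖x - y‖)]
    _ ≤ P.LF ^ 2 * ‖x - y‖ ^ 2 := by
        gcongr
        exact hP.LF_ge
    _ = _ := by ring

theorem norm_sample_le {x : Point d} (hx : x ∈ domain P W) (i : Fin n) :
    ‖sample P ℓ x i‖ ≤ P.lamMax * P.Lg + (P.lamMax * P.Lg + 1) * Real.exp (P.C / P.lam₀) := by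
  have h0 := hP.lamMax_pos
  have h1 := hP.Lg_nonneg
  have h2 := hℓ.one_le_gi hP hx i
  have h3 := hℓ.gi_le hP hx i
  have h4 := hℓ.norm_giGrad_le hP hx i
  rw [← hℓ.gradient_gi hP hx] at h4
  refine le_of_sq_le_sq ?_ (by positivity)
  rw [sample, norm_weighted_sq]
  calc _ ≤ P.lamMax ^ 2 * P.Lg ^ 2
          + (P.lamMax * P.Lg + 1) ^ 2 * Real.exp (P.C / P.lam₀) ^ 2 := by gcongr
    _ ≤ _ := by
        have : 0 ≤ P.lamMax * P.Lg * ((P.lamMax * P.Lg + 1) * Real.exp (P.C / P.lam₀)) := by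
          positivity
        nlinarith

theorem avg_sample {x : Point d} (hx : x ∈ domain P W) :
    avg (sample P ℓ x) = weighted P (gradient (g ℓ) x) (g ℓ x) := by
  rw [avg_fin, hℓ.gradient_g hP hx]
  simp only [sample]
  rw [sum_weighted, smul_weighted]
  rfl

theorem avg_norm_sample_sub_sq_le {x : Point d} (hx : x ∈ domain P W) :
    avg (fun i => ‖sample P ℓ x i - avg (sample P ℓ x)‖ ^ 2) ≤ 2 * P.σ ^ 2 * P.LF ^ 2 := by
  have h0 := hP.lamMax_pos
  have h1 := hP.Lg_nonneg
  have h2 := hP.lamMax_le_LF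
  have h3 := hP.lamMax_mul_Lg_le
  have h4 := hP.σg_pos
  have h5 := hP.σdg_pos
  have h6 := hP.σ_pos
  rw [hℓ.avg_sample hP hx]
  simp only [sample, weighted_sub, norm_weighted_sq]
  rw [avg_add, avg_const_mul, avg_const_mul, avg_fin, avg_fin]
  have a1 : P.σdg ≤ P.σ := le_max_right _ _
  have a2 : P.σg ≤ P.σ := le_max_left _ _
  calc _ ≤ P.lamMax ^ 2 * P.σdg ^ 2 + (P.lamMax * P.Lg + 1) ^ 2 * P.σg ^ 2 := by
        gcongr
        · exact hℓ.variance_gradient x hx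
        · exact hℓ.variance x hx
    _ ≤ P.LF ^ 2 * P.σ ^ 2 + P.LF ^ 2 * P.σ ^ 2 := by gcongr
    _ = _ := by ring

theorem norm_err_sq {S : State d} (hx : S.x ∈ domain P W) :
    ‖S.err P ℓ‖ ^ 2 = P.lamMax ^ 2 * (‖S.v - (gradient (g ℓ) S.x).fst‖ ^ 2
      + (S.u - (gradient (g ℓ) S.x).snd) ^ 2)
      + (P.lamMax * P.Lg + 1) ^ 2 * (S.s - g ℓ S.x) ^ 2 := by
  rw [State.err, State.tracker, hℓ.avg_sample hP hx, weighted_sub, norm_weighted_sq,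
    WithLp.prod_norm_sq_eq_of_L2, Real.norm_eq_abs, sq_abs]
  rfl

variable [NeZero n]

/-- g ≥ 1 because the losses are nonnegative, and the value component of the error has weight at
least one. -/
theorem half_le_s {S : State d} (hx : S.x ∈ domain P W) (he : ‖S.err P ℓ‖ ≤ 1 / 2) :
    1 / 2 ≤ S.s := by
  have h1 := hℓ.norm_err_sq hP hx
  have h2 := hℓ.one_le_g hP hx
  have h3 : 1 ≤ P.lamMax * P.Lg + 1 := by
    have := mul_nonneg hP.lamMax_pos.le hP.Lg_nonneg
    linarith
  have h4 : (S.s - g ℓ S.x) ^ 2 ≤ (1 / 2) ^ 2 := by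
    calc (S.s - g ℓ S.x) ^ 2 ≤ (P.lamMax * P.Lg + 1) ^ 2 * (S.s - g ℓ S.x) ^ 2 :=
          le_mul_of_one_le_left (sq_nonneg _) (one_le_pow₀ h3)
      _ ≤ ‖S.err P ℓ‖ ^ 2 := by
          rw [h1]
          exact le_add_of_nonneg_left (by positivity)
      _ ≤ _ := by gcongr
  have := (abs_le_of_sq_le_sq' h4 (by norm_num)).1
  linarith

theorem norm_estimator_sub_sq_le {S : State d} (μ : ℝ) (hx : S.x ∈ domain P W)
    (he : ‖S.err P ℓ‖ ≤ 1 / 2) :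
    ‖estimator P μ S - FmuGrad P ℓ μ S.x‖ ^ 2 ≤ 16 * ‖S.err P ℓ‖ ^ 2 := by
  have hb := hℓ.norm_gradient_g_le hP hx
  rw [FmuGrad, estimator, add_sub_add_right_eq_sub, hℓ.norm_err_sq hP hx]
  exact norm_dualMap_sub_sq_le hP (snd_pos hP hx).le hx.2.2 (hℓ.half_le_s hP hx he)
    (hℓ.one_le_g hP hx) ((norm_fst_le _).trans hb) ((abs_snd_le _).trans hb)

end ConvexProblem

/-! ### One iteration -/

/-- The iterate after one iteration. -/
def State.next (P : Constants) (W : Set (EuclideanSpace ℝ (Fin d))) (μ η : ℝ) (S : State d) :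
    Point d := proj (domain P W) (S.x - η • estimator P μ S)

theorem step_x (μ η β : ℝ) (i : Fin n) (S : State d) :
    (step P W ℓ μ η β i S).x = S.next P W μ η := rfl

/-- The next iterate depends on the state but not on the new sample i, so the noise averages to zero
over i. -/
theorem err_step [NeZero n] (μ η β : ℝ) (i : Fin n) (S : State d) :
    (step P W ℓ μ η β i S).err P ℓ
      = (1 - β) • S.err P ℓ + noise β (sample P ℓ S.x) (sample P ℓ (S.next P W μ η)) i := by
  have h : (step P W ℓ μ η β i S).tracker P
      = sample P ℓ (S.next P W μ η) i + (1 - β) • (S.tracker P - sample P ℓ S.x i) := by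
    rw [State.tracker, State.tracker, sample, sample, weighted_sub, smul_weighted, weighted_add]
    rfl
  rw [State.err, h, State.err, noise, step_x]
  module

end DRO

namespace DRO

variable {d n : ℕ} {P : Constants} {W : Set (EuclideanSpace ℝ (Fin d))}
  {ℓ : Fin n → EuclideanSpace ℝ (Fin d) → ℝ}

/-! ### Constants in the one-step estimates -/

namespace Constants

variable (P : Constants)

/-- The ratio `β / η²`. -/
def ratio : ℝ := 442368 * P.LF ^ 4

/-- A bound for the gradient of the regularised objective. -/
def gradBound : ℝ := P.lamMax * P.Lg + P.C / P.lam₀ + P.ρ + (P.R ^ 2 + P.lamMax ^ 2 + 1)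

/-- A bound for the gradient estimator. -/
def moveBound : ℝ := P.gradBound + 2

/-- A Lipschitz constant of the regularised objective along the iteration. -/
def changeBound : ℝ := P.gradBound + (5 * P.LF + 1) * P.moveBound

/-- A bound for the weighted samples. -/
def sampleBound : ℝ := P.lamMax * P.Lg + (P.lamMax * P.Lg + 1) * Real.exp (P.C / P.lam₀)

/-- A bound for the noise in the trackers, relative to the step size. -/
def noiseBound : ℝ := 2 * P.ratio * P.sampleBound + 2 * P.LF * P.moveBound

/-- The variance of the noise in the trackers, relative to the fourth power of the step size. -/
def varBound : ℝ := 4 * P.ratio ^ 2 * P.σ ^ 2 * P.LF ^ 2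

/-- A bound for the regularised objective. -/
def gapBound : ℝ := P.lamMax * (P.C / P.lam₀) + P.lamMax * P.ρ + (P.R ^ 2 + P.lamMax ^ 2)

/-- The inverse of the step size up to which the one-step estimates hold. -/
def stepScale : ℝ := 4 * (5 * P.LF + 1) + P.noiseBound ^ 2 + 2 * P.changeBound * P.moveBound
  + 120 * P.changeBound ^ 2 + 192 * P.ratio + P.varBound

/-- The growth of the Lyapunov function in one step, relative to the sixth power of the step
size. -/
def growth : ℝ := 64 * (280800 * P.varBound * P.LF ^ 4 * (P.gapBound + 1) ^ 2)

variable {P}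

theorem Admissible.ratio_pos (hP : P.Admissible) : 0 < P.ratio := by
  have := hP.one_le_LF
  unfold ratio
  positivity

theorem Admissible.gradBound_nonneg (hP : P.Admissible) : 0 ≤ P.gradBound := by
  have := hP.lamMax_pos
  have := hP.Lg_nonneg
  have := hP.C_nonneg
  have := hP.lam₀_pos
  have := hP.ρ_pos
  unfold gradBound
  positivity

theorem Admissible.moveBound_nonneg (hP : P.Admissible) : 0 ≤ P.moveBound := by
  have := hP.gradBound_nonneg
  unfold moveBound
  positivity

theorem Admissible.changeBound_nonneg (hP : P.Admissible) : 0 ≤ P.changeBound := by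
  have := hP.gradBound_nonneg
  have := hP.moveBound_nonneg
  have := hP.one_le_LF
  unfold changeBound
  positivity

theorem Admissible.sampleBound_nonneg (hP : P.Admissible) : 0 ≤ P.sampleBound := by
  have := hP.lamMax_pos
  have := hP.Lg_nonneg
  unfold sampleBound
  positivity

theorem varBound_nonneg : 0 ≤ P.varBound := by
  unfold varBound
  positivity

theorem Admissible.gapBound_pos (hP : P.Admissible) : 0 < P.gapBound := by
  have := hP.lamMax_pos
  have := hP.C_nonneg
  have := hP.lam₀_pos
  have := hP.ρ_pos
  unfold gapBound
  positivity

theorem Admissible.growth_nonneg (hP : P.Admissible) : 0 ≤ P.growth := by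
  have := P.varBound_nonneg
  have := hP.gapBound_pos
  unfold growth
  positivity

end Constants

/-- The parameters of a stage in the regime of small step sizes. -/
structure SmallStep (P : Constants) (μ η β : ℝ) : Prop where
  μ_pos : 0 < μ
  μ_le : μ ≤ 1
  η_pos : 0 < η
  β_eq : β = P.ratio * η ^ 2
  scale_le : P.stepScale * η ≤ 1

namespace SmallStep

variable {μ η β : ℝ} (h : SmallStep P μ η β) (hP : P.Admissible)
include h

theorem terms_le (hP : P.Admissible) : (4 * (5 * P.LF + 1)) * η ≤ 1 ∧ P.noiseBound ^ 2 * η ≤ 1 ∧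
    2 * P.changeBound * P.moveBound * η ≤ 1 ∧ 120 * P.changeBound ^ 2 * η ≤ 1 ∧
    192 * P.ratio * η ≤ 1 ∧ P.varBound * η ≤ 1 := by
  have hη := h.η_pos
  have h0 := h.scale_le
  have h1 := hP.one_le_LF
  have a1 : 0 ≤ (4 * (5 * P.LF + 1)) * η := by positivity
  have a2 : 0 ≤ P.noiseBound ^ 2 * η := by positivity
  have a3 : 0 ≤ 2 * P.changeBound * P.moveBound * η := by
    have := hP.changeBound_nonneg
    have := hP.moveBound_nonneg
    positivity
  have a4 : 0 ≤ 120 * P.changeBound ^ 2 * η := by positivity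
  have a5 : 0 ≤ 192 * P.ratio * η := by
    have := hP.ratio_pos
    positivity
  have a6 : 0 ≤ P.varBound * η := by
    have := P.varBound_nonneg
    positivity
  unfold Constants.stepScale at h0
  refine ⟨?_, ?_, ?_, ?_, ?_, ?_⟩ <;> linarith

include hP

theorem η_le : η ≤ 1 := by
  have h1 := (h.terms_le hP).1
  have := hP.one_le_LF
  have := h.η_pos
  nlinarith

theorem β_pos : 0 < β := by
  have := h.η_pos
  have := hP.ratio_pos
  rw [h.β_eq]
  positivity

theorem β_le : 192 * β ≤ 1 := by
  have h1 := (h.terms_le hP).2.2.2.2.1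
  have h2 := h.η_le hP
  have h3 := h.η_pos
  have h4 := hP.ratio_pos
  have h5 : P.ratio * η * η ≤ P.ratio * η * 1 := by gcongr
  rw [h.β_eq]
  nlinarith

end SmallStep

/-- The optimality gap of the regularised objective relative to the point `xs`. -/
def gap (P : Constants) (ℓ : Fin n → EuclideanSpace ℝ (Fin d) → ℝ) (μ : ℝ) (xs x : Point d) : ℝ :=
  Fmu P ℓ μ x - Fmu P ℓ μ xs

/-- A minimizer of the regularised objective. -/
structure IsMinimizer (P : Constants) (W : Set (EuclideanSpace ℝ (Fin d)))
    (ℓ : Fin n → EuclideanSpace ℝ (Fin d) → ℝ) (μ : ℝ) (xs : Point d) : Prop where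
  mem : xs ∈ domain P W
  le : ∀ y ∈ domain P W, Fmu P ℓ μ xs ≤ Fmu P ℓ μ y

theorem IsMinimizer.gap_nonneg {μ : ℝ} {xs x : Point d} (h : IsMinimizer P W ℓ μ xs)
    (hx : x ∈ domain P W) : 0 ≤ gap P ℓ μ xs x := sub_nonneg.2 (h.le x hx)

theorem next_mem (hℓ : ConvexProblem P W ℓ) {S : State d} (hx : S.x ∈ domain P W) (μ η : ℝ) :
    S.next P W μ η ∈ domain P W := proj_mem hℓ ⟨_, hx⟩ _

section OneStep

variable [NeZero n] (hP : P.Admissible) (hℓ : ConvexProblem P W ℓ) {μ η β : ℝ}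
  (h : SmallStep P μ η β) {xs : Point d} {S : State d} (hx : S.x ∈ domain P W)
include hP hℓ

theorem gap_le (hxs : IsMinimizer P W ℓ μ xs) (hμ : 0 ≤ μ) (hμ1 : μ ≤ 1) {x : Point d}
    (hx : x ∈ domain P W) : gap P ℓ μ xs x ≤ P.gapBound := by
  have h1 := hℓ.F_nonneg hP hxs.mem
  have h2 := hℓ.F_le hP hx
  have h3 := hℓ.norm_sq_le hP hx
  have h4 : μ * ‖x‖ ^ 2 / 2 ≤ P.R ^ 2 + P.lamMax ^ 2 := by
    have : μ * ‖x‖ ^ 2 ≤ 1 * ‖x‖ ^ 2 := by gcongr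
    linarith [sq_nonneg ‖x‖]
  have h5 : 0 ≤ μ * ‖xs‖ ^ 2 / 2 := by positivity
  unfold gap Fmu Constants.gapBound
  linarith

include hx h

omit hℓ h [NeZero n] hx in
theorem norm_FmuGrad_le (hℓ : ConvexProblem P W ℓ) [NeZero n] (hμ : 0 ≤ μ) (hμ1 : μ ≤ 1)
    {x : Point d} (hx : x ∈ domain P W) : ‖FmuGrad P ℓ μ x‖ ≤ P.gradBound := by
  have h1 := hℓ.norm_FGrad_le hP hx
  have h2 := hℓ.norm_sq_le hP hx
  have h3 : ‖μ • x‖ ≤ P.R ^ 2 + P.lamMax ^ 2 + 1 := by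
    rw [norm_smul, Real.norm_of_nonneg hμ]
    have : μ * ‖x‖ ≤ 1 * ‖x‖ := by gcongr
    nlinarith [sq_nonneg (‖x‖ - 1)]
  refine (norm_add_le _ _).trans ?_
  unfold Constants.gradBound
  linarith

theorem norm_next_sub_le (he : ‖S.err P ℓ‖ ≤ 1 / 2) :
    ‖S.next P W μ η - S.x‖ ≤ P.moveBound * η := by
  have h1 : ‖S.next P W μ η - S.x‖ ≤ η * ‖estimator P μ S‖ :=
    norm_sub_le_of_projected_step h.η_pos (inner_proj_nonpos hℓ ⟨_, hx⟩ _ hx)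
  have h2 := hℓ.norm_estimator_sub_sq_le hP μ hx he
  have h3 : ‖estimator P μ S - FmuGrad P ℓ μ S.x‖ ^ 2 ≤ 2 ^ 2 := by
    have : ‖S.err P ℓ‖ ^ 2 ≤ (1 / 2) ^ 2 := by gcongr
    linarith
  have h4 := le_of_sq_le_sq h3 (by norm_num)
  have h5 := norm_FmuGrad_le hP hℓ h.μ_pos.le h.μ_le hx
  have h6 : ‖estimator P μ S‖ ≤ P.moveBound := by
    have := norm_add_le (estimator P μ S - FmuGrad P ℓ μ S.x) (FmuGrad P ℓ μ S.x)
    rw [sub_add_cancel] at this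
    unfold Constants.moveBound
    linarith
  rw [mul_comm]
  have := h.η_pos
  exact h1.trans (by gcongr)

theorem gap_next_le (he : ‖S.err P ℓ‖ ≤ 1 / 2) :
    gap P ℓ μ xs (S.next P W μ η) ≤ gap P ℓ μ xs S.x
      - ‖S.next P W μ η - S.x‖ ^ 2 / (2 * η) + η * (16 * ‖S.err P ℓ‖ ^ 2) := by
  have h1 := descent_of_projected_step h.η_pos
    (inner_proj_nonpos hℓ ⟨_, hx⟩ (S.x - η • estimator P μ S) hx)
    (hℓ.Fmu_upper hP μ hx (next_mem hℓ hx μ η)) (hℓ.norm_estimator_sub_sq_le hP μ hx he) (by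
      have h2 := (h.terms_le hP).1
      have := h.η_pos
      have := h.μ_le
      nlinarith)
  change Fmu P ℓ μ (S.next P W μ η) ≤ Fmu P ℓ μ S.x - ‖S.next P W μ η - S.x‖ ^ 2 / (2 * η)
    + η * (16 * ‖S.err P ℓ‖ ^ 2) at h1
  unfold gap
  linarith

theorem gap_next_add_le (hxs : xs ∈ domain P W) (he : ‖S.err P ℓ‖ ≤ 1 / 2) :
    gap P ℓ μ xs (S.next P W μ η) + ‖S.next P W μ η - xs‖ ^ 2 / (2 * η)
      ≤ ‖S.x - xs‖ ^ 2 / (2 * η) + 16 * ‖S.err P ℓ‖ ^ 2 / μ :=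
  progress_of_projected_step h.η_pos h.μ_pos
    (inner_proj_nonpos hℓ ⟨_, hx⟩ (S.x - η • estimator P μ S) hxs)
    (hℓ.Fmu_upper hP μ hx (next_mem hℓ hx μ η)) (hℓ.Fmu_lower hP μ hx hxs)
    (hℓ.norm_estimator_sub_sq_le hP μ hx he) (by
      have h2 := (h.terms_le hP).1
      have := h.η_pos
      have := h.μ_le
      nlinarith)

theorem abs_gap_next_sub_le (he : ‖S.err P ℓ‖ ≤ 1 / 2) :
    |gap P ℓ μ xs (S.next P W μ η) - gap P ℓ μ xs S.x|
      ≤ P.changeBound * ‖S.next P W μ η - S.x‖ := by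
  have h1 := hℓ.Fmu_upper hP μ hx (next_mem hℓ hx μ η)
  have h2 := hℓ.Fmu_lower hP μ hx (next_mem hℓ hx μ η)
  have h3 := norm_next_sub_le hP hℓ h hx he
  have h4 := norm_FmuGrad_le hP hℓ h.μ_pos.le h.μ_le hx
  have h5 := abs_le.1 (abs_real_inner_le_norm (FmuGrad P ℓ μ S.x) (S.next P W μ η - S.x))
  set X := ‖S.next P W μ η - S.x‖
  have hX : 0 ≤ X := norm_nonneg _
  have h6 : ‖FmuGrad P ℓ μ S.x‖ * X ≤ P.gradBound * X := by gcongr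
  have h7 : (5 * P.LF + μ / 2) * X ^ 2 ≤ (5 * P.LF + 1) * (P.moveBound * X) := by
    have hm := hP.moveBound_nonneg
    have : X ≤ P.moveBound * 1 := h3.trans (by have := h.η_le hP; gcongr)
    rw [sq]
    have := h.μ_le
    have := hP.one_le_LF
    gcongr
    · linarith
    · linarith
  have h8 : 0 ≤ (5 * P.LF + 1) * (P.moveBound * X) := by
    have := hP.one_le_LF
    have := hP.moveBound_nonneg
    positivity
  have h9 : 0 ≤ μ / 2 * X ^ 2 := by
    have := h.μ_pos
    positivity
  have h10 : P.changeBound * X = P.gradBound * X + (5 * P.LF + 1) * (P.moveBound * X) := by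
    unfold Constants.changeBound; ring
  rw [abs_le, gap, gap, h10]
  constructor <;> linarith

omit h in
theorem avg_norm_noise_state_sq_le (hβ0 : 0 ≤ β) (hβ1 : β ≤ 1) :
    avg (fun i => ‖noise β (sample P ℓ S.x) (sample P ℓ (S.next P W μ η)) i‖ ^ 2)
      ≤ 4 * β ^ 2 * P.σ ^ 2 * P.LF ^ 2 + 2 * P.LF ^ 2 * ‖S.next P W μ η - S.x‖ ^ 2 := by
  have hx' := next_mem hℓ hx μ η
  refine (avg_norm_noise_sq_le hβ0 hβ1 (hℓ.avg_norm_sample_sub_sq_le hP hx')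
    (hℓ.norm_sample_sub_le hP hx' hx)).trans (le_of_eq ?_)
  ring

theorem norm_noise_state_le (he : ‖S.err P ℓ‖ ≤ 1 / 2) (i : Fin n) :
    ‖noise β (sample P ℓ S.x) (sample P ℓ (S.next P W μ η)) i‖ ≤ P.noiseBound * η := by
  have hx' := next_mem hℓ hx μ η
  have hβ1 := h.β_le hP
  have hβ0 := h.β_pos hP
  refine (norm_noise_le hβ0.le (by linarith) (hℓ.norm_sample_le hP hx')
    (hℓ.norm_sample_sub_le hP hx' hx) i).trans ?_
  have h1 := norm_next_sub_le hP hℓ h hx he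
  have h2 := hP.one_le_LF
  have h3 := hP.sampleBound_nonneg
  have h4 : β ≤ P.ratio * η := by
    rw [h.β_eq, sq, ← mul_assoc]
    have := h.η_le hP
    have := hP.ratio_pos
    have := h.η_pos
    exact mul_le_of_le_one_right (by positivity) (by assumption)
  change 2 * β * P.sampleBound + 2 * (P.LF * ‖S.next P W μ η - S.x‖) ≤ _
  calc _ ≤ 2 * (P.ratio * η) * P.sampleBound + 2 * (P.LF * (P.moveBound * η)) := by gcongr
    _ = _ := by unfold Constants.noiseBound; ring

end OneStep

/-! ### Potential functions -/

/-- The Lyapunov function that controls the probability of a large tracking error. -/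
def lyapunov (P : Constants) (ℓ : Fin n → EuclideanSpace ℝ (Fin d) → ℝ) (μ η : ℝ) (xs : Point d)
    (S : State d) : ℝ :=
  64 * (‖S.err P ℓ‖ ^ 2 + 60 * P.LF ^ 2 * η * (gap P ℓ μ xs S.x + 1)) ^ 3

/-- The merit of a state: the optimality gap plus a multiple of the squared tracking error. -/
def merit (P : Constants) (ℓ : Fin n → EuclideanSpace ℝ (Fin d) → ℝ) (μ : ℝ) (xs : Point d)
    (S : State d) : ℝ := gap P ℓ μ xs S.x + 16 / μ * ‖S.err P ℓ‖ ^ 2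

/-- The potential whose decrease in one step pays for the merit. -/
def potential (P : Constants) (ℓ : Fin n → EuclideanSpace ℝ (Fin d) → ℝ) (μ η β : ℝ)
    (xs : Point d) (S : State d) : ℝ :=
  ‖S.x - xs‖ ^ 2 / (2 * η) + (1 + 132 * P.LF ^ 2 * η / (μ * β)) * gap P ℓ μ xs S.x
    + 33 / (μ * β) * ‖S.err P ℓ‖ ^ 2

section Potential

variable [NeZero n] (hP : P.Admissible) (hℓ : ConvexProblem P W ℓ) {μ η β : ℝ}
  {xs : Point d} (hxs : IsMinimizer P W ℓ μ xs) {S : State d} (hx : S.x ∈ domain P W)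
include hxs hx

omit [NeZero n] in
theorem lyapunov_nonneg (hη : 0 ≤ η) : 0 ≤ lyapunov P ℓ μ η xs S := by
  have := hxs.gap_nonneg hx
  unfold lyapunov
  positivity

omit [NeZero n] in
-- Step sizes shrink from stage to stage, so changing the stage never increases the Lyapunov
-- function.
theorem lyapunov_mono {η' : ℝ} (hη : 0 ≤ η) (hηη' : η ≤ η') :
    lyapunov P ℓ μ η xs S ≤ lyapunov P ℓ μ η' xs S := by
  have := hxs.gap_nonneg hx
  unfold lyapunov
  gcongr

omit [NeZero n] in
-- An error above 1/2 makes the base of the cube at least 1/4, whence the factor 64 = 4³.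
theorem one_le_lyapunov (hη : 0 ≤ η) (he : 1 / 2 < ‖S.err P ℓ‖) : 1 ≤ lyapunov P ℓ μ η xs S := by
  have h1 := hxs.gap_nonneg hx
  have h2 : 1 / 4 ≤ ‖S.err P ℓ‖ ^ 2 + 60 * P.LF ^ 2 * η * (gap P ℓ μ xs S.x + 1) := by
    have : 0 ≤ 60 * P.LF ^ 2 * η * (gap P ℓ μ xs S.x + 1) := by positivity
    nlinarith
  have h3 := pow_le_pow_left₀ (by norm_num) h2 3
  unfold lyapunov
  linarith

omit [NeZero n] in
theorem potential_nonneg (hμ : 0 ≤ μ) (hη : 0 ≤ η) (hβ : 0 ≤ β) :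
    0 ≤ potential P ℓ μ η β xs S := by
  have := hxs.gap_nonneg hx
  unfold potential
  positivity

include hP hℓ

theorem avg_lyapunov_step_le (h : SmallStep P μ η β) (he : ‖S.err P ℓ‖ ≤ 1 / 2) :
    avg (fun i => lyapunov P ℓ μ η xs (step P W ℓ μ η β i S))
      ≤ lyapunov P ℓ μ η xs S + P.growth * η ^ 6 := by
  have hβ1 := h.β_le hP
  have hβ0 := h.β_pos hP
  have hη := h.η_pos
  obtain ⟨t1, t2, t3, t4, t5, t6⟩ := h.terms_le hP
  have key := avg_lyapunov_pow_three_le (e := S.err P ℓ) (β := β) (Λ := P.LF)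
    (avg_noise (a := sample P ℓ S.x) (b := sample P ℓ (S.next P W μ η)) (β := β))
    hη hP.one_le_LF (κ := P.ratio) (by
      unfold Constants.ratio
      have := pow_le_pow_right₀ hP.one_le_LF (show 2 ≤ 4 by norm_num)
      linarith) h.β_eq
    (norm_next_sub_le hP hℓ h hx he)
    (hxs.gap_nonneg hx) (gap_le hP hℓ hxs h.μ_pos.le h.μ_le hx) P.varBound_nonneg
    ((avg_norm_noise_state_sq_le hP hℓ hx hβ0.le (by linarith)).trans (le_of_eq (by
      rw [h.β_eq]; unfold Constants.varBound; ring)))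
    (norm_noise_state_le hP hℓ h hx he) (gap_next_le hP hℓ h hx he)
    (abs_gap_next_sub_le hP hℓ h hx he) hP.changeBound_nonneg
    (by linarith) t3 t4 hβ1 (by linarith)
  unfold lyapunov
  simp only [err_step, step_x]
  rw [avg_const_mul]
  unfold Constants.growth
  linarith

theorem avg_potential_step_le (h : SmallStep P μ η β) (he : ‖S.err P ℓ‖ ≤ 1 / 2) :
    avg (fun i => potential P ℓ μ η β xs (step P W ℓ μ η β i S)) + merit P ℓ μ xs S
      ≤ potential P ℓ μ η β xs S + 132 * β * P.σ ^ 2 * P.LF ^ 2 / μ := by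
  have hβ1 := h.β_le hP
  have hβ0 := h.β_pos hP
  have hη := h.η_pos
  have hμ := h.μ_pos
  have hΛ := hP.one_le_LF
  have a1 := gap_next_le (xs := xs) hP hℓ h hx he
  -- This controls the gap at the next iterate, whereas the merit contains the gap at S; the summand
  -- 1 in the weight of the gap in `potential` makes up for the shift.
  have a2 := gap_next_add_le hP hℓ h hx hxs.mem he
  have a3 := avg_norm_noise_state_sq_le (η := η) (μ := μ) hP hℓ hx hβ0.le (by linarith)
  have a4 := avg_norm_tracker_sq_le (e := S.err P ℓ) hβ0.le (by linarith)
    (avg_noise (a := sample P ℓ S.x) (b := sample P ℓ (S.next P W μ η)) (β := β))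
  unfold potential merit
  simp only [err_step, step_x]
  rw [avg_add, avg_const, avg_const_mul]
  set f := gap P ℓ μ xs S.x
  set f' := gap P ℓ μ xs (S.next P W μ η)
  set A := avg fun i => ‖(1 - β) • S.err P ℓ
    + noise β (sample P ℓ S.x) (sample P ℓ (S.next P W μ η)) i‖ ^ 2
  set X2 := ‖S.next P W μ η - S.x‖ ^ 2
  set E2 := ‖S.err P ℓ‖ ^ 2
  have hE2 : 0 ≤ E2 := sq_nonneg _
  have b1 : A ≤ (1 - β) * E2 + (4 * β ^ 2 * P.σ ^ 2 * P.LF ^ 2 + 2 * P.LF ^ 2 * X2) :=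
    a4.trans (by linarith)
  have b2 : 33 / (μ * β) * A ≤ 33 / (μ * β) * ((1 - β) * E2
      + (4 * β ^ 2 * P.σ ^ 2 * P.LF ^ 2 + 2 * P.LF ^ 2 * X2)) := by gcongr
  have b3 : 132 * P.LF ^ 2 * η / (μ * β) * f' ≤ 132 * P.LF ^ 2 * η / (μ * β)
      * (f - X2 / (2 * η) + η * (16 * E2)) := by gcongr
  -- The weight of the gap is chosen so that its descent term, 132/2, cancels the movement part 33·2
  -- of the noise variance in `b5`.
  have b4 : 132 * P.LF ^ 2 * η / (μ * β) * (f - X2 / (2 * η) + η * (16 * E2))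
      = 132 * P.LF ^ 2 * η / (μ * β) * f - 33 / (μ * β) * (2 * P.LF ^ 2 * X2)
        + 2112 * P.LF ^ 2 * η ^ 2 / β * E2 / μ := by
    field_simp
    ring
  have b5 : 33 / (μ * β) * ((1 - β) * E2 + (4 * β ^ 2 * P.σ ^ 2 * P.LF ^ 2 + 2 * P.LF ^ 2 * X2))
      = 33 / (μ * β) * E2 - 33 * E2 / μ + 132 * β * P.σ ^ 2 * P.LF ^ 2 / μ
        + 33 / (μ * β) * (2 * P.LF ^ 2 * X2) := by
    field_simp
    ring
  have b6 : 2112 * P.LF ^ 2 * η ^ 2 / β ≤ 1 := by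
    rw [div_le_one hβ0, h.β_eq, Constants.ratio]
    have : P.LF ^ 2 ≤ P.LF ^ 4 := pow_le_pow_right₀ hΛ (by norm_num)
    gcongr
    norm_num
  have b7 : 2112 * P.LF ^ 2 * η ^ 2 / β * E2 / μ ≤ 1 * E2 / μ := by gcongr
  have b8 : 16 / μ * E2 = 16 * E2 / μ := by ring
  -- The contraction of the error pays for three things: the merit, the gradient error in the
  -- progress inequality, and the gradient error in the descent inequality.
  have b9 : 33 * E2 / μ = 16 * E2 / μ + 16 * E2 / μ + 1 * E2 / μ := by ring
  linarith

/-- Quadratic growth bounds the distance to the minimizer by the gap, so every part of the potential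
is a multiple of the merit. The three conditions on T reflect the three terms in the definition of
T_k. -/
theorem potential_le (h : SmallStep P μ η β) {T : ℝ} (hT1 : 192 ≤ T) (hT2 : 8 ≤ μ * η * T)
    (hT3 : 192 ≤ β * T) : potential P ℓ μ η β xs S ≤ T * (1 / 3 * merit P ℓ μ xs S) := by
  have hβ0 := h.β_pos hP
  have hη := h.η_pos
  have hμ := h.μ_pos
  have hΛ := hP.one_le_LF
  have hf := hxs.gap_nonneg hx
  have hg := hℓ.quadratic_growth hP μ hx hxs.mem hxs.le
  change μ / 2 * ‖S.x - xs‖ ^ 2 ≤ gap P ℓ μ xs S.x at hg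
  unfold potential merit
  set f := gap P ℓ μ xs S.x
  set E2 := ‖S.err P ℓ‖ ^ 2
  have hE2 : 0 ≤ E2 := sq_nonneg _
  have c1 : ‖S.x - xs‖ ^ 2 / (2 * η) ≤ T / 8 * f := by
    rw [div_le_iff₀ (by positivity)]
    have : 8 * f ≤ μ * η * T * f := by gcongr
    have : μ * (2 * ‖S.x - xs‖ ^ 2) ≤ μ * (T * f * η / 2) := by linarith
    have := le_of_mul_le_mul_left this hμ
    linarith
  have c2 : 132 * P.LF ^ 2 * η / (μ * β) ≤ T / 8 := by
    rw [div_le_iff₀ (by positivity), h.β_eq, Constants.ratio]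
    have e1 : P.LF ^ 2 ≤ P.LF ^ 4 := pow_le_pow_right₀ hΛ (by norm_num)
    have e2 : P.LF ^ 4 * η * 8 ≤ P.LF ^ 4 * η * (μ * η * T) := by gcongr
    have e3 : P.LF ^ 2 * η ≤ P.LF ^ 4 * η := by gcongr
    have e4 : 0 ≤ P.LF ^ 4 * η := by positivity
    linarith
  have c3 : (1 + 132 * P.LF ^ 2 * η / (μ * β)) * f ≤ (T / 192 + T / 8) * f := by
    gcongr
    linarith
  have c4 : 33 / (μ * β) * E2 ≤ T * (1 / 3 * (16 / μ * E2)) := by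
    have e1 : 33 / (μ * β) ≤ T * (16 / 3) / μ := by
      rw [div_le_div_iff₀ (by positivity) hμ]
      have : μ * 33 ≤ μ * (β * T * (16 / 3)) := by gcongr; linarith
      linarith
    calc _ ≤ T * (16 / 3) / μ * E2 := by gcongr
      _ = _ := by ring
  have c5 : 0 ≤ T * f := by positivity
  linarith

end Potential

end DRO

namespace DRO

/-! ### Cumulative costs along a random iteration -/

section Cumulative

variable {ι Ω : Type*} [Fintype ι]

/-- The expected total of `u` over the first `m` states of the iteration that starts at `S` and
applies `stp i` for independent uniform `i`. -/
def cumulative (stp : ι → Ω → Ω) (u : Ω → ℝ) : ℕ → Ω → ℝ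
  | 0, _ => 0
  | m + 1, S => u S + avg fun i => cumulative stp u m (stp i S)

theorem cumulative_mem_Icc [Nonempty ι] {stp : ι → Ω → Ω} {D : Set Ω} {u : Ω → ℝ} {M : ℝ}
    (hD : ∀ S ∈ D, ∀ i, stp i S ∈ D) (hu : ∀ S ∈ D, 0 ≤ u S) (huM : ∀ S ∈ D, u S ≤ M) (m : ℕ) :
    ∀ S ∈ D, 0 ≤ cumulative stp u m S ∧ cumulative stp u m S ≤ m * M := by
  induction m with
  | zero => intro S _; simp [cumulative]
  | succ m ih =>
    intro S hS
    have h1 := avg_nonneg fun i => (ih _ (hD S hS i)).1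
    have h2 := avg_le fun i => (ih _ (hD S hS i)).2
    rw [cumulative]
    push_cast
    constructor <;> linarith [huM S hS, hu S hS]

/-- If a cost is bounded by `M` and, up to `h + M * Lyap`, by a cost `q` for which `V` is a
potential on the good states, and if `Lyap` is at least one on the bad states and has small drift
on the good ones, then the total cost is controlled by `V` and `Lyap`. -/
theorem cumulative_le [Nonempty ι] {stp : ι → Ω → Ω} {D good : Set Ω} {u q V Lyap : Ω → ℝ}
    {M h κ ν : ℝ} (hM : 0 ≤ M) (hκh : 0 ≤ κ + h) (hν : 0 ≤ ν)
    (hD : ∀ S ∈ D, ∀ i, stp i S ∈ D) (hu0 : ∀ S ∈ D, 0 ≤ u S) (huM : ∀ S ∈ D, u S ≤ M)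
    (hu : ∀ S ∈ D, u S ≤ q S + h + M * Lyap S) (hV : ∀ S ∈ D, 0 ≤ V S)
    (hL : ∀ S ∈ D, 0 ≤ Lyap S) (hbad : ∀ S ∈ D, S ∉ good → 1 ≤ Lyap S)
    (hVstep : ∀ S ∈ D, S ∈ good → avg (fun i => V (stp i S)) + q S ≤ V S + κ)
    (hLstep : ∀ S ∈ D, S ∈ good → avg (fun i => Lyap (stp i S)) ≤ Lyap S + ν) (m : ℕ) :
    ∀ S ∈ D, cumulative stp u m S ≤ V S + m * (κ + h) + M * m * (Lyap S + m * ν) := by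
  induction m with
  | zero => intro S hS; simpa [cumulative] using hV S hS
  | succ m ih =>
    intro S hS
    have hm : (0 : ℝ) ≤ m := m.cast_nonneg
    have hV0 := hV S hS
    have hL0 := hL S hS
    by_cases hg : S ∈ good
    · have h1 := avg_mono fun i => ih _ (hD S hS i)
      rw [avg_add, avg_add, avg_const, avg_const_mul, avg_add, avg_const] at h1
      have h2 := hu S hS
      have h3 := hVstep S hS hg
      have h4 := mul_le_mul_of_nonneg_left (hLstep S hS hg) (mul_nonneg hM hm)
      have h5 : 0 ≤ M * m * ν := by positivity
      have h6 : 0 ≤ M * ν := by positivity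
      rw [cumulative]
      push_cast
      linarith
    -- From a bad state on nothing is known about the iteration; the trivial bound (m + 1)M for the
    -- whole remaining cost is charged to Lyap(S) ≥ 1.
    · have h1 := (cumulative_mem_Icc hD hu0 huM (m + 1) S hS).2
      have h2 := mul_le_mul_of_nonneg_left (hbad S hS hg) hM
      push_cast at h1 ⊢
      have h3 : (m + 1 : ℝ) * (M * 1) ≤ (m + 1) * (M * Lyap S) := by gcongr
      have h4 : 0 ≤ M * (m + 1) * ((m + 1) * ν) := by positivity
      have h5 : 0 ≤ (m + 1 : ℝ) * (κ + h) := by positivity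
      linarith

end Cumulative

theorem avg_cons {E : Type*} [AddCommGroup E] [Module ℝ E] {ι : Type*} [Fintype ι] {m : ℕ}
    (a : (Fin (m + 1) → ι) → E) :
    avg a = avg fun i : ι => avg fun ξ : Fin m → ι => a (Fin.cons i ξ) := by
  rw [avg_avg]
  exact (avg_equiv (Fin.consEquiv fun _ : Fin (m + 1) => ι) a).symm

variable {d n : ℕ} {P : Constants} {W : Set (EuclideanSpace ℝ (Fin d))}
  {ℓ : Fin n → EuclideanSpace ℝ (Fin d) → ℝ} {μ η β : ℝ}

theorem trajectory_zero (S : State d) {T : ℕ} (ξ : Fin T → Fin n) :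
    trajectory P W ℓ μ η β S ξ 0 = S := rfl

theorem trajectory_succ (S : State d) {T : ℕ} (ξ : Fin T → Fin n) (t : Fin T) :
    trajectory P W ℓ μ η β S ξ t.succ
      = step P W ℓ μ η β (ξ t) (trajectory P W ℓ μ η β S ξ t.castSucc) := rfl

theorem trajectory_cons_succ (S : State d) {T : ℕ} (i : Fin n) (ξ : Fin T → Fin n)
    (t : Fin (T + 1)) :
    trajectory P W ℓ μ η β S (Fin.cons i ξ : Fin (T + 1) → Fin n) t.succ
      = trajectory P W ℓ μ η β (step P W ℓ μ η β i S) ξ t := by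
  induction t using Fin.induction with
  | zero => rfl
  | succ t ih =>
    rw [trajectory_succ, Fin.castSucc_succ, ih, Fin.cons_succ, trajectory_succ]

/-- Conditioning on the first sample turns the average over sample paths into the recursion. Only
the states before the last one count, since τ ≤ T. -/
theorem avg_sum_trajectory [NeZero n] (u : State d → ℝ) (T : ℕ) (S : State d) :
    avg (fun ξ : Fin T → Fin n => ∑ τ : Fin T, u (trajectory P W ℓ μ η β S ξ τ.castSucc))
      = cumulative (step P W ℓ μ η β) u T S := by
  induction T generalizing S with
  | zero => simp [cumulative, avg]
  | succ T ih =>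
    rw [avg_cons, cumulative]
    simp only [Fin.sum_univ_succ, Fin.castSucc_zero, trajectory_zero, Fin.castSucc_succ,
      trajectory_cons_succ]
    simp only [avg_add, avg_const, ih]

theorem trajectory_mem (hℓ : ConvexProblem P W ℓ) {S : State d} (hx : S.x ∈ domain P W) {T : ℕ}
    (ξ : Fin T → Fin n) (t : Fin (T + 1)) :
    (trajectory P W ℓ μ η β S ξ t).x ∈ domain P W := by
  induction t using Fin.induction with
  | zero => exact hx
  | succ t ih =>
    rw [trajectory_succ]
    exact next_mem hℓ ih μ η

/-! ### Expectations of nonnegative functions -/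

section Expectation

open ENNReal

/-- The expectation of a nonnegative function. -/
def expectation {α : Type*} (p : PMF α) (f : α → ℝ≥0∞) : ℝ≥0∞ := ∑' a, p a * f a

variable {α γ : Type*}

theorem expectation_bind (p : PMF α) (q : α → PMF γ) (f : γ → ℝ≥0∞) :
    expectation (p.bind q) f = expectation p fun a => expectation (q a) f := by
  simp only [expectation, PMF.bind_apply, ← ENNReal.tsum_mul_right, ← ENNReal.tsum_mul_left]
  rw [ENNReal.tsum_comm]
  simp only [mul_assoc]

theorem expectation_pure (a : α) (f : α → ℝ≥0∞) : expectation (PMF.pure a) f = f a := by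
  rw [expectation, tsum_eq_single a fun b hb => by simp [PMF.pure_apply, hb]]
  simp

theorem expectation_map (p : PMF α) (h : α → γ) (f : γ → ℝ≥0∞) :
    expectation (p.map h) f = expectation p fun a => f (h a) := by
  rw [PMF.map, expectation_bind]
  simp only [Function.comp_apply, expectation_pure]

theorem expectation_const (p : PMF α) (c : ℝ≥0∞) : expectation p (fun _ => c) = c := by
  rw [expectation, ENNReal.tsum_mul_right, p.tsum_coe, one_mul]

theorem expectation_mono {p : PMF α} {f f' : α → ℝ≥0∞} (h : ∀ a ∈ p.support, f a ≤ f' a) :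
    expectation p f ≤ expectation p f' := by
  refine ENNReal.tsum_le_tsum fun a => ?_
  by_cases ha : a ∈ p.support
  · exact mul_le_mul_right (h a ha) _
  · rw [PMF.mem_support_iff, not_not] at ha
    simp [ha]

theorem expectation_uniform [Fintype α] [Nonempty α] {f : α → ℝ} (hf : ∀ a, 0 ≤ f a) :
    expectation (PMF.uniformOfFintype α) (fun a => ENNReal.ofReal (f a))
      = ENNReal.ofReal (avg f) := by
  have hc : (0 : ℝ) < Fintype.card α := Nat.cast_pos.2 Fintype.card_pos
  simp only [expectation, PMF.uniformOfFintype_apply]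
  rw [tsum_fintype, ← Finset.mul_sum, ← ENNReal.ofReal_sum_of_nonneg fun a _ => hf a, avg,
    smul_eq_mul, ENNReal.ofReal_mul (by positivity), one_div, ENNReal.ofReal_inv_of_pos hc,
    ENNReal.ofReal_natCast]

end Expectation

variable [NeZero n]

theorem expectation_ascdro (hℓ : ConvexProblem P W ℓ) {T : ℕ} [NeZero T] {S : State d × ℕ}
    (hx : S.1.x ∈ domain P W) {u : State d → ℝ} (hu : ∀ S : State d, S.x ∈ domain P W → 0 ≤ u S) :
    expectation (ascdro P W ℓ μ η β T S) (fun o => ENNReal.ofReal (u o.1))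
      = ENNReal.ofReal (cumulative (step P W ℓ μ η β) u T S.1 / T) := by
  have h0 : ∀ (ξ : Fin T → Fin n) (τ : Fin T),
      0 ≤ u (trajectory P W ℓ μ η β S.1 ξ τ.castSucc) := fun ξ τ => hu _ (trajectory_mem hℓ hx ξ _)
  rw [ascdro, expectation_bind]
  simp only [expectation_map]
  simp only [expectation_uniform (h0 _)]
  rw [expectation_uniform fun ξ => avg_nonneg (h0 ξ), ← avg_sum_trajectory]
  congr 1
  rw [div_eq_inv_mul, ← smul_eq_mul (T : ℝ)⁻¹, ← avg_smul]
  congr 1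
  funext ξ
  rw [avg_fin, one_div]

theorem mem_support_ascdro (hℓ : ConvexProblem P W ℓ) {T : ℕ} [NeZero T] {S o : State d × ℕ}
    (hx : S.1.x ∈ domain P W) (ho : o ∈ (ascdro P W ℓ μ η β T S).support) :
    o.1.x ∈ domain P W ∧ o.2 = S.2 + T := by
  rw [ascdro, PMF.mem_support_bind_iff] at ho
  obtain ⟨ξ, -, ho⟩ := ho
  rw [PMF.mem_support_map_iff] at ho
  obtain ⟨τ, -, rfl⟩ := ho
  exact ⟨trajectory_mem hℓ hx ξ _, rfl⟩

/-! ### The restarted method -/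

theorem mem_support_stages (hℓ : ConvexProblem P W ℓ) {Δ : ℝ} {x₁ : Point d}
    (hx : x₁ ∈ domain P W) (m : ℕ) : ∀ o ∈ (stages P W ℓ μ Δ x₁ m).support, o.1.x ∈ domain P W ∧
      o.2 = batchSize P μ (stageEps Δ 1)
        + ∑ k ∈ Finset.range m, stageLength P μ (stageEps Δ (k + 1)) := by
  induction m with
  | zero =>
    intro o ho
    rw [stages, PMF.mem_support_map_iff] at ho
    obtain ⟨I, -, rfl⟩ := ho
    exact ⟨hx, by simp⟩
  | succ m ih =>
    intro o ho
    rw [stages, PMF.mem_support_bind_iff] at ho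
    obtain ⟨S, hS, ho⟩ := ho
    obtain ⟨h1, h2⟩ := ih S hS
    obtain ⟨h3, h4⟩ := mem_support_ascdro hℓ h1 ho
    refine ⟨h3, ?_⟩
    rw [h4, h2, Finset.sum_range_succ, add_assoc]

theorem mem_support_rascdro (hℓ : ConvexProblem P W ℓ) {Δ : ℝ} {x₁ : Point d}
    (hx : x₁ ∈ domain P W) (m : ℕ) {o : Point d × ℕ}
    (ho : o ∈ (rascdro P W ℓ μ Δ x₁ (m + 1)).support) : o.1 ∈ domain P W ∧
      o.2 = batchSize P μ (stageEps Δ 1)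
        + ∑ k ∈ Finset.range (m + 1), stageLength P μ (stageEps Δ (k + 1)) := by
  rw [rascdro, PMF.mem_support_bind_iff] at ho
  obtain ⟨S, hS, ho⟩ := ho
  rw [PMF.mem_support_map_iff] at ho
  obtain ⟨S', hS', rfl⟩ := ho
  obtain ⟨h1, h2⟩ := mem_support_stages hℓ hx _ S hS
  obtain ⟨h3, h4⟩ := mem_support_ascdro hℓ h1 hS'
  refine ⟨h1, ?_⟩
  rw [h4, h2, Finset.sum_range_succ, add_assoc]
  rfl

/-- The last stage adds to the sample count but does not affect the output, which is the iterate at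
its start. -/
theorem expectation_rascdro (Δ : ℝ) (x₁ : Point d) (m : ℕ) (f : Point d → ENNReal) :
    expectation (rascdro P W ℓ μ Δ x₁ (m + 1)) (fun o => f o.1)
      = expectation (stages P W ℓ μ Δ x₁ m) fun S => f S.1.x := by
  rw [rascdro, expectation_bind]
  simp only [expectation_map, expectation_const]
  rfl

end DRO

namespace DRO

/-! ### Moments of the minibatch average -/

section Minibatch

variable {ι E : Type*} [Fintype ι] [Nonempty ι] [NormedAddCommGroup E] [InnerProductSpace ℝ E]

theorem avg_norm_add_sum_sq {c : ι → E} (hc : avg c = 0) (b : ℕ) (e : E) :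
    avg (fun I : Fin b → ι => ‖e + ∑ j, c (I j)‖ ^ 2)
      = ‖e‖ ^ 2 + b * avg fun i => ‖c i‖ ^ 2 := by
  induction b generalizing e with
  | zero => simp [avg]
  | succ b ih =>
    rw [avg_cons]
    simp only [Fin.sum_univ_succ, Fin.cons_zero, Fin.cons_succ, ← add_assoc, ih]
    rw [avg_add, avg_const, avg_norm_add_sq e hc]
    push_cast
    ring

theorem avg_norm_add_pow_four_le {c : ι → E} {B : ℝ} (hc : avg c = 0) (hB : ∀ i, ‖c i‖ ≤ B)
    (e : E) : avg (fun i => ‖e + c i‖ ^ 4) ≤ ‖e‖ ^ 4 + 8 * B ^ 2 * ‖e‖ ^ 2 + 3 * B ^ 4 := by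
  have h : ∀ i, ‖e + c i‖ ^ 4
      -- The linear term in c is kept exact because it averages to zero; all other terms are bounded
      -- pointwise.
      ≤ (‖e‖ ^ 4 + 8 * B ^ 2 * ‖e‖ ^ 2 + 3 * B ^ 4) + 4 * ‖e‖ ^ 2 * inner ℝ e (c i) := by
    intro i
    have h1 : ‖c i‖ ^ 2 ≤ B ^ 2 := pow_le_pow_left₀ (norm_nonneg _) (hB i) 2
    have h2 := abs_real_inner_le_norm e (c i)
    have h3 : inner ℝ e (c i) ^ 2 ≤ ‖e‖ ^ 2 * ‖c i‖ ^ 2 := by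
      rw [← sq_abs, ← mul_pow]
      exact pow_le_pow_left₀ (abs_nonneg _) h2 2
    have h4 : 2 * inner ℝ e (c i) ≤ ‖e‖ ^ 2 + ‖c i‖ ^ 2 := by
      linarith [le_abs_self (inner ℝ e (c i)), two_mul_le_add_sq ‖e‖ ‖c i‖]
    have e1 : ‖e + c i‖ ^ 4 = (‖e + c i‖ ^ 2) ^ 2 := by ring
    have e2 : ‖e‖ ^ 4 = (‖e‖ ^ 2) ^ 2 := by ring
    have e3 : B ^ 4 = (B ^ 2) ^ 2 := by ring
    rw [e1, norm_add_sq_real, e2, e3]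
    set A := ‖e‖ ^ 2
    set w := ‖c i‖ ^ 2
    set t := inner ℝ e (c i)
    have hA : 0 ≤ A := sq_nonneg _
    have hw : 0 ≤ w := sq_nonneg _
    have p1 : 2 * t * w ≤ (A + w) * w := by gcongr
    have p2 : A * w ≤ A * B ^ 2 := by gcongr
    have p3 : w ^ 2 ≤ (B ^ 2) ^ 2 := by gcongr
    linarith
  refine (avg_mono h).trans ?_
  rw [avg_add, avg_const, avg_const_mul, avg_inner, hc, inner_zero_right, mul_zero, add_zero]

theorem avg_norm_add_sum_pow_four_le {c : ι → E} {B : ℝ} (hc : avg c = 0) (hB : ∀ i, ‖c i‖ ≤ B)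
    (b : ℕ) (e : E) : avg (fun I : Fin b → ι => ‖e + ∑ j, c (I j)‖ ^ 4)
      ≤ ‖e‖ ^ 4 + 8 * b * B ^ 2 * ‖e‖ ^ 2 + 4 * b ^ 2 * B ^ 4 := by
  induction b generalizing e with
  | zero => simp [avg]
  | succ b ih =>
    rw [avg_cons]
    simp only [Fin.sum_univ_succ, Fin.cons_zero, Fin.cons_succ, ← add_assoc]
    refine (avg_mono fun i => ih _).trans ?_
    rw [avg_add, avg_const, avg_add, avg_const_mul, avg_norm_add_sq e hc]
    have h1 := avg_norm_add_pow_four_le hc hB e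
    have h2 : avg (fun i => ‖c i‖ ^ 2) ≤ B ^ 2 :=
      avg_le fun i => pow_le_pow_left₀ (norm_nonneg _) (hB i) 2
    have h3 : 8 * b * B ^ 2 * avg (fun i => ‖c i‖ ^ 2) ≤ 8 * b * B ^ 2 * B ^ 2 := by gcongr
    have h4 : 0 ≤ B ^ 4 := by positivity
    push_cast
    linarith

end Minibatch

variable {d n : ℕ} {P : Constants} {W : Set (EuclideanSpace ℝ (Fin d))}
  {ℓ : Fin n → EuclideanSpace ℝ (Fin d) → ℝ} [NeZero n]

section Init

omit [NeZero n] in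
theorem err_initState {b : ℕ} (hb : b ≠ 0) (x₁ : Point d) (I : Fin b → Fin n) :
    (initState ℓ x₁ I).err P ℓ
      = (1 / b : ℝ) • (0 + ∑ j, (sample P ℓ x₁ (I j) - avg (sample P ℓ x₁))) := by
  have hb' : (b : ℝ) ≠ 0 := Nat.cast_ne_zero.2 hb
  have h1 : (initState ℓ x₁ I).tracker P = (1 / b : ℝ) • ∑ j, sample P ℓ x₁ (I j) := by
    simp only [sample]
    rw [sum_weighted, smul_weighted]
    show weighted P _ _ = _
    congr 1
    refine WithLp.ofLp_injective 2 (Prod.ext ?_ ?_)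
    · show (1 / b : ℝ) • ∑ j, (gradient (gi ℓ (I j)) x₁).fst
        = (1 / b : ℝ) • (∑ j, gradient (gi ℓ (I j)) x₁).fst
      congr 1
      exact (map_sum (WithLp.fstL 2 ℝ (EuclideanSpace ℝ (Fin d)) ℝ) _ _).symm
    · show (1 / b : ℝ) * ∑ j, (gradient (gi ℓ (I j)) x₁).snd
        = (1 / b : ℝ) * (∑ j, gradient (gi ℓ (I j)) x₁).snd
      congr 1
      exact (map_sum (WithLp.sndL 2 ℝ (EuclideanSpace ℝ (Fin d)) ℝ) _ _).symm
  rw [State.err, h1, Finset.sum_sub_distrib, Finset.sum_const, Finset.card_univ, Fintype.card_fin,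
    zero_add, smul_sub, ← Nat.cast_smul_eq_nsmul ℝ, smul_smul, one_div_mul_cancel hb', one_smul]
  rfl

variable (hP : P.Admissible) (hℓ : ConvexProblem P W ℓ) {x₁ : Point d} (hx : x₁ ∈ domain P W)
  {b : ℕ} (hb : b ≠ 0)
include hP hℓ hx hb

theorem avg_norm_err_initState_sq_le :
    avg (fun I : Fin b → Fin n => ‖(initState ℓ x₁ I).err P ℓ‖ ^ 2)
      ≤ 2 * P.σ ^ 2 * P.LF ^ 2 / b := by
  have hb' : (0 : ℝ) < b := Nat.cast_pos.2 (Nat.pos_of_ne_zero hb)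
  have h0 : avg (fun i => sample P ℓ x₁ i - avg (sample P ℓ x₁)) = 0 := by
    rw [avg_sub, avg_const, sub_self]
  have h1 := hℓ.avg_norm_sample_sub_sq_le hP hx
  simp only [err_initState hb, norm_smul, mul_pow]
  rw [avg_const_mul, avg_norm_add_sum_sq h0, norm_zero, Real.norm_of_nonneg (by positivity)]
  calc _ = avg (fun i => ‖sample P ℓ x₁ i - avg (sample P ℓ x₁)‖ ^ 2) / b := by
        field_simp; ring
    _ ≤ _ := by gcongr

/-- Two of the six powers are bounded deterministically, the others by the fourth moment. The
resulting O(1/b²) suffices, since 1/b = O(με_1). -/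
theorem avg_norm_err_initState_pow_six_le :
    avg (fun I : Fin b → Fin n => ‖(initState ℓ x₁ I).err P ℓ‖ ^ 6)
      ≤ 4 * (2 * P.sampleBound) ^ 6 / b ^ 2 := by
  have hb' : (0 : ℝ) < b := Nat.cast_pos.2 (Nat.pos_of_ne_zero hb)
  have hS := hP.sampleBound_nonneg
  have h0 : avg (fun i => sample P ℓ x₁ i - avg (sample P ℓ x₁)) = 0 := by
    rw [avg_sub, avg_const, sub_self]
  have h1 : ∀ i, ‖sample P ℓ x₁ i - avg (sample P ℓ x₁)‖ ≤ 2 * P.sampleBound := by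
    intro i
    have h := hℓ.norm_sample_le hP hx
    have := norm_sub_le (sample P ℓ x₁ i) (avg (sample P ℓ x₁))
    have := h i
    have := norm_avg_le h
    unfold Constants.sampleBound
    linarith
  have h2 : ∀ I : Fin b → Fin n, ‖(initState ℓ x₁ I).err P ℓ‖ ≤ 2 * P.sampleBound := by
    intro I
    rw [err_initState hb, zero_add, norm_smul, Real.norm_of_nonneg (by positivity), one_div,
      inv_mul_le_iff₀ hb']
    refine (norm_sum_le_of_le _ fun j _ => h1 (I j)).trans (le_of_eq ?_)
    rw [Finset.sum_const, Finset.card_univ, Fintype.card_fin, nsmul_eq_mul]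
  have h3 : ∀ I : Fin b → Fin n, ‖(initState ℓ x₁ I).err P ℓ‖ ^ 6
      ≤ (2 * P.sampleBound) ^ 2 * ‖(initState ℓ x₁ I).err P ℓ‖ ^ 4 := by
    intro I
    have h4 := pow_le_pow_left₀ (norm_nonneg _) (h2 I) 2
    calc _ = ‖(initState ℓ x₁ I).err P ℓ‖ ^ 2 * ‖(initState ℓ x₁ I).err P ℓ‖ ^ 4 := by ring
      _ ≤ _ := by gcongr
  refine (avg_mono h3).trans ?_
  rw [avg_const_mul]
  have h5 := avg_norm_add_sum_pow_four_le h0 h1 b 0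
  have h6 : avg (fun I : Fin b → Fin n => ‖(initState ℓ x₁ I).err P ℓ‖ ^ 4)
      ≤ (1 / b) ^ 4 * (4 * b ^ 2 * (2 * P.sampleBound) ^ 4) := by
    simp only [err_initState hb, norm_smul, mul_pow]
    rw [avg_const_mul, Real.norm_of_nonneg (by positivity)]
    gcongr
    refine h5.trans (le_of_eq ?_)
    rw [norm_zero]
    ring
  calc _ ≤ (2 * P.sampleBound) ^ 2 * ((1 / b) ^ 4 * (4 * b ^ 2 * (2 * P.sampleBound) ^ 4)) := by
        gcongr
    _ = _ := by field_simp

theorem avg_merit_initState_le {μ : ℝ} (hμ : 0 < μ) (xs : Point d) :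
    avg (fun I : Fin b → Fin n => merit P ℓ μ xs (initState ℓ x₁ I))
      ≤ gap P ℓ μ xs x₁ + 16 / μ * (2 * P.σ ^ 2 * P.LF ^ 2 / b) := by
  have h := avg_norm_err_initState_sq_le hP hℓ hx hb
  unfold merit
  rw [avg_add, avg_const_mul]
  have e : avg (fun I : Fin b → Fin n => gap P ℓ μ xs (initState ℓ x₁ I).x) = gap P ℓ μ xs x₁ :=
    avg_const (gap P ℓ μ xs x₁)
  rw [e]
  gcongr

theorem avg_lyapunov_initState_le {μ η : ℝ} (hμ : 0 ≤ μ) (hμ1 : μ ≤ 1) (hη : 0 ≤ η)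
    {xs : Point d} (hxs : IsMinimizer P W ℓ μ xs) :
    avg (fun I : Fin b → Fin n => lyapunov P ℓ μ η xs (initState ℓ x₁ I))
      ≤ 256 * (4 * (2 * P.sampleBound) ^ 6 / b ^ 2
        + (60 * P.LF ^ 2 * (P.gapBound + 1)) ^ 3 * η ^ 3) := by
  have hf := hxs.gap_nonneg hx
  have hfM := gap_le hP hℓ hxs hμ hμ1 hx
  have h1 : ∀ I : Fin b → Fin n, lyapunov P ℓ μ η xs (initState ℓ x₁ I)
      ≤ 256 * (‖(initState ℓ x₁ I).err P ℓ‖ ^ 6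
        + (60 * P.LF ^ 2 * (P.gapBound + 1)) ^ 3 * η ^ 3) := by
    intro I
    unfold lyapunov
    change 64 * (‖(initState ℓ x₁ I).err P ℓ‖ ^ 2
      + 60 * P.LF ^ 2 * η * (gap P ℓ μ xs x₁ + 1)) ^ 3 ≤ _
    set E2 := ‖(initState ℓ x₁ I).err P ℓ‖ ^ 2 with hE2
    have e1 : ‖(initState ℓ x₁ I).err P ℓ‖ ^ 6 = E2 ^ 3 := by rw [hE2]; ring
    have hE : 0 ≤ E2 := sq_nonneg _
    set y := 60 * P.LF ^ 2 * η * (gap P ℓ μ xs x₁ + 1) with hy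
    have hy0 : 0 ≤ y := by positivity
    have hy1 : y ≤ 60 * P.LF ^ 2 * (P.gapBound + 1) * η := by
      rw [hy, mul_right_comm]
      gcongr
    have h2 : (E2 + y) ^ 3 ≤ 4 * (E2 ^ 3 + y ^ 3) := by
      nlinarith [mul_nonneg (add_nonneg hE hy0) (sq_nonneg (E2 - y))]
    have h3 := pow_le_pow_left₀ hy0 hy1 3
    rw [mul_pow _ η] at h3
    rw [e1]
    linarith
  refine (avg_mono h1).trans ?_
  rw [avg_const_mul, avg_add, avg_const]
  have := avg_norm_err_initState_pow_six_le hP hℓ hx hb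
  gcongr

end Init

/-! ### One stage -/

/-- A stage preserves the form of the bound θ · merit + a + M · lyapunov for a cost: θ shrinks to
θ/3 and a grows by the noise floor and the failure growth. This stability drives the induction over
stages. -/
theorem cumulative_stage_le (hP : P.Admissible) (hℓ : ConvexProblem P W ℓ) {μ η β : ℝ}
    (h : SmallStep P μ η β) {xs : Point d} (hxs : IsMinimizer P W ℓ μ xs) {T : ℕ}
    (hT1 : 192 ≤ (T : ℝ)) (hT2 : 8 ≤ μ * η * T) (hT3 : 192 ≤ β * T) {u : State d → ℝ}
    {θ a M : ℝ} (hθ : 0 ≤ θ) (ha : 0 ≤ a) (hM : 0 ≤ M)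
    (hu0 : ∀ S : State d, S.x ∈ domain P W → 0 ≤ u S)
    (huM : ∀ S : State d, S.x ∈ domain P W → u S ≤ M)
    (hu : ∀ S : State d, S.x ∈ domain P W →
      u S ≤ θ * merit P ℓ μ xs S + a + M * lyapunov P ℓ μ η xs S)
    {S : State d} (hx : S.x ∈ domain P W) :
    cumulative (step P W ℓ μ η β) u T S / T
      ≤ θ / 3 * merit P ℓ μ xs S + (a + θ * (132 * β * P.σ ^ 2 * P.LF ^ 2 / μ)
        + M * (T * (P.growth * η ^ 6))) + M * lyapunov P ℓ μ η xs S := by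
  have hη := h.η_pos
  have hμ := h.μ_pos
  have hβ := h.β_pos hP
  have hgr := hP.growth_nonneg
  have hT : (0 : ℝ) < T := by linarith
  have key := cumulative_le (stp := step P W ℓ μ η β) (D := {S | S.x ∈ domain P W})
    (good := {S | ‖S.err P ℓ‖ ≤ 1 / 2}) (u := u) (q := fun S => θ * merit P ℓ μ xs S)
    (V := fun S => θ * potential P ℓ μ η β xs S) (Lyap := lyapunov P ℓ μ η xs)
    (h := a) (κ := θ * (132 * β * P.σ ^ 2 * P.LF ^ 2 / μ)) (ν := P.growth * η ^ 6) hM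
    (by positivity) (by positivity) (fun S hS i => next_mem hℓ hS μ η) hu0 huM hu
    (fun S hS => mul_nonneg hθ (potential_nonneg hxs hS hμ.le hη.le hβ.le))
    (fun S hS => lyapunov_nonneg hxs hS hη.le)
    (fun S hS hb => one_le_lyapunov hxs hS hη.le (not_le.1 hb))
    (fun S hS hg => by
      have := mul_le_mul_of_nonneg_left (avg_potential_step_le hP hℓ hxs hS h hg) hθ
      rw [avg_const_mul]
      linarith)
    (fun S hS hg => avg_lyapunov_step_le hP hℓ hxs hS h hg) T S hx
  have h2 := mul_le_mul_of_nonneg_left (potential_le hP hℓ hxs hx h hT1 hT2 hT3) hθ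
  rw [div_le_iff₀ hT]
  linarith

end DRO

namespace DRO

variable {P : Constants}

/-! ### The parameters of the stages -/

namespace Constants

variable (P)

/-- The ratio of `√(μ ε_k)` to `η_k`. -/
def etaScale : ℝ := 24 * P.c * P.LF * P.σ

variable {P}

theorem Admissible.c_ge (hP : P.Admissible) : 768 ≤ P.c := by
  have := one_le_pow₀ hP.one_le_LF (n := 2)
  unfold c
  linarith

theorem Admissible.etaScale_pos (hP : P.Admissible) : 0 < P.etaScale := by
  have := hP.c_ge
  have := hP.one_le_LF
  have := hP.σ_pos
  unfold etaScale
  positivity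

theorem Admissible.stepScale_nonneg (hP : P.Admissible) : 0 ≤ P.stepScale := by
  have := hP.one_le_LF
  have := hP.changeBound_nonneg
  have := hP.moveBound_nonneg
  have := hP.ratio_pos
  have := P.varBound_nonneg
  unfold stepScale
  positivity

end Constants

section Parameters

variable (hP : P.Admissible) {μ e q : ℝ}
include hP

/-- For small με_k the first entry of the minimum is active, so the step size is proportional to
√(με_k). -/
theorem stageEta_eq (hq : Real.sqrt (μ * e) * P.LF ≤ P.σ) :
    stageEta P μ e = Real.sqrt (μ * e) / P.etaScale := by
  have h1 := hP.c_ge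
  have h2 := hP.one_le_LF
  have h3 := hP.σ_pos
  rw [stageEta, Constants.etaScale, min_eq_left]
  rw [div_le_div_iff₀ (by positivity) (by positivity)]
  have : 24 * P.c * P.LF * (Real.sqrt (μ * e) * P.LF) ≤ 24 * P.c * P.LF * P.σ := by gcongr
  linarith

theorem stageBeta_eq (hμe : 0 ≤ μ * e) (hq : Real.sqrt (μ * e) * P.LF ≤ P.σ) :
    stageBeta P μ e = μ * e / (P.c * P.σ ^ 2) := by
  have h1 := hP.c_ge
  have h2 := hP.one_le_LF
  have h3 := hP.σ_pos
  have h0 := Real.sqrt_nonneg (μ * e)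
  rw [stageBeta, min_eq_left]
  rw [div_le_div_iff₀ (by positivity) (by positivity)]
  have h4 : Real.sqrt (μ * e) ≤ P.σ := by nlinarith
  have h5 : μ * e ≤ P.σ ^ 2 := by
    rw [← Real.sq_sqrt hμe]
    gcongr
  have : P.c * (μ * e) ≤ P.c * P.σ ^ 2 := by gcongr
  linarith

theorem smallStep_stage (hμ : 0 < μ) (hμ1 : μ ≤ 1) (he : 0 < e)
    (hq : Real.sqrt (μ * e) * P.LF ≤ P.σ)
    (hq' : P.stepScale * Real.sqrt (μ * e) ≤ P.etaScale) :
    SmallStep P μ (stageEta P μ e) (stageBeta P μ e) := by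
  have h0 := hP.etaScale_pos
  have hq0 : 0 < Real.sqrt (μ * e) := Real.sqrt_pos.2 (by positivity)
  have h1 := hP.c_ge
  have h2 := hP.one_le_LF
  have h3 := hP.σ_pos
  rw [stageEta_eq hP hq, stageBeta_eq hP (by positivity) hq]
  refine ⟨hμ, hμ1, by positivity, ?_, ?_⟩
  -- β/η² = (24cΛσ)²/(cσ²) = 576cΛ² = 442368Λ⁴ with Λ = `LF`, the same in all stages.
  · rw [div_pow, Real.sq_sqrt (by positivity), Constants.etaScale, Constants.ratio, Constants.c]
    field_simp
    norm_num
  · rw [mul_div_assoc', div_le_one h0]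
    exact hq'

omit hP in
theorem rpow_three_halves_mul_sqrt (hμ : 0 < μ) :
    μ ^ (3 / 2 : ℝ) * Real.sqrt e = μ * Real.sqrt (μ * e) := by
  rw [Real.sqrt_mul hμ.le, show (3 / 2 : ℝ) = 1 + 1 / 2 by norm_num, Real.rpow_add hμ,
    Real.rpow_one, ← Real.sqrt_eq_rpow, mul_assoc]

theorem le_stageLength (hμ : 0 < μ) (hμ1 : μ ≤ 1) (he : 0 < e)
    (hq : Real.sqrt (μ * e) * P.LF ≤ P.σ) :
    192 ≤ (stageLength P μ e : ℝ) ∧ 8 ≤ μ * stageEta P μ e * stageLength P μ e ∧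
      192 ≤ stageBeta P μ e * stageLength P μ e := by
  have h1 := hP.c_ge
  have h2 := hP.one_le_LF
  have h3 := hP.σ_pos
  have h4 := one_le_pow₀ h2 (n := 2)
  have hq0 : 0 < Real.sqrt (μ * e) := Real.sqrt_pos.2 (by positivity)
  have hT : max (max (192 * P.c * P.LF * P.σ / (μ ^ (3 / 2 : ℝ) * Real.sqrt e))
      (192 * P.c * P.LF ^ 2 * P.σ ^ 2 / (μ * e))) (192 * P.c * P.LF ^ 2 / μ)
      ≤ (stageLength P μ e : ℝ) :=
    (Nat.le_ceil _).trans (Nat.cast_le.2 (le_max_right _ _))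
  rw [max_le_iff, max_le_iff, rpow_three_halves_mul_sqrt hμ] at hT
  obtain ⟨⟨t1, t2⟩, t3⟩ := hT
  set T : ℝ := ((stageLength P μ e : ℕ) : ℝ)
  refine ⟨?_, ?_, ?_⟩
  · refine le_trans ?_ t3
    rw [le_div_iff₀ hμ]
    have : 1 * 1 ≤ P.c * P.LF ^ 2 := by gcongr; linarith
    linarith
  · rw [stageEta_eq hP hq, Constants.etaScale]
    calc (8 : ℝ) = μ * (Real.sqrt (μ * e) / (24 * P.c * P.LF * P.σ))
          * (192 * P.c * P.LF * P.σ / (μ * Real.sqrt (μ * e))) := by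
          field_simp
          norm_num
      _ ≤ _ := by gcongr
  · rw [stageBeta_eq hP (by positivity) hq]
    calc (192 : ℝ) ≤ 192 * P.LF ^ 2 := by linarith
      _ = μ * e / (P.c * P.σ ^ 2) * (192 * P.c * P.LF ^ 2 * P.σ ^ 2 / (μ * e)) := by
          field_simp
      _ ≤ _ := by gcongr

/-- With κμ ≤ √(με) the term of order 1/(με) is also O(1/(μ√(με))), so all terms share one order. -/
theorem stageLength_le {κ : ℝ} (hμ : 0 < μ) (he : 0 < e) (hμ1 : μ ≤ 1) (hκ : 0 < κ)
    (hq1 : Real.sqrt (μ * e) ≤ 1) (hq : κ * μ ≤ Real.sqrt (μ * e)) :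
    (stageLength P μ e : ℝ) ≤ (1 + 192 * P.c * P.LF * P.σ + 192 * P.c * P.LF ^ 2 * P.σ ^ 2 / κ
      + 192 * P.c * P.LF ^ 2) / (μ * Real.sqrt (μ * e)) := by
  have h1 := hP.c_ge
  have h2 := hP.one_le_LF
  have h3 := hP.σ_pos
  have hq0 : 0 < Real.sqrt (μ * e) := Real.sqrt_pos.2 (by positivity)
  set q := Real.sqrt (μ * e) with hqdef
  have hqe : μ * e = q * q := (Real.mul_self_sqrt (by positivity)).symm
  set a := 192 * P.c * P.LF * P.σ
  set b := 192 * P.c * P.LF ^ 2 * P.σ ^ 2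
  set c := 192 * P.c * P.LF ^ 2
  have ha : 0 ≤ a := by positivity
  have hb : 0 ≤ b := by positivity
  have hc : 0 ≤ c := by positivity
  have hT : (stageLength P μ e : ℝ)
      ≤ max (max (a / (μ ^ (3 / 2 : ℝ) * Real.sqrt e)) (b / (μ * e))) (c / μ) + 1 := by
    rw [stageLength]
    push_cast
    refine max_le (le_add_of_nonneg_left (le_max_of_le_right (by positivity))) ?_
    exact (Nat.ceil_lt_add_one (le_max_of_le_right (by positivity))).le
  refine hT.trans ?_
  rw [rpow_three_halves_mul_sqrt hμ, ← hqdef]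
  have e1 : max (max (a / (μ * q)) (b / (μ * e))) (c / μ) ≤ a / (μ * q) + b / (μ * e) + c / μ := by
    have p1 : 0 ≤ a / (μ * q) := by positivity
    have p2 : 0 ≤ b / (μ * e) := by positivity
    have p3 : 0 ≤ c / μ := by positivity
    exact max_le (max_le (by linarith) (by linarith)) (by linarith)
  have e2 : b / (μ * e) ≤ b / κ / (μ * q) := by
    rw [hqe, div_div, ← mul_assoc]
    gcongr
  have e3 : c / μ ≤ c / (μ * q) := by
    gcongr
    exact mul_le_of_le_one_right hμ.le hq1
  have e4 : 1 ≤ 1 / (μ * q) := by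
    rw [le_div_iff₀ (by positivity), one_mul]
    exact mul_le_one₀ hμ1 hq0.le hq1
  rw [add_div, add_div, add_div]
  linarith

theorem batchSize_le {κ : ℝ} (hμ : 0 < μ) (he : 0 < e) (hμ1 : μ ≤ 1) (hκ : 0 < κ)
    (hq1 : Real.sqrt (μ * e) ≤ 1) (hq : κ * μ ≤ Real.sqrt (μ * e)) :
    (batchSize P μ e : ℝ) ≤ (1 + 48 * P.LF ^ 2 * P.σ ^ 2 / κ) / (μ * Real.sqrt (μ * e)) := by
  have h2 := hP.one_le_LF
  have h3 := hP.σ_pos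
  have hq0 : 0 < Real.sqrt (μ * e) := Real.sqrt_pos.2 (by positivity)
  set q := Real.sqrt (μ * e) with hqdef
  have hqe : μ * e = q * q := (Real.mul_self_sqrt (by positivity)).symm
  have hT : (batchSize P μ e : ℝ) ≤ 48 * P.LF ^ 2 * P.σ ^ 2 / (μ * e) + 1 := by
    rw [batchSize]
    push_cast
    refine max_le (le_add_of_nonneg_left (by positivity)) ?_
    exact (Nat.ceil_lt_add_one (by positivity)).le
  refine hT.trans ?_
  have e2 : 48 * P.LF ^ 2 * P.σ ^ 2 / (μ * e) ≤ 48 * P.LF ^ 2 * P.σ ^ 2 / κ / (μ * q) := by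
    rw [hqe, div_div, ← mul_assoc]
    gcongr
  have e4 : 1 ≤ 1 / (μ * q) := by
    rw [le_div_iff₀ (by positivity), one_mul]
    exact mul_le_one₀ hμ1 hq0.le hq1
  rw [add_div]
  linarith

omit hP in
theorem le_batchSize : 48 * P.LF ^ 2 * P.σ ^ 2 / (μ * e) ≤ batchSize P μ e :=
  (Nat.le_ceil _).trans (Nat.cast_le.2 (le_max_right _ _))

end Parameters

theorem batchSize_ne_zero (μ e : ℝ) : batchSize P μ e ≠ 0 :=
  Nat.one_le_iff_ne_zero.1 (le_max_left _ _)

theorem stageEps_succ (Δ : ℝ) (m : ℕ) : stageEps Δ (m + 1) = Δ / 2 ^ m := by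
  rw [stageEps, Nat.add_sub_cancel]

theorem stageEps_succ_succ (Δ : ℝ) (m : ℕ) : stageEps Δ (m + 2) = stageEps Δ (m + 1) / 2 := by
  rw [stageEps_succ, stageEps_succ, pow_succ, div_div]

/-- The reciprocals of the square roots of the stagewise accuracies grow geometrically. -/
theorem sum_inv_sqrt_stageEps_le {μ Δ : ℝ} (hμ : 0 < μ) (hΔ : 0 < Δ) (m : ℕ) :
    ∑ k ∈ Finset.range (m + 1), 1 / Real.sqrt (μ * stageEps Δ (k + 1))
      ≤ 4 / Real.sqrt (μ * stageEps Δ (m + 1)) := by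
  have hpos : ∀ m, 0 < stageEps Δ (m + 1) := fun m => by rw [stageEps_succ]; positivity
  induction m with
  | zero =>
    rw [zero_add, Finset.sum_range_one]
    gcongr
    norm_num
  | succ m ih =>
    rw [Finset.sum_range_succ]
    have h1 := Real.sqrt_pos.2 (mul_pos hμ (hpos m))
    have h2 := Real.sqrt_pos.2 (mul_pos hμ (hpos (m + 1)))
    -- Consecutive roots have ratio √2 ≥ 4/3, so the constant 4 reproduces itself as 3 + 1.
    have h3 : 4 * Real.sqrt (μ * stageEps Δ (m + 1 + 1))
        ≤ 3 * Real.sqrt (μ * stageEps Δ (m + 1)) := by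
      refine le_of_sq_le_sq ?_ (by positivity)
      rw [mul_pow, mul_pow, Real.sq_sqrt (mul_pos hμ (hpos _)).le,
        Real.sq_sqrt (mul_pos hμ (hpos _)).le, stageEps_succ_succ]
      have := mul_pos hμ (hpos m)
      linarith
    have h4 : 4 / Real.sqrt (μ * stageEps Δ (m + 1))
        ≤ 3 / Real.sqrt (μ * stageEps Δ (m + 1 + 1)) := by
      rw [div_le_div_iff₀ h1 h2]
      exact h3
    calc _ ≤ 3 / Real.sqrt (μ * stageEps Δ (m + 1 + 1))
          + 1 / Real.sqrt (μ * stageEps Δ (m + 1 + 1)) := by linarith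
      _ = _ := by rw [← add_div]; norm_num

theorem sum_stageEps_le {Δ : ℝ} (hΔ : 0 ≤ Δ) (m : ℕ) :
    ∑ k ∈ Finset.range m, stageEps Δ (k + 1) ≤ 2 * Δ := by
  have h : ∑ k ∈ Finset.range m, stageEps Δ (k + 1) = 2 * Δ - 2 * (Δ / 2 ^ m) := by
    induction m with
    | zero => simp
    | succ m ih =>
      rw [Finset.sum_range_succ, ih, stageEps_succ, pow_succ]
      field_simp
      ring
  have : 0 ≤ Δ / 2 ^ m := by positivity
  linarith

end DRO

namespace DRO

/-! ### Integrals with respect to a probability mass function -/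

section Integral

variable {α : Type*} [MeasurableSpace α] [MeasurableSingletonClass α] {p : PMF α} {f : α → ℝ}

theorem ae_mem_support (p : PMF α) : ∀ᵐ a ∂p.toMeasure, a ∈ p.support := by
  rw [ae_iff]
  have h : MeasurableSet {a | ¬a ∈ p.support} := p.support_countable.measurableSet.compl
  rw [p.toMeasure_apply_eq_zero_iff h]
  exact disjoint_compl_right

/-- Measurability of f is not required: the support is countable, hence f restricted to it and
extended by zero is measurable and equals f almost everywhere. -/
theorem integrable_of_bounded_on_support {M : ℝ} (h : ∀ a ∈ p.support, ‖f a‖ ≤ M) :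
    Integrable f p.toMeasure := by
  have hm : Measurable (p.support.indicator f) := by
    intro s hs
    have h0 : (p.support.indicator f) ⁻¹' s \ p.support = (fun _ => (0 : ℝ)) ⁻¹' s \ p.support := by
      ext a
      by_cases ha : a ∈ p.support <;> simp [ha]
    rw [← Set.inter_union_sdiff ((p.support.indicator f) ⁻¹' s) p.support, h0]
    exact (p.support_countable.mono Set.inter_subset_right).measurableSet.union
      ((measurable_const hs).diff p.support_countable.measurableSet)
  have hae : p.support.indicator f =ᵐ[p.toMeasure] f := by
    filter_upwards [ae_mem_support p] with a ha
    exact Set.indicator_of_mem ha f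
  refine Integrable.of_bound (hm.aestronglyMeasurable.congr hae) M ?_
  filter_upwards [ae_mem_support p] with a ha using h a ha

theorem integral_le_of_expectation_le {c : ℝ} (hc : 0 ≤ c) (hf : Integrable f p.toMeasure)
    (h0 : ∀ a ∈ p.support, 0 ≤ f a)
    (h : expectation p (fun a => ENNReal.ofReal (f a)) ≤ ENNReal.ofReal c) :
    ∫ a, f a ∂p.toMeasure ≤ c := by
  rw [PMF.integral_eq_tsum p f hf]
  have e : ∀ a, (p a).toReal • f a = (p a * ENNReal.ofReal (f a)).toReal := by
    intro a
    rw [ENNReal.toReal_mul, smul_eq_mul]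
    by_cases ha : a ∈ p.support
    · rw [ENNReal.toReal_ofReal (h0 a ha)]
    · rw [PMF.mem_support_iff, not_not] at ha
      simp [ha]
  simp only [e]
  rw [← ENNReal.tsum_toReal_eq fun a => ENNReal.mul_ne_top (p.apply_ne_top a) ENNReal.ofReal_ne_top]
  exact ENNReal.toReal_le_of_le_ofReal hc h

end Integral

variable {d n : ℕ} {P : Constants} {W : Set (EuclideanSpace ℝ (Fin d))}
  {ℓ : Fin n → EuclideanSpace ℝ (Fin d) → ℝ} [NeZero n]

/-! ### All stages -/

/-- A bound for the mean of the Lyapunov function of the initial state. -/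
def initBound (P : Constants) (μ Δ : ℝ) : ℝ :=
  256 * (4 * (2 * P.sampleBound) ^ 6 / (batchSize P μ (stageEps Δ 1) : ℝ) ^ 2
    + (60 * P.LF ^ 2 * (P.gapBound + 1)) ^ 3 * stageEta P μ (stageEps Δ 1) ^ 3)

/-- A bound for the growth of the Lyapunov function in stage `k`. -/
def stageGrowth (P : Constants) (μ Δ : ℝ) (k : ℕ) : ℝ :=
  stageLength P μ (stageEps Δ k) * (P.growth * stageEta P μ (stageEps Δ k) ^ 6)

theorem stageEps_pos {Δ : ℝ} (hΔ : 0 < Δ) (m : ℕ) : 0 < stageEps Δ (m + 1) := by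
  rw [stageEps_succ]
  positivity

theorem stageEps_le {Δ : ℝ} (hΔ : 0 < Δ) (m : ℕ) : stageEps Δ (m + 1) ≤ Δ := by
  rw [stageEps_succ]
  exact div_le_self hΔ.le (one_le_pow₀ (by norm_num))

/-- The cost u is kept general so that the last stage can be integrated out: its mean cost `u'` is
again admissible, with θ/3 in place of θ, and the induction hypothesis applies to it. -/
theorem expectation_stages_le (hP : P.Admissible) (hℓ : ConvexProblem P W ℓ) {μ Δ : ℝ}
    (hμ : 0 < μ) (hμ1 : μ ≤ 1) (hΔ : 0 < Δ) {xs x₁ : Point d} (hxs : IsMinimizer P W ℓ μ xs)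
    (hx : x₁ ∈ domain P W) (hgap : gap P ℓ μ xs x₁ ≤ Δ) (hq : Real.sqrt (μ * Δ) * P.LF ≤ P.σ)
    (hq' : P.stepScale * Real.sqrt (μ * Δ) ≤ P.etaScale) (m : ℕ) :
    ∀ {u : State d → ℝ} {θ a : ℝ}, 0 ≤ θ → 0 ≤ a →
      (∀ S : State d, S.x ∈ domain P W → 0 ≤ u S) →
      (∀ S : State d, S.x ∈ domain P W → u S ≤ P.gapBound) →
      (∀ S : State d, S.x ∈ domain P W → u S ≤ θ * merit P ℓ μ xs S + a
        + P.gapBound * lyapunov P ℓ μ (stageEta P μ (stageEps Δ (m + 1))) xs S) →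
      expectation (stages P W ℓ μ Δ x₁ m) (fun o => ENNReal.ofReal (u o.1))
        ≤ ENNReal.ofReal (2 * θ * stageEps Δ (m + 1) + a
          + P.gapBound * (initBound P μ Δ + ∑ k ∈ Finset.range m, stageGrowth P μ Δ (k + 1))) := by
  have hM := hP.gapBound_pos
  have hΛ := hP.one_le_LF
  have hs := hP.σ_pos
  have hsc := hP.stepScale_nonneg
  have hsq : ∀ k, Real.sqrt (μ * stageEps Δ (k + 1)) ≤ Real.sqrt (μ * Δ) := fun k =>
    Real.sqrt_le_sqrt (mul_le_mul_of_nonneg_left (stageEps_le hΔ k) hμ.le)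
  have hqk : ∀ k, Real.sqrt (μ * stageEps Δ (k + 1)) * P.LF ≤ P.σ := fun k =>
    (mul_le_mul_of_nonneg_right (hsq k) (by linarith)).trans hq
  have hqk' : ∀ k, P.stepScale * Real.sqrt (μ * stageEps Δ (k + 1)) ≤ P.etaScale := fun k =>
    (mul_le_mul_of_nonneg_left (hsq k) hsc).trans hq'
  have hsmall := fun k => smallStep_stage hP hμ hμ1 (stageEps_pos hΔ k) (hqk k) (hqk' k)
  induction m with
  | zero =>
    intro u θ a hθ ha hu0 huM hu
    have hb := batchSize_ne_zero (P := P) μ (stageEps Δ 1)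
    rw [stages, expectation_map, expectation_uniform fun I => hu0 _ hx]
    refine ENNReal.ofReal_le_ofReal ?_
    refine (avg_mono fun I => hu (initState ℓ x₁ I) hx).trans ?_
    rw [avg_add, avg_add, avg_const, avg_const_mul, avg_const_mul]
    have h1 := avg_merit_initState_le hP hℓ hx hb hμ xs
    have h2 := avg_lyapunov_initState_le hP hℓ hx hb hμ.le hμ1 (hsmall 0).η_pos.le hxs
    have h3 : stageEps Δ (0 + 1) = Δ := by rw [stageEps_succ, pow_zero, div_one]
    -- The batch size gives 32/48 = 2/3, so the initial merit is at most Δ + 2Δ/3 ≤ 2ε_1.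
    have h4 : 16 / μ * (2 * P.σ ^ 2 * P.LF ^ 2 / batchSize P μ (stageEps Δ 1)) ≤ 2 / 3 * Δ := by
      have h5 := le_batchSize (P := P) (μ := μ) (e := stageEps Δ 1)
      have hb' : (0 : ℝ) < batchSize P μ (stageEps Δ 1) := Nat.cast_pos.2 (Nat.pos_of_ne_zero hb)
      set b : ℝ := ((batchSize P μ (stageEps Δ 1) : ℕ) : ℝ)
      rw [show stageEps Δ 1 = Δ from h3, div_le_iff₀ (by positivity)] at h5
      rw [div_mul_div_comm, div_le_iff₀ (by positivity)]
      linarith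
    rw [Finset.range_zero, Finset.sum_empty, add_zero]
    have h8 : 2 * θ * stageEps Δ (0 + 1) = 2 * θ * Δ := by rw [h3]
    have h6 : θ * avg (fun I : Fin (batchSize P μ (stageEps Δ 1)) → Fin n =>
        merit P ℓ μ xs (initState ℓ x₁ I)) ≤ θ * (2 * Δ) := by
      refine mul_le_mul_of_nonneg_left (h1.trans ?_) hθ
      linarith
    have h7 : P.gapBound * avg (fun I : Fin (batchSize P μ (stageEps Δ 1)) → Fin n =>
        lyapunov P ℓ μ (stageEta P μ (stageEps Δ (0 + 1))) xs (initState ℓ x₁ I)) ≤ P.gapBound * initBound P μ Δ :=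
      mul_le_mul_of_nonneg_left h2 hM.le
    linarith
  | succ m ih =>
    intro u θ a hθ ha hu0 huM hu
    rw [stages, expectation_bind]
    obtain ⟨t1, t2, t3⟩ := le_stageLength hP hμ hμ1 (stageEps_pos hΔ m) (hqk m)
    have hsm := hsmall m
    set e := stageEps Δ (m + 1) with he
    set η := stageEta P μ e with hη
    set β := stageBeta P μ e with hβ
    set T := stageLength P μ e with hT
    have hT0 : (0 : ℝ) < T := by linarith
    set u' : State d → ℝ := fun S => cumulative (step P W ℓ μ η β) u T S / T with hu'
    have hmem := fun S : State d × ℕ => mem_support_stages hℓ (μ := μ) (Δ := Δ) hx m S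
    have hle : expectation (stages P W ℓ μ Δ x₁ m)
          (fun S => expectation (stage P W ℓ μ Δ (m + 1) S) fun o => ENNReal.ofReal (u o.1))
        ≤ expectation (stages P W ℓ μ Δ x₁ m) fun o => ENNReal.ofReal (u' o.1) := by
      refine expectation_mono fun S hS => ?_
      exact (expectation_ascdro hℓ (hmem S hS).1 hu0).le
    -- The factor c = 768Λ² in β_k makes the noise floor a small multiple of ε_k.
    have hβe : 132 * β * P.σ ^ 2 * P.LF ^ 2 / μ = 132 / 768 * e := by
      rw [hβ, stageBeta_eq hP (mul_pos hμ (stageEps_pos hΔ m)).le (hqk m), Constants.c]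
      field_simp
      rw [he]
    have hstep : ∀ S : State d, S.x ∈ domain P W → u' S ≤ θ / 3 * merit P ℓ μ xs S
        + (a + θ * (132 / 768 * e) + P.gapBound * stageGrowth P μ Δ (m + 1))
        + P.gapBound * lyapunov P ℓ μ η xs S := by
      intro S hS
      rw [← hβe]
      refine cumulative_stage_le hP hℓ hsm hxs t1 t2 t3 hθ ha hM.le hu0 huM (fun S' hS' => ?_) hS
      refine (hu S' hS').trans ?_
      gcongr
      refine lyapunov_mono hxs hS' (hsmall (m + 1)).η_pos.le ?_
      rw [stageEta_eq hP (hqk (m + 1)), hη, stageEta_eq hP (hqk m)]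
      have := hP.etaScale_pos
      have := stageEps_pos hΔ m
      rw [stageEps_succ_succ]
      gcongr
      linarith
    have hG : 0 ≤ stageGrowth P μ Δ (m + 1) := by
      have := hP.growth_nonneg
      have := hsm.η_pos
      unfold stageGrowth
      positivity
    have hint : ∀ S : State d, S.x ∈ domain P W → 0 ≤ u' S ∧ u' S ≤ P.gapBound := by
      intro S hS
      obtain ⟨c1, c2⟩ := cumulative_mem_Icc (stp := step P W ℓ μ η β)
        (D := {S | S.x ∈ domain P W}) (fun S hS i => next_mem hℓ hS μ η) hu0 huM T S hS
      refine ⟨by positivity, ?_⟩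
      rw [hu', div_le_iff₀ hT0]
      linarith
    have he0 := stageEps_pos hΔ m
    refine hle.trans ((ih (θ := θ / 3) (by positivity) (by positivity) (fun S hS => (hint S hS).1)
      (fun S hS => (hint S hS).2) hstep).trans (ENNReal.ofReal_le_ofReal ?_))
    -- The invariant closes because 2/3 + 132/768 ≤ 1 and the next target accuracy is e/2.
    rw [Finset.sum_range_succ, stageEps_succ_succ]
    have : 0 ≤ θ * e := by positivity
    linarith

end DRO

namespace DRO

variable {d n : ℕ} {P : Constants} {W : Set (EuclideanSpace ℝ (Fin d))}
  {ℓ : Fin n → EuclideanSpace ℝ (Fin d) → ℝ}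

/-! ### The constants of the complexity bound -/

namespace Constants

variable (P : Constants)

/-- The bound `R² + lamMax²` for the squared norm on the domain. -/
def normBound : ℝ := P.R ^ 2 + P.lamMax ^ 2

/-- A lower bound for `√(ε_k / μ)` in all stages. -/
def kappa : ℝ := Real.sqrt P.normBound / 2

/-- A constant in the bound for the numbers of iterations. -/
def lengthConst : ℝ :=
  1 + 192 * P.c * P.LF * P.σ + 192 * P.c * P.LF ^ 2 * P.σ ^ 2 / P.kappa + 192 * P.c * P.LF ^ 2

/-- A constant in the bound for the size of the initial minibatch. -/
def batchConst : ℝ := 1 + 48 * P.LF ^ 2 * P.σ ^ 2 / P.kappa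

/-- A constant in the bound for `initBound`. -/
def initConst : ℝ :=
  256 * (4 * (2 * P.sampleBound) ^ 6 / (48 * P.LF ^ 2 * P.σ ^ 2) ^ 2
    + (60 * P.LF ^ 2 * (P.gapBound + 1)) ^ 3 / P.etaScale ^ 3)

/-- A constant in the bound for the total contribution of the Lyapunov function. -/
def failureConst (Δ : ℝ) : ℝ :=
  P.initConst + 2 * Δ * (P.lengthConst * P.growth / P.etaScale ^ 6)

/-- The reciprocal of an upper bound for `√(μ ε_1)` that makes all steps small. -/
def accuracyConst (Δ : ℝ) : ℝ :=
  P.LF / P.σ + P.stepScale / P.etaScale + 1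
    + 4 * (P.gapBound * P.failureConst Δ * (Δ / (2 * P.normBound)))

/-- A constant in the bound for the number of samples. -/
def totalConst : ℝ :=
  (P.batchConst + 4 * P.lengthConst) / P.kappa * (2 * P.normBound) ^ 2

variable {P}

theorem Admissible.normBound_pos (hP : P.Admissible) : 0 < P.normBound := by
  have := hP.lamMax_pos
  unfold normBound
  positivity

theorem Admissible.kappa_pos (hP : P.Admissible) : 0 < P.kappa :=
  half_pos (Real.sqrt_pos.2 hP.normBound_pos)

theorem Admissible.lengthConst_pos (hP : P.Admissible) : 0 < P.lengthConst := by
  have := hP.kappa_pos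
  have := hP.c_ge
  have := hP.one_le_LF
  have := hP.σ_pos
  unfold lengthConst
  positivity

theorem Admissible.batchConst_pos (hP : P.Admissible) : 0 < P.batchConst := by
  have := hP.kappa_pos
  have := hP.σ_pos
  unfold batchConst
  positivity

theorem Admissible.initConst_nonneg (hP : P.Admissible) : 0 ≤ P.initConst := by
  have := hP.etaScale_pos
  have := hP.gapBound_pos
  unfold initConst
  positivity

theorem Admissible.failureConst_nonneg (hP : P.Admissible) {Δ : ℝ} (hΔ : 0 ≤ Δ) :
    0 ≤ P.failureConst Δ := by
  have := hP.initConst_nonneg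
  have := hP.lengthConst_pos
  have := hP.growth_nonneg
  have := hP.etaScale_pos
  unfold failureConst
  positivity

theorem Admissible.one_le_accuracyConst (hP : P.Admissible) {Δ : ℝ} (hΔ : 0 ≤ Δ) :
    1 ≤ P.accuracyConst Δ := by
  have := hP.one_le_LF
  have := hP.σ_pos
  have := hP.stepScale_nonneg
  have := hP.etaScale_pos
  have := hP.gapBound_pos
  have := hP.failureConst_nonneg hΔ
  have := hP.normBound_pos
  have h1 : 0 ≤ P.LF / P.σ + P.stepScale / P.etaScale := by positivity
  have h2 : 0 ≤ 4 * (P.gapBound * P.failureConst Δ * (Δ / (2 * P.normBound))) := by positivity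
  unfold accuracyConst
  linarith

theorem Admissible.totalConst_pos (hP : P.Admissible) : 0 < P.totalConst := by
  have := hP.batchConst_pos
  have := hP.lengthConst_pos
  have := hP.kappa_pos
  have := hP.normBound_pos
  unfold totalConst
  positivity

end Constants

/-! ### Explicit bounds for the failure terms and the number of samples -/

section Bounds

variable (hP : P.Admissible) {μ Δ : ℝ} (hμ : 0 < μ) (hΔ : 0 < Δ)
include hP hμ hΔ

/-- With q = √(μΔ), the minibatch term 1/b² is O(q⁴) and the step size term η³ is O(q³). -/
theorem initBound_le (hq1 : Real.sqrt (μ * Δ) ≤ 1) (hq : Real.sqrt (μ * Δ) * P.LF ≤ P.σ) :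
    initBound P μ Δ ≤ P.initConst * Real.sqrt (μ * Δ) ^ 3 := by
  have h1 : stageEps Δ 1 = Δ := by rw [stageEps_succ Δ 0, pow_zero, div_one]
  have hq0 : 0 < Real.sqrt (μ * Δ) := Real.sqrt_pos.2 (by positivity)
  have hs := hP.etaScale_pos
  have hσ := hP.σ_pos
  have hΛ := hP.one_le_LF
  have hb := le_batchSize (P := P) (μ := μ) (e := Δ)
  have hqq : μ * Δ = Real.sqrt (μ * Δ) ^ 2 := (Real.sq_sqrt (by positivity)).symm
  rw [initBound, h1, stageEta_eq hP hq]
  set b : ℝ := ((batchSize P μ Δ : ℕ) : ℝ)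
  set q := Real.sqrt (μ * Δ)
  have h2 : 4 * (2 * P.sampleBound) ^ 6 / b ^ 2
      ≤ 4 * (2 * P.sampleBound) ^ 6 / (48 * P.LF ^ 2 * P.σ ^ 2) ^ 2 * q ^ 3 := by
    calc 4 * (2 * P.sampleBound) ^ 6 / b ^ 2
        ≤ 4 * (2 * P.sampleBound) ^ 6 / (48 * P.LF ^ 2 * P.σ ^ 2 / (μ * Δ)) ^ 2 := by gcongr
      _ = 4 * (2 * P.sampleBound) ^ 6 / (48 * P.LF ^ 2 * P.σ ^ 2) ^ 2 * (q ^ 3 * q) := by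
          rw [hqq]
          field_simp
      _ ≤ _ := by
          gcongr
          exact mul_le_of_le_one_right (by positivity) hq1
  rw [div_pow, mul_div_assoc', Constants.initConst]
  calc _ ≤ 256 * (4 * (2 * P.sampleBound) ^ 6 / (48 * P.LF ^ 2 * P.σ ^ 2) ^ 2 * q ^ 3
        + (60 * P.LF ^ 2 * (P.gapBound + 1)) ^ 3 * q ^ 3 / P.etaScale ^ 3) := by gcongr
    _ = _ := by ring

/-- With q_k = √(με_k), T_k η_k⁶ = O(q_k⁶/(μq_k)) = O(q_k³ε_k); the factor ε_k makes the sum over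
the stages bounded. -/
theorem stageGrowth_le (hμ1 : μ ≤ 1) (hq1 : Real.sqrt (μ * Δ) ≤ 1)
    (hq : Real.sqrt (μ * Δ) * P.LF ≤ P.σ) {k : ℕ}
    (hκ : P.kappa * μ ≤ Real.sqrt (μ * stageEps Δ (k + 1))) :
    stageGrowth P μ Δ (k + 1)
      ≤ P.lengthConst * P.growth / P.etaScale ^ 6 * Real.sqrt (μ * Δ) ^ 3 * stageEps Δ (k + 1) := by
  have he := stageEps_pos hΔ k
  have hs := hP.etaScale_pos
  have hG := hP.growth_nonneg
  have hL := hP.lengthConst_pos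
  have hΛ := hP.one_le_LF
  have hle : Real.sqrt (μ * stageEps Δ (k + 1)) ≤ Real.sqrt (μ * Δ) :=
    Real.sqrt_le_sqrt (mul_le_mul_of_nonneg_left (stageEps_le hΔ k) hμ.le)
  have hT := stageLength_le hP hμ he hμ1 hP.kappa_pos (hle.trans hq1) hκ
  have hq0 : 0 < Real.sqrt (μ * stageEps Δ (k + 1)) := Real.sqrt_pos.2 (by positivity)
  have hqq : μ * stageEps Δ (k + 1) = Real.sqrt (μ * stageEps Δ (k + 1)) ^ 2 :=
    (Real.sq_sqrt (by positivity)).symm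
  rw [stageGrowth, stageEta_eq hP ((mul_le_mul_of_nonneg_right hle (by linarith)).trans hq)]
  change _ ≤ P.lengthConst / _ at hT
  set q := Real.sqrt (μ * stageEps Δ (k + 1))
  set q₁ := Real.sqrt (μ * Δ)
  calc _ ≤ P.lengthConst / (μ * q) * (P.growth * (q / P.etaScale) ^ 6) := by gcongr
    _ = P.lengthConst * P.growth / P.etaScale ^ 6 * q ^ 3 * (q ^ 2 / μ) := by field_simp
    _ = P.lengthConst * P.growth / P.etaScale ^ 6 * q ^ 3 * stageEps Δ (k + 1) := by
        rw [← hqq, mul_div_cancel_left₀ _ hμ.ne']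
    _ ≤ _ := by gcongr

theorem initBound_add_sum_stageGrowth_le {Δ' : ℝ} (hΔ' : Δ ≤ Δ') (hμ1 : μ ≤ 1)
    (hq1 : Real.sqrt (μ * Δ) ≤ 1) (hq : Real.sqrt (μ * Δ) * P.LF ≤ P.σ) {m : ℕ}
    (hκ : ∀ k < m, P.kappa * μ ≤ Real.sqrt (μ * stageEps Δ (k + 1))) :
    initBound P μ Δ + ∑ k ∈ Finset.range m, stageGrowth P μ Δ (k + 1)
      ≤ P.failureConst Δ' * Real.sqrt (μ * Δ) ^ 3 := by
  have hs := hP.etaScale_pos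
  have hG := hP.growth_nonneg
  have hL := hP.lengthConst_pos
  have h1 := initBound_le hP hμ hΔ hq1 hq
  have h2 : ∑ k ∈ Finset.range m, stageGrowth P μ Δ (k + 1)
      ≤ P.lengthConst * P.growth / P.etaScale ^ 6 * Real.sqrt (μ * Δ) ^ 3 * (2 * Δ') := by
    calc _ ≤ ∑ k ∈ Finset.range m, P.lengthConst * P.growth / P.etaScale ^ 6
          * Real.sqrt (μ * Δ) ^ 3 * stageEps Δ (k + 1) :=
          Finset.sum_le_sum fun k hk =>
            stageGrowth_le hP hμ hΔ hμ1 hq1 hq (hκ k (Finset.mem_range.1 hk))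
      _ = P.lengthConst * P.growth / P.etaScale ^ 6 * Real.sqrt (μ * Δ) ^ 3
          * ∑ k ∈ Finset.range m, stageEps Δ (k + 1) := by rw [Finset.mul_sum]
      _ ≤ _ := by
          have := sum_stageEps_le hΔ.le m
          gcongr
          linarith
  rw [Constants.failureConst]
  linarith

theorem samples_le (hμ1 : μ ≤ 1) (hq1 : Real.sqrt (μ * Δ) ≤ 1) {m : ℕ}
    (hκ : ∀ k ≤ m, P.kappa * μ ≤ Real.sqrt (μ * stageEps Δ (k + 1))) :
    (batchSize P μ (stageEps Δ 1) : ℝ)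
        + ∑ k ∈ Finset.range (m + 1), (stageLength P μ (stageEps Δ (k + 1)) : ℝ)
      ≤ (P.batchConst + 4 * P.lengthConst) / P.kappa / μ ^ 2 := by
  have hL := hP.lengthConst_pos
  have hB := hP.batchConst_pos
  have hk := hP.kappa_pos
  have hle : ∀ k, Real.sqrt (μ * stageEps Δ (k + 1)) ≤ 1 := fun k =>
    (Real.sqrt_le_sqrt (mul_le_mul_of_nonneg_left (stageEps_le hΔ k) hμ.le)).trans hq1
  have hanti : Real.sqrt (μ * stageEps Δ (m + 1)) ≤ Real.sqrt (μ * stageEps Δ 1) := by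
    rw [stageEps_succ Δ 0, pow_zero, div_one]
    exact Real.sqrt_le_sqrt (mul_le_mul_of_nonneg_left (stageEps_le hΔ m) hμ.le)
  have hq0 : 0 < Real.sqrt (μ * stageEps Δ (m + 1)) :=
    Real.sqrt_pos.2 (mul_pos hμ (stageEps_pos hΔ m))
  have h1 : (batchSize P μ (stageEps Δ 1) : ℝ)
      ≤ P.batchConst / (μ * Real.sqrt (μ * stageEps Δ (m + 1))) :=
    (batchSize_le hP hμ (stageEps_pos hΔ 0) hμ1 hk (hle 0) (hκ 0 (Nat.zero_le m))).trans
      (by gcongr; exact le_rfl)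
  have h2 : ∑ k ∈ Finset.range (m + 1), (stageLength P μ (stageEps Δ (k + 1)) : ℝ)
      ≤ 4 * P.lengthConst / (μ * Real.sqrt (μ * stageEps Δ (m + 1))) := by
    calc _ ≤ ∑ k ∈ Finset.range (m + 1),
          P.lengthConst / μ * (1 / Real.sqrt (μ * stageEps Δ (k + 1))) := by
          refine Finset.sum_le_sum fun k hk' => ?_
          have := stageLength_le hP hμ (stageEps_pos hΔ k) hμ1 hk (hle k)
            (hκ k (Nat.lt_succ_iff.1 (Finset.mem_range.1 hk')))
          rw [div_mul_div_comm, mul_one]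
          exact this
      _ = P.lengthConst / μ
          * ∑ k ∈ Finset.range (m + 1), 1 / Real.sqrt (μ * stageEps Δ (k + 1)) := by
          rw [Finset.mul_sum]
      _ ≤ P.lengthConst / μ * (4 / Real.sqrt (μ * stageEps Δ (m + 1))) := by
          have := sum_inv_sqrt_stageEps_le hμ hΔ m
          gcongr
      _ = _ := by rw [div_mul_div_comm, mul_comm P.lengthConst]
  calc _ ≤ (P.batchConst + 4 * P.lengthConst) / (μ * Real.sqrt (μ * stageEps Δ (m + 1))) := by
        rw [add_div]
        exact add_le_add h1 h2
    _ ≤ (P.batchConst + 4 * P.lengthConst) / (μ * (P.kappa * μ)) := by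
        have := hκ m le_rfl
        gcongr
    _ = _ := by field_simp

end Bounds

/-- There is a stage with target accuracy between `ε / 8` and `ε / 4`. -/
theorem exists_stageEps_near {ε Δ : ℝ} (hε : 0 < ε) (hΔ : ε ≤ Δ) :
    ∃ m : ℕ, ε / 8 ≤ stageEps Δ (m + 1) ∧ stageEps Δ (m + 1) ≤ ε / 4 ∧
      ((m + 1 : ℕ) : ℝ) ≤ 4 * (1 + Real.logb 2 (Δ / ε)) := by
  have hΔ0 : 0 < Δ := hε.trans_le hΔ
  have h1 : 1 ≤ Δ / ε := (one_le_div hε).2 hΔ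
  -- m is the largest exponent with 2^m ≤ 4Δ/ε, and the stage sought is the next one.
  obtain ⟨m, h2, h3⟩ := exists_nat_pow_near (x := 4 * (Δ / ε)) (y := 2) (by linarith) one_lt_two
  refine ⟨m + 1, ?_, ?_, ?_⟩
  · rw [stageEps_succ, pow_succ, le_div_iff₀ (by positivity)]
    have : 2 ^ m * ε ≤ 4 * (Δ / ε) * ε := by gcongr
    rw [mul_assoc, div_mul_cancel₀ _ hε.ne'] at this
    linarith
  · rw [stageEps_succ, div_le_iff₀ (by positivity)]
    have : 4 * (Δ / ε) * ε ≤ 2 ^ (m + 1) * ε := by gcongr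
    rw [mul_assoc, div_mul_cancel₀ _ hε.ne'] at this
    linarith
  · have h4 : 0 ≤ Real.logb 2 (Δ / ε) := Real.logb_nonneg one_lt_two h1
    have h5 : (m : ℝ) ≤ Real.logb 2 (4 * (Δ / ε)) := by
      rw [Real.le_logb_iff_rpow_le one_lt_two (by positivity), Real.rpow_natCast]
      exact h2
    have h6 : Real.logb 2 4 = 2 := by
      rw [show (4 : ℝ) = 2 ^ (2 : ℝ) by norm_num, Real.logb_rpow (by norm_num) (by norm_num)]
    rw [Real.logb_mul (by norm_num) (by positivity), h6] at h5
    push_cast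
    linarith

/-- The objective exceeds its infimum by at most the gap of the regularised objective, up to the
size of the regularisation. -/
theorem F_sub_sInf_le [NeZero n] (hP : P.Admissible) (hℓ : ConvexProblem P W ℓ) {μ : ℝ}
    (hμ : 0 ≤ μ) {xs x : Point d} (hxs : IsMinimizer P W ℓ μ xs) :
    F P ℓ x - sInf (F P ℓ '' domain P W) ≤ gap P ℓ μ xs x + μ * P.normBound / 2 := by
  have h : Fmu P ℓ μ xs - μ * P.normBound / 2 ≤ sInf (F P ℓ '' domain P W) := by
    refine le_csInf ⟨_, Set.mem_image_of_mem _ hxs.mem⟩ ?_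
    rintro _ ⟨y, hy, rfl⟩
    have h1 := hxs.le y hy
    have h2 : μ * ‖y‖ ^ 2 ≤ μ * P.normBound :=
      mul_le_mul_of_nonneg_left (hℓ.norm_sq_le hP hy) hμ
    unfold Fmu at h1 ⊢
    linarith
  have h3 : 0 ≤ μ * ‖x‖ ^ 2 / 2 := by positivity
  unfold gap
  rw [show Fmu P ℓ μ x = F P ℓ x + μ * ‖x‖ ^ 2 / 2 from rfl]
  linarith

end DRO

namespace DRO

variable {d n : ℕ} {P : Constants} {W : Set (EuclideanSpace ℝ (Fin d))}
  {ℓ : Fin n → EuclideanSpace ℝ (Fin d) → ℝ} [NeZero n]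

/-! ### The output of the method -/

theorem F_sub_sInf_nonneg (hP : P.Admissible) (hℓ : ConvexProblem P W ℓ) {x : Point d}
    (hx : x ∈ domain P W) : 0 ≤ F P ℓ x - sInf (F P ℓ '' domain P W) := by
  refine sub_nonneg.2 (csInf_le ⟨0, ?_⟩ (Set.mem_image_of_mem _ hx))
  rintro _ ⟨y, hy, rfl⟩
  exact hℓ.F_nonneg hP hy

theorem integrable_rascdro (hP : P.Admissible) (hℓ : ConvexProblem P W ℓ) {μ Δ : ℝ} {x₁ : Point d}
    (hx : x₁ ∈ domain P W) (m : ℕ) :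
    Integrable (fun o : Point d × ℕ => F P ℓ o.1)
      (rascdro P W ℓ μ Δ x₁ (m + 1)).toMeasure := by
  refine integrable_of_bounded_on_support (M := P.lamMax * (P.C / P.lam₀) + P.lamMax * P.ρ)
    fun o ho => ?_
  have h := (mem_support_rascdro hℓ hx m ho).1
  rw [Real.norm_of_nonneg (hℓ.F_nonneg hP h)]
  exact hℓ.F_le hP h

/-- If the first step size is small, then the output of the first stage with target accuracy at
most `ε / 4` has mean accuracy `ε`. -/
theorem integral_rascdro_le (hP : P.Admissible) (hℓ : ConvexProblem P W ℓ) {ε Δ Δ' : ℝ}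
    (hε : 0 < ε) (hμ1 : P.mu ε ≤ 1) (hΔ : 0 < Δ) (hΔ' : Δ ≤ Δ') {x₁ : Point d}
    (hx : x₁ ∈ domain P W)
    (hgap : Fmu P ℓ (P.mu ε) x₁ - sInf (Fmu P ℓ (P.mu ε) '' domain P W) ≤ Δ)
    (hq : Real.sqrt (P.mu ε * Δ) * P.accuracyConst Δ' ≤ 1) {m : ℕ}
    (hm : stageEps Δ (m + 1) ≤ ε / 4)
    (hκ : ∀ k ≤ m, P.kappa * P.mu ε ≤ Real.sqrt (P.mu ε * stageEps Δ (k + 1))) :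
    ∫ o, (F P ℓ o.1 - sInf (F P ℓ '' domain P W))
      ∂(rascdro P W ℓ (P.mu ε) Δ x₁ (m + 1)).toMeasure ≤ ε := by
  have hD := hP.normBound_pos
  have hμD : P.mu ε * P.normBound = ε / 2 := by
    rw [Constants.mu, ← Constants.normBound]
    field_simp
  have hμ : 0 < P.mu ε := by
    rw [Constants.mu, ← Constants.normBound]
    positivity
  set μ := P.mu ε
  obtain ⟨xs, hxs1, hxs2⟩ := hℓ.exists_minimizer hP μ ⟨x₁, hx⟩
  have hxs : IsMinimizer P W ℓ μ xs := ⟨hxs1, hxs2⟩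
  have hinf : sInf (Fmu P ℓ μ '' domain P W) = Fmu P ℓ μ xs := by
    refine IsLeast.csInf_eq ⟨Set.mem_image_of_mem _ hxs1, ?_⟩
    rintro _ ⟨y, hy, rfl⟩
    exact hxs2 y hy
  rw [hinf] at hgap
  have hs := hP.etaScale_pos
  have hσ := hP.σ_pos
  have hΛ := hP.one_le_LF
  have hsc := hP.stepScale_nonneg
  have hM := hP.gapBound_pos
  have hfail := hP.failureConst_nonneg (hΔ.le.trans hΔ')
  have hq0 := Real.sqrt_nonneg (μ * Δ)
  have hqq : Real.sqrt (μ * Δ) ^ 2 = μ * Δ := Real.sq_sqrt (mul_pos hμ hΔ).le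
  set q := Real.sqrt (μ * Δ)
  have p1 : 0 ≤ q * (P.LF / P.σ) := by positivity
  have p2 : 0 ≤ q * (P.stepScale / P.etaScale) := by positivity
  have p3 : 0 ≤ q * (4 * (P.gapBound * P.failureConst Δ' * (Δ' / (2 * P.normBound)))) := by
    have := hΔ.le.trans hΔ'
    positivity
  rw [Constants.accuracyConst, mul_add, mul_add, mul_add, mul_one] at hq
  have hq1 : q ≤ 1 := by linarith
  have hq2 : q * P.LF ≤ P.σ := by
    rw [← div_le_one hσ, ← mul_div_assoc']
    linarith
  have hq3 : P.stepScale * q ≤ P.etaScale := by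
    rw [mul_comm, ← div_le_one hs, ← mul_div_assoc']
    linarith
  -- One factor q² = μΔ of q³ is O(ε); the spare factor q, made small through `accuracyConst`,
  -- brings the constant down to 1/4.
  have hF : P.gapBound * (initBound P μ Δ + ∑ k ∈ Finset.range m, stageGrowth P μ Δ (k + 1))
      ≤ ε / 4 := by
    have h1 := initBound_add_sum_stageGrowth_le hP hμ hΔ hΔ' hμ1 hq1 hq2
      fun k (hk : k < m) => hκ k hk.le
    have h2 : μ * Δ ≤ ε * (Δ' / (2 * P.normBound)) := by
      calc μ * Δ ≤ μ * Δ' := by gcongr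
        _ = μ * P.normBound * 2 * (Δ' / (2 * P.normBound)) := by field_simp
        _ = _ := by rw [hμD]; ring
    calc _ ≤ P.gapBound * (P.failureConst Δ' * q ^ 3) := by gcongr
      _ = P.gapBound * P.failureConst Δ' * q * (μ * Δ) := by rw [← hqq]; ring
      _ ≤ P.gapBound * P.failureConst Δ' * q * (ε * (Δ' / (2 * P.normBound))) := by gcongr
      _ = q * (4 * (P.gapBound * P.failureConst Δ' * (Δ' / (2 * P.normBound)))) * (ε / 4) := by
          ring
      _ ≤ 1 * (ε / 4) := by gcongr; linarith
      _ = ε / 4 := one_mul _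
  have hstages := expectation_stages_le hP hℓ hμ hμ1 hΔ hxs hx hgap hq2 hq3 m
    (u := fun S => gap P ℓ μ xs S.x) (θ := 1) (a := 0) zero_le_one le_rfl
    (fun S hS => hxs.gap_nonneg hS) (fun S hS => gap_le hP hℓ hxs hμ.le hμ1 hS) fun S hS => by
      have h1 := lyapunov_nonneg hxs hS
        (smallStep_stage hP hμ hμ1 (stageEps_pos hΔ m)
          ((mul_le_mul_of_nonneg_right (Real.sqrt_le_sqrt
            (mul_le_mul_of_nonneg_left (stageEps_le hΔ m) hμ.le)) (by linarith)).trans hq2)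
          ((mul_le_mul_of_nonneg_left (Real.sqrt_le_sqrt
            (mul_le_mul_of_nonneg_left (stageEps_le hΔ m) hμ.le)) hsc).trans hq3)).η_pos.le
      have h2 : gap P ℓ μ xs S.x ≤ merit P ℓ μ xs S := by
        unfold merit
        exact le_add_of_nonneg_right (by positivity)
      have h3 := mul_nonneg hM.le h1
      linarith
  refine integral_le_of_expectation_le hε.le
    ((integrable_rascdro hP hℓ hx m).sub (integrable_const _))
    (fun o ho => F_sub_sInf_nonneg hP hℓ (mem_support_rascdro hℓ hx m ho).1) ?_
  rw [expectation_rascdro Δ x₁ m fun x => ENNReal.ofReal (F P ℓ x - sInf (F P ℓ '' domain P W))]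
  calc _ ≤ expectation (stages P W ℓ μ Δ x₁ m) fun S =>
        ENNReal.ofReal (gap P ℓ μ xs S.1.x) + ENNReal.ofReal (ε / 4) := by
        refine expectation_mono fun S hS => ?_
        have h := (mem_support_stages hℓ hx m S hS).1
        rw [← ENNReal.ofReal_add (hxs.gap_nonneg h) (by positivity)]
        refine ENNReal.ofReal_le_ofReal ((F_sub_sInf_le hP hℓ hμ.le hxs).trans ?_)
        linarith
    _ = expectation (stages P W ℓ μ Δ x₁ m) (fun S => ENNReal.ofReal (gap P ℓ μ xs S.1.x))
        + ENNReal.ofReal (ε / 4) := by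
        simp only [expectation, mul_add, ENNReal.tsum_add, ENNReal.tsum_mul_right, PMF.tsum_coe,
          one_mul]
    -- 2ε_K ≤ ε/2 for the good part and ε/4 for the failures; the separate ε/4 is the regularisation
    -- error.
    _ ≤ ENNReal.ofReal (3 * ε / 4) + ENNReal.ofReal (ε / 4) := by
        refine add_le_add (hstages.trans (ENNReal.ofReal_le_ofReal ?_)) le_rfl
        linarith
    _ = ENNReal.ofReal ε := by
        rw [← ENNReal.ofReal_add (by positivity) (by positivity)]
        congr 1
        ring

end DRO

end

/-! ### Choice of the constants and conclusion -/

theorem mainTheorem3 (P : DRO.Constants) (hP : P.Admissible) (Δmax : ℝ) :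
    ∃ A : ℝ, 0 < A ∧ ∃ B : ℝ, 0 < B ∧ ∃ ε₀ : ℝ, 0 < ε₀ ∧
      ∀ (d n : ℕ) [NeZero n] (W : Set (EuclideanSpace ℝ (Fin d)))
        (ℓ : Fin n → EuclideanSpace ℝ (Fin d) → ℝ), DRO.ConvexProblem P W ℓ →
      ∀ x₁ ∈ DRO.domain P W, ∀ ε : ℝ, 0 < ε → ε ≤ ε₀ →
      ∀ Δ : ℝ, ε ≤ Δ → Δ ≤ Δmax →
        DRO.Fmu P ℓ (P.mu ε) x₁ - sInf (DRO.Fmu P ℓ (P.mu ε) '' DRO.domain P W) ≤ Δ →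
      ∃ K : ℕ, 1 ≤ K ∧ (K : ℝ) ≤ A * (1 + Real.logb 2 (Δ / ε)) ∧
        Integrable (fun o : DRO.Point d × ℕ => DRO.F P ℓ o.1)
          (DRO.rascdro P W ℓ (P.mu ε) Δ x₁ K).toMeasure ∧
        ∫ o, (DRO.F P ℓ o.1 - sInf (DRO.F P ℓ '' DRO.domain P W))
          ∂(DRO.rascdro P W ℓ (P.mu ε) Δ x₁ K).toMeasure ≤ ε ∧
        ∀ o ∈ (DRO.rascdro P W ℓ (P.mu ε) Δ x₁ K).support, (o.2 : ℝ) ≤ B / ε ^ 2 := by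
  have hD := hP.normBound_pos
  have hΔ' : 0 < max Δmax 1 := lt_max_of_lt_right one_pos
  have hA1 := hP.one_le_accuracyConst hΔ'.le
  have hA : 0 < P.accuracyConst (max Δmax 1) := one_pos.trans_le hA1
  -- The first bound on ε gives μ ≤ 1, the second √(μΔ) · `accuracyConst` ≤ 1 for every admissible
  -- Δ. The maximum with 1 keeps ε₀ well defined and positive when Δmax is not positive.
  refine ⟨4, by norm_num, P.totalConst, hP.totalConst_pos, min (2 * P.normBound)
    (2 * P.normBound / (max Δmax 1 * P.accuracyConst (max Δmax 1) ^ 2)), by positivity, ?_⟩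
  intro d n _ W ℓ hℓ x₁ hx ε hε hε₀ Δ hΔε hΔmax hgap
  have hΔ : 0 < Δ := hε.trans_le hΔε
  have hΔ1 : Δ ≤ max Δmax 1 := hΔmax.trans (le_max_left _ _)
  have hmu : P.mu ε = ε / (2 * P.normBound) := rfl
  have hμ : 0 < P.mu ε := by
    rw [hmu]
    positivity
  have hμ1 : P.mu ε ≤ 1 := by
    rw [hmu, div_le_one (by positivity)]
    exact hε₀.trans (min_le_left _ _)
  have hq : Real.sqrt (P.mu ε * Δ) * P.accuracyConst (max Δmax 1) ≤ 1 := by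
    rw [← le_div_iff₀ hA]
    refine Real.sqrt_le_iff.2 ⟨by positivity, ?_⟩
    have h := hε₀.trans (min_le_right _ _)
    rw [le_div_iff₀ (by positivity)] at h
    rw [hmu, div_pow, one_pow, div_mul_eq_mul_div, div_le_div_iff₀ (by positivity) (by positivity)]
    calc ε * Δ * P.accuracyConst (max Δmax 1) ^ 2
        ≤ ε * max Δmax 1 * P.accuracyConst (max Δmax 1) ^ 2 := by gcongr
      _ ≤ _ := by linarith
  obtain ⟨m, hm1, hm2, hK⟩ := DRO.exists_stageEps_near hε hΔε
  have hκ : ∀ k ≤ m, P.kappa * P.mu ε ≤ Real.sqrt (P.mu ε * DRO.stageEps Δ (k + 1)) := by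
    intro k hk
    refine Real.le_sqrt_of_sq_le ?_
    have h1 : ε / 8 ≤ DRO.stageEps Δ (k + 1) := by
      refine hm1.trans ?_
      rw [DRO.stageEps_succ, DRO.stageEps_succ]
      gcongr
      norm_num
    -- With D = `normBound`, μ = ε/(2D) and κ = √D/2 give κ²μ = ε/8, the lower bound for ε_K.
    calc (P.kappa * P.mu ε) ^ 2 = P.mu ε * (ε / 8) := by
          rw [mul_pow, DRO.Constants.kappa, div_pow, Real.sq_sqrt hD.le, hmu]
          field_simp
          norm_num
      _ ≤ _ := by gcongr
  have hq1 : Real.sqrt (P.mu ε * Δ) ≤ 1 :=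
    (le_mul_of_one_le_right (Real.sqrt_nonneg _) hA1).trans hq
  refine ⟨m + 1, Nat.le_add_left 1 m, hK, DRO.integrable_rascdro hP hℓ hx m,
    DRO.integral_rascdro_le hP hℓ hε hμ1 hΔ hΔ1 hx hgap hq hm2 hκ, fun o ho => ?_⟩
  rw [(DRO.mem_support_rascdro hℓ hx m ho).2]
  push_cast
  refine (DRO.samples_le hP hμ hΔ hμ1 hq1 hκ).trans (le_of_eq ?_)
  rw [hmu, DRO.Constants.totalConst, div_pow, div_div_eq_mul_div]
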